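/- Let $\mathbb C(q)$ be the field of rational functions, $h_k=q^k-q^{-k}$, $h=h_1$, $[2]_q=q+q^{-1}$, $[a,b]_v=ab-v\,ba$, $[a,b]=ab-ba$, $\{a,b\}_+=ab+ba$. Throughout, $i\in\{1,3\}$ is arbitrary and $j$ is defined by $\{i,j\}=\{1,3\}$. Let $\mathcal A_{q,4}$ be the associative unital $\mathbb C(q)$-algebra with generators $u_1,u_2,u_3$, $z_{12}=z_{21}$, $z_{23}=z_{32}$, $z_{13}=z_{31}$ and relations * $u_kz_{kl}=z_{kl}u_k$ for all $k\neq l$ in $\{1,2,3\}$, and $u_1u_3=u_3u_1$; * $[u_k,[u_k,u_l]_{q^2}]_{q^{-2}}=h\,u_kz_{kl}$ for $|k-l|=1$; * $[u_i,[u_i,z_{j2}]_{q^2}]_{q^{-2}}=h\,u_iz_{13}$; * $(q+q^{-1})[z_{12},z_{23}]=[u_2,[z_{12},u_3]_{q^{-2}}]_{q^2}-[u_2,[z_{23},u_1]_{q^{-2}}]_{q^2}$; * $[u_2,z_{13}]+[z_{i2},z_{j2}]=h(z_{j2}u_iu_2-u_2u_iz_{j2})$; * $2[z_{i2},[z_{i2},u_j]_{q^{-2}}]_{q^2}+[z_{i2},[u_i,z_{2j}]_{q^{-2}}]_{q^2}+[u_i,[z_{i2},z_{2j}]_{q^{-2}}]_{q^2}$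 $=h\big(\{z_{i2},\,z_{13}-u_iu_ju_2-u_2u_iu_j\}_++(q^2+1+q^{-2})(u_iu_2u_jz_{i2}+z_{i2}u_ju_2u_i)-u_ju_2u_iz_{i2}-z_{i2}u_iu_2u_j\big)$; * $[z_{i2},z_{13}]-[u_i,[u_2,[u_j,z_{i2}]]]=h(u_iz_{j2}z_{i2}-z_{i2}z_{j2}u_i)+h^2(u_iu_2u_jz_{i2}-z_{i2}u_ju_2u_i)$. Put $Y_k=u_k$ ($k=1,2,3$), $Z_{2i}=(1-q^2)^{-1}z_{2i}$, $Z_{13}=(1-q^2)^{-2}z_{13}$, $$Y_{2i}=\frac{u_iu_2-q^{-2}u_2u_i+q^{-1}z_{i2}}{q^2-q^{-2}},\qquad Z_{i2j}=\frac{[u_j,z_{2i}]_{q^{-2}}+q^{-1}z_{13}}{(1-q^4)(1-q^{-2})},$$ $$Y_{13}=\frac{[u_j,Y_{2i}]_{q^{-2}}}{q^2-q^{-2}}-\frac{Z_{j2i}}{[2]_q},\qquad Z_{1232}=\frac{qZ_{2j}Y_{2i}-q^{-1}Y_{2i}Z_{2j}}{q-q^{-1}}.$$ **(1)** The last two elements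 do not depend on the choice of $i\in\{1,3\}$. **(2)** The following relations hold in $\mathcal A_{q,4}$, and $\mathcal A_{q,4}$ is presented by the twelve generators $Y_\alpha,Z_\beta$ with these relations: $$\begin{aligned} &Y_{2i}Y_2=q^2Y_2Y_{2i},\quad Z_{2i}Y_2=Y_2Z_{2i},\quad Z_{1232}Y_2=q^2Y_2Z_{1232},\\ &Y_{13}Y_2=Y_2Y_{13}+h_2Y_{21}Y_{23}+h_1Z_{1232},\\ &Y_2Z_{13}=q^2Z_{13}Y_2+h_1(Y_2Z_{123}+q^2Y_2Z_{321}-q^{-2}Y_{23}Z_{21}-qZ_{21}Z_{23}-Y_{21}Z_{23})-h_1h_2Z_{1232},\\ &Z_{i2j}Y_2=Y_2Z_{i2j}+q^{-1}h_1(Y_{2j}Z_{2i}-Z_{1232}),\\ &Y_iY_2=q^{-2}Y_2Y_i+h_2Y_{2i}+h_1Z_{2i},\quad Y_{2i}Z_{13}=Z_{13}Y_{2i}+h_1(Y_{2i}Z_{i2j}-Z_{2i}Y_{13}),\\ &Y_{23}Y_{21}=Y_{21}Y_{23},\quad Z_{2i}Y_{2i}=Y_{2i}Z_{2i},\quad Y_{13}Y_{2i}=q^2Y_{2i}Y_{13},\quad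 Z_{j2i}Y_{2i}=Y_{2i}Z_{j2i},\\ &Z_{i2j}Y_{2i}=q^2Y_{2i}Z_{i2j},\quad Z_{1232}Y_{2i}=Y_{2i}Z_{1232},\quad Y_iY_{2i}=q^2Y_{2i}Y_i,\\ &Y_jY_{2i}=q^{-2}Y_{2i}Y_j+h_2Y_{13}+h_1Z_{j2i},\quad Z_{2j}Y_{2i}=q^{-2}Y_{2i}Z_{2j}+q^{-1}h_1Z_{1232},\\ &Z_{23}Z_{21}=Z_{21}Z_{23}+h_1(Y_2Z_{123}-Y_2Z_{321}+q^{-2}Y_{21}Z_{23}-q^{-2}Y_{23}Z_{21}),\\ &Y_{13}Z_{2i}=Z_{2i}Y_{13}+qh_1Y_{2i}Z_{i2j},\\ &Z_{2i}Z_{j2i}=q^2Z_{j2i}Z_{2i}+h_1(Z_{2i}Y_{13}-Y_{2i}Z_{i2j}-qY_{2i}Z_{13}),\\ &Z_{i2j}Z_{2i}=q^2Z_{2i}Z_{i2j}+h_1(Z_{2i}Y_{13}-Y_{2i}Z_{i2j}-Z_{1232}Y_i),\\ &Z_{1232}Z_{2i}=Z_{2i}Z_{1232}+h_1(q^2Y_2Y_{2i}Z_{i2j}+q^{-2}Y_{2i}Z_{1232}-q^{-2}Y_{21}Y_{23}Z_{2i}),\\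 &Z_{13}Z_{2i}=Z_{2i}Z_{13}+h_1q^{-2}(-qY_2Z_{j2i}Y_i+q^{-1}Y_{2i}Z_{2j}Y_i-Y_{2i}Z_{13}+Z_{2i}Z_{j2i})\\ &\qquad\qquad+h_1^2q^{-2}(Z_{1232}Y_i+Y_{2i}Z_{i2j}-Z_{2i}Y_{13}),\\ &Y_iZ_{2j}=q^{-2}Z_{2j}Y_i+h_1Z_{13}+h_2Z_{j2i},\quad Z_{13}Y_{13}=q^2Y_{13}Z_{13}-qh_1Z_{123}Z_{321},\\ &Y_iZ_{2i}=Z_{2i}Y_i,\quad Z_{i2j}Y_{13}=Y_{13}Z_{i2j},\quad Z_{1232}Y_{13}=q^{-2}Y_{13}Z_{1232},\\ &Y_iY_{13}=q^2Y_{13}Y_i,\quad Z_{321}Z_{123}=Z_{123}Z_{321},\\ &Z_{1232}Z_{i2j}=Z_{i2j}Z_{1232}+h_1(Y_{21}Y_{23}Z_{i2j}-Y_{2j}Z_{2i}Y_{13}+q^{-2}Y_{13}Z_{1232}),\\ &Z_{i2j}Z_{13}=Z_{13}Z_{i2j}+h_1(Y_{13}Z_{13}-Z_{123}Z_{321}+q^{-1}Y_{2j}Z_{j2i}Y_i-q^{-1}Z_{2j}Y_{13}Y_i),\\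 &Z_{1232}Z_{13}=Z_{13}Z_{1232}+h_1(q^{-1}Y_2Y_{13}Z_{123}+qY_2Y_{13}Z_{321}+Y_2Z_{123}Z_{321}-q^{-1}Y_{21}Y_{23}Z_{123}\\ &\qquad\qquad-q^{-1}Y_{21}Y_{23}Z_{321}-Z_{21}Z_{23}Y_{13})+h_1^2(q^{-2}Y_{23}Z_{21}Y_{13}-q^{-4}Y_{13}Z_{1232}),\\ &Y_iZ_{1232}=Z_{1232}Y_i-h_1q(Y_{2i}Z_{i2j}-Z_{2i}Y_{13}),\\ &Y_iZ_{i2j}=Z_{i2j}Y_i,\quad Y_iZ_{j2i}=q^2Z_{j2i}Y_i,\quad Z_{13}Y_i=Y_iZ_{13},\quad Y_3Y_1=Y_1Y_3. \end{aligned}$$ **(3)** $\mathcal A_{q,4}$ is PBW on the totally ordered set $$X=\{Y_2<Y_{21}<Y_{23}<Z_{21}<Z_{23}<Y_{13}<Z_{123}<Z_{321}<Z_{1232}<Z_{13}<Y_3<Y_1\},$$ that is, $X$ generates $\mathcal A_{q,4}$ and the ordered monomials $M$ in $X$ form a basis. **(4)** For $x<x'$ in $X$ write $x'x=\sum_Mc^M_{x,x'}M$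 in this basis. The algebra is optimal specializable: every $c^M_{x,x'}\in\mathbb C(q)$ is defined at $q=1$, with value $1$ if $M=xx'$ and $0$ otherwise. Its specialization, the $\mathbb C(q)$-algebra generated by $X$ with relations $x'x=\sum_Mc^M_{x,x'}(1)M$, is the polynomial algebra $\mathbb C(q)[X]$ in twelve variables. **(5)** There is a unique skew-symmetric $\mathbb C(q)$-bilinear bracket on $\mathbb C(q)[X]$ that satisfies the Leibniz rule in both arguments and $\{x',x\}=\sum_M\frac{d c^M_{x,x'}}{dq}\big|_{q=1}M$ for all $x<x'$ in $X$. It is a Poisson bracket, and it is given on generators by the following formulae (the brackets of the pairs of generators not shown are zero): $$\begin{aligned} &\{Y_2,Y_i\}=2Y_2Y_i-4Y_{2i}-2Z_{2i},\quad \{Y_2,Y_{2i}\}=-2Y_{2i}Y_2,\quad \{Y_2,Y_{13}\}=-4Y_{21}Y_{23}-2Z_{1232},\\ &\{Y_2,Z_{i2j}\}=-2Z_{2i}Y_{2j}+2Z_{1232},\quad \{Y_2,Z_{1232}\}=-2Y_2Z_{1232},\\ &\{Y_2,Z_{13}\}=2Y_2Z_{123}+2Y_2Z_{13}+2Y_2Z_{321}-2Y_{21}Z_{23}-2Y_{23}Z_{21}-2Z_{21}Z_{23},\\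 &\{Y_i,Y_{2i}\}=2Y_iY_{2i},\quad \{Y_j,Y_{2i}\}=-2Y_{2i}Y_j+4Y_{13}+2Z_{j2i},\quad \{Y_{2i},Y_{13}\}=-2Y_{2i}Y_{13},\\ &\{Y_{2i},Z_{2j}\}=2Y_{2i}Z_{2j}-2Z_{1232},\quad \{Y_{2i},Z_{i2j}\}=-2Y_{2i}Z_{i2j},\quad \{Y_{2i},Z_{13}\}=2Y_{2i}Z_{i2j}-2Z_{2i}Y_{13},\\ &\{Y_i,Y_{13}\}=2Y_{13}Y_i,\quad \{Y_{13},Z_{13}\}=-2Y_{13}Z_{13}+2Z_{123}Z_{321},\quad \{Y_{13},Z_{1232}\}=2Y_{13}Z_{1232},\\ &\{Y_i,Z_{2j}\}=-2Z_{2j}Y_i+4Z_{j2i}+2Z_{13},\quad \{Y_{13},Z_{2i}\}=2Y_{2i}Z_{i2j},\\ &\{Z_{21},Z_{23}\}=-2Y_2Z_{123}+2Y_2Z_{321}-2Y_{21}Z_{23}+2Y_{23}Z_{21},\\ &\{Z_{2i},Z_{i2j}\}=2Z_{1232}Y_i+2Y_{2i}Z_{i2j}-2Z_{2i}Z_{i2j}-2Z_{2i}Y_{13},\\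 &\{Z_{2i},Z_{13}\}=2(Y_2Z_{j2i}Y_i-Y_{2i}Z_{2j}Y_i+Y_{2i}Z_{13}-Z_{2i}Z_{j2i}),\\ &\{Z_{2i},Z_{j2i}\}=-2Y_{2i}Z_{i2j}-2Y_{2i}Z_{13}+2Z_{2i}Y_{13}+2Z_{2i}Z_{j2i},\\ &\{Z_{2i},Z_{1232}\}=-2Y_2Y_{2i}Z_{i2j}-2Y_{2i}Z_{1232}+2Y_{21}Y_{23}Z_{2i},\\ &\{Z_{13},Z_{i2j}\}=2Z_{2j}Y_{13}Y_i-2Y_{2j}Z_{j2i}Y_i+2Z_{123}Z_{321}-2Y_{13}Z_{13},\\ &\{Z_{13},Z_{1232}\}=2(Y_{21}Y_{23}Z_{123}-Y_2Y_{13}Z_{123}-Y_2Z_{123}Z_{321}-Y_2Y_{13}Z_{321}+Z_{21}Z_{23}Y_{13}+Y_{21}Y_{23}Z_{321}),\\ &\{Y_i,Z_{j2i}\}=2Y_iZ_{j2i},\quad \{Z_{1232},Y_i\}=2Y_{2i}Z_{i2j}-2Y_{13}Z_{2i},\\ &\{Z_{1232},Z_{i2j}\}=2Y_{21}Y_{23}Z_{i2j}-2Y_{2j}Z_{2i}Y_{13}+2Y_{13}Z_{1232}.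 \end{aligned}$$ -/

import Mathlib

noncomputable section

namespace SlFourFolding

/-! ### The ground field and specialization of scalars at `q = 1` -/

/-- The ground field `ℂ(q)`. -/
abbrev K : Type := RatFunc ℂ

/-- The indeterminate `q`. -/
def q : K := RatFunc.X

/-- `h k = q ^ k - q ^ (-k)`. -/
def h (k : ℕ) : K := q ^ k - q⁻¹ ^ k

/-- The rational function `f` is defined at `q = 1`. -/
def RegularAtOne (f : K) : Prop := f.denom.eval 1 ≠ 0

/-- The value `f(1)`, for `f` defined at `q = 1`. -/
def valueAtOne (f : K) : ℂ := f.num.eval 1 / f.denom.eval 1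

/-- The derivative `f'(1)`, for `f` defined at `q = 1` (quotient rule). -/
def derivAtOne (f : K) : ℂ :=
  (f.num.derivative.eval 1 * f.denom.eval 1 - f.num.eval 1 * f.denom.derivative.eval 1) /
    f.denom.eval 1 ^ 2

/-! ### PBW algebras and their specializations -/

section PBW

variable {A : Type*} [Ring A] [Algebra K A] {N : ℕ}

/-- The ordered monomial `X₀ ^ m₀ * X₁ ^ m₁ * ⋯ * X_{N-1} ^ m_{N-1}`. -/
def orderedMonomial (X : Fin N → A) (m : Fin N →₀ ℕ) : A :=
  (List.ofFn fun i => X i ^ m i).prod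

/-- `A` is PBW on the totally ordered family `X₀ < X₁ < ⋯ < X_{N-1}`: the family generates `A`
and its ordered monomials form a basis of `A`. -/
structure IsPBW (X : Fin N → A) : Prop where
  generates : Algebra.adjoin K (Set.range X) = ⊤
  linearIndependent : LinearIndependent K (orderedMonomial X)
  spans : ⊤ ≤ Submodule.span K (Set.range (orderedMonomial X))

/-- The basis of ordered monomials of a PBW algebra. -/
def IsPBW.basis {X : Fin N → A} (hX : IsPBW X) : Module.Basis (Fin N →₀ ℕ) K A :=
  Module.Basis.mk hX.linearIndependent hX.spans

/-- The coefficients of `X j * X i` (to be used for `i < j`) in the basis of ordered monomials. -/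
def IsPBW.coeff {X : Fin N → A} (hX : IsPBW X) (i j : Fin N) : (Fin N →₀ ℕ) →₀ K :=
  hX.basis.repr (X j * X i)

/-- All coefficients of the PBW relations are defined at `q = 1`. -/
def IsPBW.Specializable {X : Fin N → A} (hX : IsPBW X) : Prop :=
  ∀ i j, i < j → ∀ m, RegularAtOne (hX.coeff i j m)

/-- The defining relations `X' X = ∑ c(1) M` of the specialization. -/
inductive IsPBW.SpecRel {X : Fin N → A} (hX : IsPBW X) :
    FreeAlgebra K (Fin N) → FreeAlgebra K (Fin N) → Prop
  | mk (i j : Fin N) (hij : i < j) :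
      IsPBW.SpecRel hX (FreeAlgebra.ι K j * FreeAlgebra.ι K i)
        ((hX.coeff i j).sum fun m c =>
          algebraMap ℂ K (valueAtOne c) • orderedMonomial (FreeAlgebra.ι K) m)

/-- The specialization of a specializable PBW algebra at `q = 1` (the ground field is kept). -/
abbrev IsPBW.Specialization {X : Fin N → A} (hX : IsPBW X) : Type :=
  RingQuot hX.SpecRel

/-- The generators of the specialization. -/
def IsPBW.specGen {X : Fin N → A} (hX : IsPBW X) (i : Fin N) : hX.Specialization :=
  RingQuot.mkAlgHom K hX.SpecRel (FreeAlgebra.ι K i)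

/-- The algebra is optimal specializable: it is specializable and the coefficients of
`X' X` specialize to those of `X X'`, for all `X < X'`. -/
structure IsPBW.OptimalSpecializable {X : Fin N → A} (hX : IsPBW X) : Prop where
  specializable : hX.Specializable
  optimal : ∀ i j, i < j → ∀ m, valueAtOne (hX.coeff i j m) =
    if m = Finsupp.single i 1 + Finsupp.single j 1 then 1 else 0

/-- The bracket of generators prescribed by the classical limit:
`{X', X} = ∑ (dc/dq)(1) M` for `X < X'`, where `X' X = ∑ c M`. -/
def IsPBW.IsClassicalLimit {X : Fin N → A} (hX : IsPBW X)
    (b : MvPolynomial (Fin N) K →ₗ[K] MvPolynomial (Fin N) K →ₗ[K] MvPolynomial (Fin N) K) :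
    Prop :=
  ∀ i j, i < j → b (MvPolynomial.X j) (MvPolynomial.X i) =
    (hX.coeff i j).sum fun m c => MvPolynomial.monomial m (algebraMap ℂ K (derivAtOne c))

end PBW

/-- A skew-symmetric bilinear bracket satisfying the Leibniz rule in both arguments. -/
structure IsSkewBiderivation {P : Type*} [CommRing P] [Algebra K P] (b : P →ₗ[K] P →ₗ[K] P) :
    Prop where
  skew : ∀ x y, b x y = - b y x
  leibniz_left : ∀ x y z, b (x * y) z = x * b y z + y * b x z
  leibniz_right : ∀ x y z, b x (y * z) = b x y * z + y * b x z

/-- A Poisson bracket. -/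
structure IsPoissonBracket {P : Type*} [CommRing P] [Algebra K P] (b : P →ₗ[K] P →ₗ[K] P) :
    Prop extends IsSkewBiderivation b where
  jacobi : ∀ x y z, b x (b y z) + b y (b z x) + b z (b x y) = 0

/-! ### The algebra `𝒜_{q,4}` -/

/-- The index set `{1, 3}`. -/
inductive Leg : Type
  | one
  | three

/-- The other element `j` of `{i, j} = {1, 3}`. -/
def Leg.other : Leg → Leg
  | .one => .three
  | .three => .one

/-- The generators `u₁, u₃` (as `u i`), `u₂`, `z₁₂, z₂₃` (as `z₂ i`, meaning `z_{2i} = z_{i2}`)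
and `z₁₃`. -/
inductive Gen : Type
  | u (i : Leg)
  | u₂
  | z₂ (i : Leg)
  | z₁₃

section Brackets

variable {A : Type*} [Ring A] [Algebra K A]

/-- `[a, b]_v = a b - v b a`. -/
def qbr (v : K) (a b : A) : A := a * b - v • (b * a)

/-- `[a, b] = a b - b a`. -/
def comm (a b : A) : A := a * b - b * a

/-- `{a, b} = a b + b a`. -/
def acomm (a b : A) : A := a * b + b * a

end Brackets

/-- The generators of the free algebra. -/
def fu (i : Leg) : FreeAlgebra K Gen := FreeAlgebra.ι K (.u i)

def fu₂ : FreeAlgebra K Gen := FreeAlgebra.ι K .u₂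

def fz₂ (i : Leg) : FreeAlgebra K Gen := FreeAlgebra.ι K (.z₂ i)

def fz₁₃ : FreeAlgebra K Gen := FreeAlgebra.ι K .z₁₃

/-- The defining relations of `𝒜_{q,4}`. Everywhere `i` runs over `{1, 3}`, and `i.other` is the
index `j` with `{i, j} = {1, 3}`. -/
inductive SerreRel : FreeAlgebra K Gen → FreeAlgebra K Gen → Prop
  | u_z (i : Leg) : SerreRel (fu i * fz₂ i) (fz₂ i * fu i)
  | u₂_z (i : Leg) : SerreRel (fu₂ * fz₂ i) (fz₂ i * fu₂)
  | u_z₁₃ (i : Leg) : SerreRel (fu i * fz₁₃) (fz₁₃ * fu i)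
  | u_u : SerreRel (fu .one * fu .three) (fu .three * fu .one)
  | serre_u (i : Leg) : SerreRel
      (qbr (q⁻¹ ^ 2) (fu i) (qbr (q ^ 2) (fu i) fu₂))
      (h 1 • (fu i * fz₂ i))
  | serre_u₂ (i : Leg) : SerreRel
      (qbr (q⁻¹ ^ 2) fu₂ (qbr (q ^ 2) fu₂ (fu i)))
      (h 1 • (fu₂ * fz₂ i))
  | serre_z (i : Leg) : SerreRel
      (qbr (q⁻¹ ^ 2) (fu i) (qbr (q ^ 2) (fu i) (fz₂ i.other)))
      (h 1 • (fu i * fz₁₃))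
  | z_z : SerreRel
      ((q + q⁻¹) • comm (fz₂ .one) (fz₂ .three))
      (qbr (q ^ 2) fu₂ (qbr (q⁻¹ ^ 2) (fz₂ .one) (fu .three)) -
        qbr (q ^ 2) fu₂ (qbr (q⁻¹ ^ 2) (fz₂ .three) (fu .one)))
  | u₂_z₁₃ (i : Leg) : SerreRel
      (comm fu₂ fz₁₃ + comm (fz₂ i) (fz₂ i.other))
      (h 1 • (fz₂ i.other * fu i * fu₂ - fu₂ * fu i * fz₂ i.other))
  | z_z_u (i : Leg) : SerreRel
      ((2 : K) • qbr (q ^ 2) (fz₂ i) (qbr (q⁻¹ ^ 2) (fz₂ i) (fu i.other)) +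
        qbr (q ^ 2) (fz₂ i) (qbr (q⁻¹ ^ 2) (fu i) (fz₂ i.other)) +
        qbr (q ^ 2) (fu i) (qbr (q⁻¹ ^ 2) (fz₂ i) (fz₂ i.other)))
      (h 1 • (acomm (fz₂ i) (fz₁₃ - fu i * fu i.other * fu₂ - fu₂ * fu i * fu i.other) +
        (q ^ 2 + 1 + q⁻¹ ^ 2) •
          (fu i * fu₂ * fu i.other * fz₂ i + fz₂ i * fu i.other * fu₂ * fu i) -
        fu i.other * fu₂ * fu i * fz₂ i - fz₂ i * fu i * fu₂ * fu i.other))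
  | z_z₁₃ (i : Leg) : SerreRel
      (comm (fz₂ i) fz₁₃ - comm (fu i) (comm fu₂ (comm (fu i.other) (fz₂ i))))
      (h 1 • (fu i * fz₂ i.other * fz₂ i - fz₂ i * fz₂ i.other * fu i) +
        h 1 ^ 2 • (fu i * fu₂ * fu i.other * fz₂ i - fz₂ i * fu i.other * fu₂ * fu i))

/-- The algebra `𝒜_{q,4}`. -/
abbrev Aq4 : Type := RingQuot SerreRel

/-- The generators `u₁, u₃` of `𝒜_{q,4}`. -/
def u (i : Leg) : Aq4 := RingQuot.mkAlgHom K SerreRel (fu i)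

/-- The generator `u₂` of `𝒜_{q,4}`. -/
def u₂ : Aq4 := RingQuot.mkAlgHom K SerreRel fu₂

/-- The generators `z₁₂ = z₂₁` and `z₂₃ = z₃₂` of `𝒜_{q,4}`. -/
def z₂ (i : Leg) : Aq4 := RingQuot.mkAlgHom K SerreRel (fz₂ i)

/-- The generator `z₁₃` of `𝒜_{q,4}`. -/
def z₁₃ : Aq4 := RingQuot.mkAlgHom K SerreRel fz₁₃

/-! ### The twelve PBW generators, the PBW relations and the Poisson brackets -/

/-- Twelve elements labelled `Y₂`, `Y_i`, `Y_{2i} = Y_{i2}`, `Y₁₃ = Y₂₁₃`, `Z_{2i} = Z_{i2}`,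
`Z_{i2j}`, `Z₁₂₃₂ = Z₂₁₃₂`, `Z₁₃`, where `i ∈ {1, 3}` and `{i, j} = {1, 3}`. -/
structure Family (A : Type*) where
  Y₂ : A
  Y : Leg → A
  Y₂ᵢ : Leg → A
  Y₁₃ : A
  Z₂ᵢ : Leg → A
  Zᵢ₂ⱼ : Leg → A
  Z₁₂₃₂ : A
  Z₁₃ : A

/-- The total order `Y₂ < Y₂₁ < Y₂₃ < Z₂₁ < Z₂₃ < Y₁₃ < Z₁₂₃ < Z₃₂₁ < Z₁₂₃₂ < Z₁₃ < Y₃ < Y₁`. -/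
def Family.seq {A : Type*} (F : Family A) : Fin 12 → A :=
  ![F.Y₂, F.Y₂ᵢ .one, F.Y₂ᵢ .three, F.Z₂ᵢ .one, F.Z₂ᵢ .three, F.Y₁₃, F.Zᵢ₂ⱼ .one, F.Zᵢ₂ⱼ .three,
    F.Z₁₂₃₂, F.Z₁₃, F.Y .three, F.Y .one]

/-- `Y_{2i} = (u_i u₂ - q⁻² u₂ u_i + q⁻¹ z_{i2}) / (q² - q⁻²)`. -/
def elY₂ᵢ (i : Leg) : Aq4 :=
  (q ^ 2 - q⁻¹ ^ 2)⁻¹ • (u i * u₂ - q⁻¹ ^ 2 • (u₂ * u i) + q⁻¹ • z₂ i)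

/-- `Z_{2i} = (1 - q²)⁻¹ z_{2i}`. -/
def elZ₂ᵢ (i : Leg) : Aq4 := (1 - q ^ 2)⁻¹ • z₂ i

/-- `Z_{i2j} = ([u_j, z_{2i}]_{q⁻²} + q⁻¹ z₁₃) / ((1 - q⁴) (1 - q⁻²))`. -/
def elZᵢ₂ⱼ (i : Leg) : Aq4 :=
  ((1 - q ^ 4) * (1 - q⁻¹ ^ 2))⁻¹ • (qbr (q⁻¹ ^ 2) (u i.other) (z₂ i) + q⁻¹ • z₁₃)

/-- `[u_j, Y_{2i}]_{q⁻²} / (q² - q⁻²) - Z_{j2i} / [2]_q`. -/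
def elY₂₁₃ (i : Leg) : Aq4 :=
  (q ^ 2 - q⁻¹ ^ 2)⁻¹ • qbr (q⁻¹ ^ 2) (u i.other) (elY₂ᵢ i) -
    (q + q⁻¹)⁻¹ • elZᵢ₂ⱼ i.other

/-- `(q Z_{2j} Y_{2i} - q⁻¹ Y_{2i} Z_{2j}) / (q - q⁻¹)`. -/
def elZ₂₁₃₂ (i : Leg) : Aq4 :=
  (q - q⁻¹)⁻¹ • (q • (elZ₂ᵢ i.other * elY₂ᵢ i) - q⁻¹ • (elY₂ᵢ i * elZ₂ᵢ i.other))

/-- The twelve PBW generators of `𝒜_{q,4}`. -/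
def pbwFamily : Family Aq4 where
  Y₂ := u₂
  Y := u
  Y₂ᵢ := elY₂ᵢ
  Y₁₃ := elY₂₁₃ .one
  Z₂ᵢ := elZ₂ᵢ
  Zᵢ₂ⱼ := elZᵢ₂ⱼ
  Z₁₂₃₂ := elZ₂₁₃₂ .one
  Z₁₃ := ((1 - q ^ 2) ^ 2)⁻¹ • z₁₃

/-- The PBW relations. -/
structure PBWRelations {A : Type*} [Ring A] [Algebra K A] (F : Family A) : Prop where
  Y₂ᵢ_Y₂ : ∀ i, F.Y₂ᵢ i * F.Y₂ = q ^ 2 • (F.Y₂ * F.Y₂ᵢ i)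
  Z₂ᵢ_Y₂ : ∀ i, F.Z₂ᵢ i * F.Y₂ = F.Y₂ * F.Z₂ᵢ i
  Z₁₂₃₂_Y₂ : F.Z₁₂₃₂ * F.Y₂ = q ^ 2 • (F.Y₂ * F.Z₁₂₃₂)
  Y₁₃_Y₂ : F.Y₁₃ * F.Y₂ = F.Y₂ * F.Y₁₃ + h 2 • (F.Y₂ᵢ .one * F.Y₂ᵢ .three) + h 1 • F.Z₁₂₃₂
  Y₂_Z₁₃ : F.Y₂ * F.Z₁₃ = q ^ 2 • (F.Z₁₃ * F.Y₂) + h 1 • (F.Y₂ * F.Zᵢ₂ⱼ .one +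
    q ^ 2 • (F.Y₂ * F.Zᵢ₂ⱼ .three) - q⁻¹ ^ 2 • (F.Y₂ᵢ .three * F.Z₂ᵢ .one) -
    q • (F.Z₂ᵢ .one * F.Z₂ᵢ .three) - F.Y₂ᵢ .one * F.Z₂ᵢ .three) - (h 1 * h 2) • F.Z₁₂₃₂
  Zᵢ₂ⱼ_Y₂ : ∀ i, F.Zᵢ₂ⱼ i * F.Y₂ = F.Y₂ * F.Zᵢ₂ⱼ i + (q⁻¹ * h 1) • (F.Y₂ᵢ i.other * F.Z₂ᵢ i -
    F.Z₁₂₃₂)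
  Yᵢ_Y₂ : ∀ i, F.Y i * F.Y₂ = q⁻¹ ^ 2 • (F.Y₂ * F.Y i) + h 2 • F.Y₂ᵢ i + h 1 • F.Z₂ᵢ i
  Y₂ᵢ_Z₁₃ : ∀ i, F.Y₂ᵢ i * F.Z₁₃ = F.Z₁₃ * F.Y₂ᵢ i + h 1 • (F.Y₂ᵢ i * F.Zᵢ₂ⱼ i - F.Z₂ᵢ i * F.Y₁₃)
  Y₂₃_Y₂₁ : F.Y₂ᵢ .three * F.Y₂ᵢ .one = F.Y₂ᵢ .one * F.Y₂ᵢ .three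
  Z₂ᵢ_Y₂ᵢ : ∀ i, F.Z₂ᵢ i * F.Y₂ᵢ i = F.Y₂ᵢ i * F.Z₂ᵢ i
  Y₁₃_Y₂ᵢ : ∀ i, F.Y₁₃ * F.Y₂ᵢ i = q ^ 2 • (F.Y₂ᵢ i * F.Y₁₃)
  Zⱼ₂ᵢ_Y₂ᵢ : ∀ i, F.Zᵢ₂ⱼ i.other * F.Y₂ᵢ i = F.Y₂ᵢ i * F.Zᵢ₂ⱼ i.other
  Zᵢ₂ⱼ_Y₂ᵢ : ∀ i, F.Zᵢ₂ⱼ i * F.Y₂ᵢ i = q ^ 2 • (F.Y₂ᵢ i * F.Zᵢ₂ⱼ i)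
  Z₁₂₃₂_Y₂ᵢ : ∀ i, F.Z₁₂₃₂ * F.Y₂ᵢ i = F.Y₂ᵢ i * F.Z₁₂₃₂
  Yᵢ_Y₂ᵢ : ∀ i, F.Y i * F.Y₂ᵢ i = q ^ 2 • (F.Y₂ᵢ i * F.Y i)
  Yⱼ_Y₂ᵢ : ∀ i, F.Y i.other * F.Y₂ᵢ i = q⁻¹ ^ 2 • (F.Y₂ᵢ i * F.Y i.other) + h 2 • F.Y₁₃ +
    h 1 • F.Zᵢ₂ⱼ i.other
  Z₂ⱼ_Y₂ᵢ : ∀ i, F.Z₂ᵢ i.other * F.Y₂ᵢ i = q⁻¹ ^ 2 • (F.Y₂ᵢ i * F.Z₂ᵢ i.other) +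
    (q⁻¹ * h 1) • F.Z₁₂₃₂
  Z₂₃_Z₂₁ : F.Z₂ᵢ .three * F.Z₂ᵢ .one = F.Z₂ᵢ .one * F.Z₂ᵢ .three + h 1 • (F.Y₂ * F.Zᵢ₂ⱼ .one -
    F.Y₂ * F.Zᵢ₂ⱼ .three + q⁻¹ ^ 2 • (F.Y₂ᵢ .one * F.Z₂ᵢ .three) -
    q⁻¹ ^ 2 • (F.Y₂ᵢ .three * F.Z₂ᵢ .one))
  Y₁₃_Z₂ᵢ : ∀ i, F.Y₁₃ * F.Z₂ᵢ i = F.Z₂ᵢ i * F.Y₁₃ + (q * h 1) • (F.Y₂ᵢ i * F.Zᵢ₂ⱼ i)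
  Z₂ᵢ_Zⱼ₂ᵢ : ∀ i, F.Z₂ᵢ i * F.Zᵢ₂ⱼ i.other = q ^ 2 • (F.Zᵢ₂ⱼ i.other * F.Z₂ᵢ i) +
    h 1 • (F.Z₂ᵢ i * F.Y₁₃ - F.Y₂ᵢ i * F.Zᵢ₂ⱼ i - q • (F.Y₂ᵢ i * F.Z₁₃))
  Zᵢ₂ⱼ_Z₂ᵢ : ∀ i, F.Zᵢ₂ⱼ i * F.Z₂ᵢ i = q ^ 2 • (F.Z₂ᵢ i * F.Zᵢ₂ⱼ i) + h 1 • (F.Z₂ᵢ i * F.Y₁₃ -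
    F.Y₂ᵢ i * F.Zᵢ₂ⱼ i - F.Z₁₂₃₂ * F.Y i)
  Z₁₂₃₂_Z₂ᵢ : ∀ i, F.Z₁₂₃₂ * F.Z₂ᵢ i = F.Z₂ᵢ i * F.Z₁₂₃₂ +
    h 1 • (q ^ 2 • (F.Y₂ * F.Y₂ᵢ i * F.Zᵢ₂ⱼ i) + q⁻¹ ^ 2 • (F.Y₂ᵢ i * F.Z₁₂₃₂) -
    q⁻¹ ^ 2 • (F.Y₂ᵢ .one * F.Y₂ᵢ .three * F.Z₂ᵢ i))
  Z₁₃_Z₂ᵢ : ∀ i, F.Z₁₃ * F.Z₂ᵢ i = F.Z₂ᵢ i * F.Z₁₃ +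
    (h 1 * q⁻¹ ^ 2) • (-(q • (F.Y₂ * F.Zᵢ₂ⱼ i.other * F.Y i)) +
    q⁻¹ • (F.Y₂ᵢ i * F.Z₂ᵢ i.other * F.Y i) - F.Y₂ᵢ i * F.Z₁₃ + F.Z₂ᵢ i * F.Zᵢ₂ⱼ i.other) +
    (h 1 ^ 2 * q⁻¹ ^ 2) • (F.Z₁₂₃₂ * F.Y i + F.Y₂ᵢ i * F.Zᵢ₂ⱼ i - F.Z₂ᵢ i * F.Y₁₃)
  Yᵢ_Z₂ⱼ : ∀ i, F.Y i * F.Z₂ᵢ i.other = q⁻¹ ^ 2 • (F.Z₂ᵢ i.other * F.Y i) + h 1 • F.Z₁₃ +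
    h 2 • F.Zᵢ₂ⱼ i.other
  Z₁₃_Y₁₃ : F.Z₁₃ * F.Y₁₃ = q ^ 2 • (F.Y₁₃ * F.Z₁₃) - (q * h 1) • (F.Zᵢ₂ⱼ .one * F.Zᵢ₂ⱼ .three)
  Yᵢ_Z₂ᵢ : ∀ i, F.Y i * F.Z₂ᵢ i = F.Z₂ᵢ i * F.Y i
  Zᵢ₂ⱼ_Y₁₃ : ∀ i, F.Zᵢ₂ⱼ i * F.Y₁₃ = F.Y₁₃ * F.Zᵢ₂ⱼ i
  Z₁₂₃₂_Y₁₃ : F.Z₁₂₃₂ * F.Y₁₃ = q⁻¹ ^ 2 • (F.Y₁₃ * F.Z₁₂₃₂)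
  Yᵢ_Y₁₃ : ∀ i, F.Y i * F.Y₁₃ = q ^ 2 • (F.Y₁₃ * F.Y i)
  Z₃₂₁_Z₁₂₃ : F.Zᵢ₂ⱼ .three * F.Zᵢ₂ⱼ .one = F.Zᵢ₂ⱼ .one * F.Zᵢ₂ⱼ .three
  Z₁₂₃₂_Zᵢ₂ⱼ : ∀ i, F.Z₁₂₃₂ * F.Zᵢ₂ⱼ i = F.Zᵢ₂ⱼ i * F.Z₁₂₃₂ +
    h 1 • (F.Y₂ᵢ .one * F.Y₂ᵢ .three * F.Zᵢ₂ⱼ i - F.Y₂ᵢ i.other * F.Z₂ᵢ i * F.Y₁₃ +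
    q⁻¹ ^ 2 • (F.Y₁₃ * F.Z₁₂₃₂))
  Zᵢ₂ⱼ_Z₁₃ : ∀ i, F.Zᵢ₂ⱼ i * F.Z₁₃ = F.Z₁₃ * F.Zᵢ₂ⱼ i + h 1 • (F.Y₁₃ * F.Z₁₃ -
    F.Zᵢ₂ⱼ .one * F.Zᵢ₂ⱼ .three + q⁻¹ • (F.Y₂ᵢ i.other * F.Zᵢ₂ⱼ i.other * F.Y i) -
    q⁻¹ • (F.Z₂ᵢ i.other * F.Y₁₃ * F.Y i))
  Z₁₂₃₂_Z₁₃ : F.Z₁₂₃₂ * F.Z₁₃ = F.Z₁₃ * F.Z₁₂₃₂ + h 1 • (q⁻¹ • (F.Y₂ * F.Y₁₃ * F.Zᵢ₂ⱼ .one) +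
    q • (F.Y₂ * F.Y₁₃ * F.Zᵢ₂ⱼ .three) + F.Y₂ * F.Zᵢ₂ⱼ .one * F.Zᵢ₂ⱼ .three -
    q⁻¹ • (F.Y₂ᵢ .one * F.Y₂ᵢ .three * F.Zᵢ₂ⱼ .one) -
    q⁻¹ • (F.Y₂ᵢ .one * F.Y₂ᵢ .three * F.Zᵢ₂ⱼ .three) - F.Z₂ᵢ .one * F.Z₂ᵢ .three * F.Y₁₃) +
    h 1 ^ 2 • (q⁻¹ ^ 2 • (F.Y₂ᵢ .three * F.Z₂ᵢ .one * F.Y₁₃) - q⁻¹ ^ 4 • (F.Y₁₃ * F.Z₁₂₃₂))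
  Yᵢ_Z₁₂₃₂ : ∀ i, F.Y i * F.Z₁₂₃₂ = F.Z₁₂₃₂ * F.Y i - (h 1 * q) • (F.Y₂ᵢ i * F.Zᵢ₂ⱼ i -
    F.Z₂ᵢ i * F.Y₁₃)
  Yᵢ_Zᵢ₂ⱼ : ∀ i, F.Y i * F.Zᵢ₂ⱼ i = F.Zᵢ₂ⱼ i * F.Y i
  Yᵢ_Zⱼ₂ᵢ : ∀ i, F.Y i * F.Zᵢ₂ⱼ i.other = q ^ 2 • (F.Zᵢ₂ⱼ i.other * F.Y i)
  Z₁₃_Yᵢ : ∀ i, F.Z₁₃ * F.Y i = F.Y i * F.Z₁₃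
  Y₃_Y₁ : F.Y .three * F.Y .one = F.Y .one * F.Y .three

/-- The variables of the polynomial algebra, labelled like the PBW generators. -/
def polyFamily : Family (MvPolynomial (Fin 12) K) where
  Y₂ := MvPolynomial.X 0
  Y | .one => MvPolynomial.X 11
    | .three => MvPolynomial.X 10
  Y₂ᵢ | .one => MvPolynomial.X 1
      | .three => MvPolynomial.X 2
  Y₁₃ := MvPolynomial.X 5
  Z₂ᵢ | .one => MvPolynomial.X 3
      | .three => MvPolynomial.X 4
  Zᵢ₂ⱼ | .one => MvPolynomial.X 6
       | .three => MvPolynomial.X 7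
  Z₁₂₃₂ := MvPolynomial.X 8
  Z₁₃ := MvPolynomial.X 9

/-- The brackets of all pairs of generators (the last fields are the vanishing ones). -/
structure PoissonTable {P : Type*} [CommRing P] [Algebra K P]
    (b : P →ₗ[K] P →ₗ[K] P) (F : Family P) : Prop where
  Y₂_Yᵢ : ∀ i, b F.Y₂ (F.Y i) = 2 * F.Y₂ * F.Y i - 4 * F.Y₂ᵢ i - 2 * F.Z₂ᵢ i
  Y₂_Y₂ᵢ : ∀ i, b F.Y₂ (F.Y₂ᵢ i) = -2 * F.Y₂ᵢ i * F.Y₂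
  Y₂_Y₁₃ : b F.Y₂ F.Y₁₃ = -4 * F.Y₂ᵢ .one * F.Y₂ᵢ .three - 2 * F.Z₁₂₃₂
  Y₂_Zᵢ₂ⱼ : ∀ i, b F.Y₂ (F.Zᵢ₂ⱼ i) = -2 * F.Z₂ᵢ i * F.Y₂ᵢ i.other + 2 * F.Z₁₂₃₂
  Y₂_Z₁₃ : b F.Y₂ F.Z₁₃ = 2 * F.Y₂ * F.Zᵢ₂ⱼ .one + 2 * F.Y₂ * F.Z₁₃ + 2 * F.Y₂ * F.Zᵢ₂ⱼ .three -
    2 * F.Y₂ᵢ .one * F.Z₂ᵢ .three - 2 * F.Y₂ᵢ .three * F.Z₂ᵢ .one - 2 * F.Z₂ᵢ .one * F.Z₂ᵢ .three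
  Y₂_Z₁₂₃₂ : b F.Y₂ F.Z₁₂₃₂ = -2 * F.Y₂ * F.Z₁₂₃₂
  Yᵢ_Y₂ᵢ : ∀ i, b (F.Y i) (F.Y₂ᵢ i) = 2 * F.Y i * F.Y₂ᵢ i
  Yⱼ_Y₂ᵢ : ∀ i, b (F.Y i.other) (F.Y₂ᵢ i) = -2 * F.Y₂ᵢ i * F.Y i.other + 4 * F.Y₁₃ +
    2 * F.Zᵢ₂ⱼ i.other
  Y₂ᵢ_Y₁₃ : ∀ i, b (F.Y₂ᵢ i) F.Y₁₃ = -2 * F.Y₂ᵢ i * F.Y₁₃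
  Y₂ᵢ_Z₂ⱼ : ∀ i, b (F.Y₂ᵢ i) (F.Z₂ᵢ i.other) = 2 * F.Y₂ᵢ i * F.Z₂ᵢ i.other - 2 * F.Z₁₂₃₂
  Y₂ᵢ_Zᵢ₂ⱼ : ∀ i, b (F.Y₂ᵢ i) (F.Zᵢ₂ⱼ i) = -2 * F.Y₂ᵢ i * F.Zᵢ₂ⱼ i
  Y₂ᵢ_Z₁₃ : ∀ i, b (F.Y₂ᵢ i) F.Z₁₃ = 2 * F.Y₂ᵢ i * F.Zᵢ₂ⱼ i - 2 * F.Z₂ᵢ i * F.Y₁₃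
  Yᵢ_Y₁₃ : ∀ i, b (F.Y i) F.Y₁₃ = 2 * F.Y₁₃ * F.Y i
  Y₁₃_Z₁₃ : b F.Y₁₃ F.Z₁₃ = -2 * F.Y₁₃ * F.Z₁₃ + 2 * F.Zᵢ₂ⱼ .one * F.Zᵢ₂ⱼ .three
  Y₁₃_Z₁₂₃₂ : b F.Y₁₃ F.Z₁₂₃₂ = 2 * F.Y₁₃ * F.Z₁₂₃₂
  Yᵢ_Z₂ⱼ : ∀ i, b (F.Y i) (F.Z₂ᵢ i.other) = -2 * F.Z₂ᵢ i.other * F.Y i + 4 * F.Zᵢ₂ⱼ i.other +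
    2 * F.Z₁₃
  Y₁₃_Z₂ᵢ : ∀ i, b F.Y₁₃ (F.Z₂ᵢ i) = 2 * F.Y₂ᵢ i * F.Zᵢ₂ⱼ i
  Z₂₁_Z₂₃ : b (F.Z₂ᵢ .one) (F.Z₂ᵢ .three) = -2 * F.Y₂ * F.Zᵢ₂ⱼ .one + 2 * F.Y₂ * F.Zᵢ₂ⱼ .three -
    2 * F.Y₂ᵢ .one * F.Z₂ᵢ .three + 2 * F.Y₂ᵢ .three * F.Z₂ᵢ .one
  Z₂ᵢ_Zᵢ₂ⱼ : ∀ i, b (F.Z₂ᵢ i) (F.Zᵢ₂ⱼ i) = 2 * F.Z₁₂₃₂ * F.Y i + 2 * F.Y₂ᵢ i * F.Zᵢ₂ⱼ i -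
    2 * F.Z₂ᵢ i * F.Zᵢ₂ⱼ i - 2 * F.Z₂ᵢ i * F.Y₁₃
  Z₂ᵢ_Z₁₃ : ∀ i, b (F.Z₂ᵢ i) F.Z₁₃ = 2 * (F.Y₂ * F.Zᵢ₂ⱼ i.other * F.Y i -
    F.Y₂ᵢ i * F.Z₂ᵢ i.other * F.Y i + F.Y₂ᵢ i * F.Z₁₃ - F.Z₂ᵢ i * F.Zᵢ₂ⱼ i.other)
  Z₂ᵢ_Zⱼ₂ᵢ : ∀ i, b (F.Z₂ᵢ i) (F.Zᵢ₂ⱼ i.other) = -2 * F.Y₂ᵢ i * F.Zᵢ₂ⱼ i - 2 * F.Y₂ᵢ i * F.Z₁₃ +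
    2 * F.Z₂ᵢ i * F.Y₁₃ + 2 * F.Z₂ᵢ i * F.Zᵢ₂ⱼ i.other
  Z₂ᵢ_Z₁₂₃₂ : ∀ i, b (F.Z₂ᵢ i) F.Z₁₂₃₂ = -2 * F.Y₂ * F.Y₂ᵢ i * F.Zᵢ₂ⱼ i -
    2 * F.Y₂ᵢ i * F.Z₁₂₃₂ + 2 * F.Y₂ᵢ .one * F.Y₂ᵢ .three * F.Z₂ᵢ i
  Z₁₃_Zᵢ₂ⱼ : ∀ i, b F.Z₁₃ (F.Zᵢ₂ⱼ i) = 2 * F.Z₂ᵢ i.other * F.Y₁₃ * F.Y i -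
    2 * F.Y₂ᵢ i.other * F.Zᵢ₂ⱼ i.other * F.Y i + 2 * F.Zᵢ₂ⱼ .one * F.Zᵢ₂ⱼ .three -
    2 * F.Y₁₃ * F.Z₁₃
  Z₁₃_Z₁₂₃₂ : b F.Z₁₃ F.Z₁₂₃₂ = 2 * (F.Y₂ᵢ .one * F.Y₂ᵢ .three * F.Zᵢ₂ⱼ .one -
    F.Y₂ * F.Y₁₃ * F.Zᵢ₂ⱼ .one - F.Y₂ * F.Zᵢ₂ⱼ .one * F.Zᵢ₂ⱼ .three -
    F.Y₂ * F.Y₁₃ * F.Zᵢ₂ⱼ .three + F.Z₂ᵢ .one * F.Z₂ᵢ .three * F.Y₁₃ +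
    F.Y₂ᵢ .one * F.Y₂ᵢ .three * F.Zᵢ₂ⱼ .three)
  Yᵢ_Zⱼ₂ᵢ : ∀ i, b (F.Y i) (F.Zᵢ₂ⱼ i.other) = 2 * F.Y i * F.Zᵢ₂ⱼ i.other
  Z₁₂₃₂_Yᵢ : ∀ i, b F.Z₁₂₃₂ (F.Y i) = 2 * F.Y₂ᵢ i * F.Zᵢ₂ⱼ i - 2 * F.Y₁₃ * F.Z₂ᵢ i
  Z₁₂₃₂_Zᵢ₂ⱼ : ∀ i, b F.Z₁₂₃₂ (F.Zᵢ₂ⱼ i) = 2 * F.Y₂ᵢ .one * F.Y₂ᵢ .three * F.Zᵢ₂ⱼ i -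
    2 * F.Y₂ᵢ i.other * F.Z₂ᵢ i * F.Y₁₃ + 2 * F.Y₁₃ * F.Z₁₂₃₂
  Y₂_Z₂ᵢ : ∀ i, b F.Y₂ (F.Z₂ᵢ i) = 0
  Y₂₁_Y₂₃ : b (F.Y₂ᵢ .one) (F.Y₂ᵢ .three) = 0
  Y₂ᵢ_Z₂ᵢ : ∀ i, b (F.Y₂ᵢ i) (F.Z₂ᵢ i) = 0
  Y₂ᵢ_Zⱼ₂ᵢ : ∀ i, b (F.Y₂ᵢ i) (F.Zᵢ₂ⱼ i.other) = 0
  Y₂ᵢ_Z₁₂₃₂ : ∀ i, b (F.Y₂ᵢ i) F.Z₁₂₃₂ = 0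
  Yᵢ_Z₂ᵢ : ∀ i, b (F.Y i) (F.Z₂ᵢ i) = 0
  Y₁₃_Zᵢ₂ⱼ : ∀ i, b F.Y₁₃ (F.Zᵢ₂ⱼ i) = 0
  Z₁₂₃_Z₃₂₁ : b (F.Zᵢ₂ⱼ .one) (F.Zᵢ₂ⱼ .three) = 0
  Yᵢ_Zᵢ₂ⱼ : ∀ i, b (F.Y i) (F.Zᵢ₂ⱼ i) = 0
  Yᵢ_Z₁₃ : ∀ i, b (F.Y i) F.Z₁₃ = 0
  Y₁_Y₃ : b (F.Y .one) (F.Y .three) = 0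

end SlFourFolding

end

open SlFourFolding

/-!
The proof has two halves that meet in the twelve PBW generators: consequences of the defining
relations are derived by linear algebra, and independence is proved with Bergman's diamond lemma.

The PBW relations are read as rewriting rules: a product `j * i` of two letters with `i < j` is
replaced by its ordered expression `ordered j i`. With suitable weights of the letters, a rule
replaces `j * i` by `i * j` and words of smaller weight (`rank_lt`), so rewriting terminates. All
overlaps `k * j * i` resolve (`overlapsResolve_eq_true`), hence normal forms do not depend on the
order of rewriting (`normalForm_append`). It follows that left multiplication by letters, followed
by reduction to normal form, defines operators on the space of words that satisfy the PBW
relations (`letterOperator_mul`). Applied to the empty word, the ordered monomials in these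
operators give the distinct ordered words. Therefore the ordered monomials are linearly
independent in every algebra whose generators can be mapped to these operators, and they form a
basis if moreover the PBW relations hold (`isPBW`).

The PBW relations imply the relations of `𝒜_{q,4}` and the formulae for the PBW generators,
because both sides of each have the same normal form (`vanish_serreRelations`,
`vanish_primaryDefinitions`, `vanish_secondaryDefinitions`). This gives the homomorphisms out of
`𝒜_{q,4}` (`exists_algHom`), and it shows that the formulae for `Y₁₃` and `Z₁₂₃₂` do not depend on
the choice of `i`. Conversely, the PBW relations follow one after the other from the relations of
`𝒜_{q,4}` and the formulae: each is, up to a nonzero scalar, a combination of given relations and of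
overlaps of PBW relations that are already known, reduced by the latter (`relationSteps`,
`pbwRelations_of_serreRelations`).

The coefficients of the PBW relations are Laurent polynomials in `q`, whose values and derivatives
at `q = 1` are read off (`HasJetAtOne`). The values show that the algebra is optimal
specializable, and the derivatives define a biderivation on the polynomial algebra. Its Jacobi
identity needs to be checked on the variables only (`IsSkewBiderivation.isPoissonBracket`), where
it is a finite computation (`vanishesAtOne_jacobiator`).

All computations take place in `QPoly`, the linear combinations of words over `ℤ[q, q⁻¹]` as
lists, with operations that the kernel evaluates quickly; `QPoly.lin` interprets them in modules,
and `QPoly.ev` in algebras.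
-/

noncomputable section

namespace SlFourFolding

/-! ### Laurent polynomials in noncommuting letters -/

/-- Words in the letters `0 < 1 < ⋯ < 11`, which stand for
`Y₂ < Y₂₁ < Y₂₃ < Z₂₁ < Z₂₃ < Y₁₃ < Z₁₂₃ < Z₃₂₁ < Z₁₂₃₂ < Z₁₃ < Y₃ < Y₁`. -/
abbrev Word : Type := List ℕ

/-- A Laurent polynomial in `q` with integral coefficients; the pair `(c, e)` is the term
`c * q ^ e`. Terms may repeat, but the operations cancel reliably only if the exponents are
decreasing. -/
abbrev Scalar : Type := List (ℤ × ℤ)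

/-- A linear combination of words over `ℤ[q, q⁻¹]`. Words may repeat. -/
abbrev QPoly : Type := List (Word × Scalar)

namespace Scalar

/-- Adds the term `c * q ^ e` to a Laurent polynomial. -/
def ins (c e : ℤ) : Scalar → Scalar
  | [] => [(c, e)]
  | y :: s =>
    match e - y.2 with
    | .ofNat 0 =>
      match c + y.1 with
      | .ofNat 0 => s
      | d => (d, e) :: s
    | .ofNat (_ + 1) => (c, e) :: y :: s
    | .negSucc _ => y :: ins c e s

def add (s t : Scalar) : Scalar := s.foldr (fun x r => ins x.1 x.2 r) t

/-- The product with the term `c * q ^ e`. -/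
def tmul (c e : ℤ) (s : Scalar) : Scalar := s.map fun x => (c * x.1, e + x.2)

def mul (s t : Scalar) : Scalar := s.foldr (fun x r => add (tmul x.1 x.2 t) r) []

/-- The value of a Laurent polynomial at `t`. -/
def val {S : Type*} [Field S] (t : S) (s : Scalar) : S :=
  (s.map fun x => (x.1 : S) * t ^ x.2).sum

section Val

variable {S : Type*} [Field S] {t : S}

@[simp] theorem val_nil : val t [] = 0 := rfl

@[simp] theorem val_cons (x : ℤ × ℤ) (s : Scalar) :
    val t (x :: s) = (x.1 : S) * t ^ x.2 + val t s := by simp [val]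

theorem val_ins (c e : ℤ) (s : Scalar) : val t (ins c e s) = (c : S) * t ^ e + val t s := by
  induction s with
  | nil => simp [ins]
  | cons y s ih =>
    unfold ins
    split
    · next he =>
      obtain rfl : e = y.2 := by
        have : e - y.2 = 0 := he
        omega
      split
      · next hc =>
        have hc' : c + y.1 = 0 := hc
        rw [val_cons, ← add_assoc, ← add_mul, ← Int.cast_add, hc']
        simp
      · simp [add_mul, add_assoc]
    · simp
    · simp [ih]
      ring

theorem val_add (s r : Scalar) : val t (add s r) = val t s + val t r := by
  induction s with
  | nil => simp [add]
  | cons x s ih =>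
    have : add (x :: s) r = ins x.1 x.2 (add s r) := rfl
    rw [this, val_ins, ih, val_cons, add_assoc]

theorem val_tmul (ht : t ≠ 0) (c e : ℤ) (s : Scalar) :
    val t (tmul c e s) = (c : S) * t ^ e * val t s := by
  induction s with
  | nil => simp [tmul]
  | cons x s ih =>
    have : tmul c e (x :: s) = (c * x.1, e + x.2) :: tmul c e s := rfl
    rw [this, val_cons, ih, val_cons, zpow_add₀ ht]
    push_cast
    ring

theorem val_mul (ht : t ≠ 0) (s r : Scalar) : val t (mul s r) = val t s * val t r := by
  induction s with
  | nil => simp [mul]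
  | cons x s ih =>
    have : mul (x :: s) r = add (tmul x.1 x.2 r) (mul s r) := rfl
    rw [this, val_add, val_tmul ht, ih, val_cons]
    ring

end Val

end Scalar

/-- Equality of words, in a form that the kernel evaluates quickly. -/
def beqWord : Word → Word → Bool
  | [], [] => true
  | x :: u, y :: v => match Nat.beq x y with
    | true => beqWord u v
    | false => false
  | _, _ => false

theorem eq_of_beqWord : ∀ {u v : Word}, beqWord u v = true → u = v
  | [], [], _ => rfl
  | x :: u, y :: v, h => by
    unfold beqWord at h
    split at h
    · next hxy => rw [Nat.eq_of_beq_eq_true hxy, eq_of_beqWord h]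
    · simp at h
  | [], _ :: _, h => by simp [beqWord] at h
  | _ :: _, [], h => by simp [beqWord] at h

namespace QPoly

/-- Adds a multiple of a word to a polynomial, and combines it with an earlier multiple. -/
def ins (w : Word) (s : Scalar) : QPoly → QPoly
  | [] => [(w, s)]
  | y :: p =>
    match beqWord w y.1 with
    | true => match Scalar.add s y.2 with
      | [] => p
      | r => (w, r) :: p
    | false => y :: ins w s p

def add (p r : QPoly) : QPoly := p.foldr (fun x o => ins x.1 x.2 o) r

def smul (s : Scalar) (p : QPoly) : QPoly := p.map fun x => (x.1, Scalar.mul s x.2)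

def sub (p r : QPoly) : QPoly := add (smul [(-1, 0)] r) p

/-- The product, in which equal words are not combined. -/
def mul (p r : QPoly) : QPoly :=
  p.flatMap fun x => r.map fun y => (x.1 ++ y.1, Scalar.mul x.2 y.2)

instance : Add QPoly := ⟨add⟩
instance : Sub QPoly := ⟨sub⟩
instance : Mul QPoly := ⟨mul⟩
instance : SMul Scalar QPoly := ⟨smul⟩

/-- The polynomial `a * p * b`. -/
def inContext (a : Word) (p : QPoly) (b : Word) : QPoly := p.map fun x => (a ++ x.1 ++ b, x.2)

/-- The value of a polynomial under the substitution of `t` for `q` and of `L w` for each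
word `w`. -/
def lin {S M : Type*} [Field S] [AddCommGroup M] [Module S M] (t : S) (L : Word → M)
    (p : QPoly) : M :=
  (p.map fun x => Scalar.val t x.2 • L x.1).sum

section Lin

variable {S M M' : Type*} [Field S] [AddCommGroup M] [Module S M] [AddCommGroup M'] [Module S M']
  {t : S} {L : Word → M}

@[simp] theorem lin_nil : lin t L [] = 0 := rfl

@[simp] theorem lin_cons (x : Word × Scalar) (p : QPoly) :
    lin t L (x :: p) = Scalar.val t x.2 • L x.1 + lin t L p := by simp [lin]

@[simp] theorem lin_append (p r : QPoly) : lin t L (p ++ r) = lin t L p + lin t L r := by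
  simp [lin]

theorem lin_ins (w : Word) (s : Scalar) (p : QPoly) :
    lin t L (ins w s p) = Scalar.val t s • L w + lin t L p := by
  induction p with
  | nil => simp [ins]
  | cons y p ih =>
    unfold ins
    split
    · next h =>
      have hs : Scalar.val t (Scalar.add s y.2) • L w =
          Scalar.val t s • L w + Scalar.val t y.2 • L y.1 := by
        rw [Scalar.val_add, add_smul, eq_of_beqWord h]
      split
      · next h0 =>
        rw [lin_cons, ← add_assoc, ← hs, h0]
        simp
      · rw [lin_cons, lin_cons, ← add_assoc, ← hs]
    · rw [lin_cons, lin_cons, ih]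
      abel

theorem lin_add (p r : QPoly) : lin t L (p + r) = lin t L p + lin t L r := by
  change lin t L (add p r) = _
  induction p with
  | nil => simp [add]
  | cons x p ih =>
    have : add (x :: p) r = ins x.1 x.2 (add p r) := rfl
    rw [this, lin_ins, ih, lin_cons, add_assoc]

theorem lin_smul (ht : t ≠ 0) (s : Scalar) (p : QPoly) :
    lin t L (s • p) = Scalar.val t s • lin t L p := by
  change lin t L (smul s p) = _
  induction p with
  | nil => simp [smul]
  | cons x p ih =>
    have : smul s (x :: p) = (x.1, Scalar.mul s x.2) :: smul s p := rfl
    rw [this, lin_cons, ih, lin_cons, smul_add, smul_smul, Scalar.val_mul ht]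

theorem lin_sub (ht : t ≠ 0) (p r : QPoly) : lin t L (p - r) = lin t L p - lin t L r := by
  change lin t L (([(-1, 0)] : Scalar) • r + p) = _
  rw [lin_add, lin_smul ht]
  simp [sub_eq_neg_add]

theorem lin_inContext (a : Word) (p : QPoly) (b : Word) :
    lin t L (inContext a p b) = lin t (fun w => L (a ++ w ++ b)) p := by
  simp [lin, inContext, Function.comp_def]

theorem map_lin (f : M →ₗ[S] M') (p : QPoly) : f (lin t L p) = lin t (fun w => f (L w)) p := by
  induction p with
  | nil => simp
  | cons x p ih => simp [ih]

theorem lin_congr {L' : Word → M} {p : QPoly} (h : ∀ x ∈ p, L x.1 = L' x.1) :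
    lin t L p = lin t L' p := by
  unfold lin
  rw [List.map_congr_left fun x hx => by rw [h x hx]]

theorem lin_comm {p r : QPoly} (L : Word → Word → M) :
    lin t (fun u => lin t (L u) r) p = lin t (fun v => lin t (fun u => L u v) p) r := by
  induction p with
  | nil => simp [lin]
  | cons x p ih =>
    rw [lin_cons, ih]
    clear ih
    induction r with
    | nil => simp
    | cons y r ih =>
      simp only [lin_cons, smul_add, smul_smul] at ih ⊢
      rw [← ih, mul_comm]
      abel

/-- Every word of `ins w s p` is `w` or a word of `p`. -/
theorem exists_of_mem_ins {w : Word} {s : Scalar} {p : QPoly} {P : Word → Prop} (hw : P w)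
    (hp : ∀ x ∈ p, P x.1) : ∀ x ∈ ins w s p, P x.1 := by
  induction p with
  | nil => simpa [ins] using hw
  | cons y p ih =>
    simp only [List.forall_mem_cons] at hp
    unfold ins
    split
    · split
      · exact hp.2
      · exact List.forall_mem_cons.2 ⟨hw, hp.2⟩
    · exact List.forall_mem_cons.2 ⟨hp.1, ih hp.2⟩

theorem forall_mem_add {p r : QPoly} {P : Word → Prop} (hp : ∀ x ∈ p, P x.1)
    (hr : ∀ x ∈ r, P x.1) : ∀ x ∈ p + r, P x.1 := by
  change ∀ x ∈ add p r, P x.1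
  induction p with
  | nil => exact hr
  | cons y p ih =>
    simp only [List.forall_mem_cons] at hp
    exact exists_of_mem_ins hp.1 (ih hp.2)

theorem forall_mem_smul {s : Scalar} {p : QPoly} {P : Word → Prop} (hp : ∀ x ∈ p, P x.1) :
    ∀ x ∈ s • p, P x.1 := by
  change ∀ x ∈ smul s p, P x.1
  exact List.forall_mem_map.2 hp

theorem forall_mem_sub {p r : QPoly} {P : Word → Prop} (hp : ∀ x ∈ p, P x.1)
    (hr : ∀ x ∈ r, P x.1) : ∀ x ∈ p - r, P x.1 :=
  forall_mem_add (forall_mem_smul hr) hp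

end Lin

/-- The value of a polynomial in an algebra. -/
def ev {A : Type*} [Ring A] [Algebra K A] (X : ℕ → A) (p : QPoly) : A :=
  lin q (fun w => (w.map X).prod) p

end QPoly

theorem q_ne_zero : q ≠ 0 := RatFunc.X_ne_zero

namespace QPoly

variable {A : Type*} [Ring A] [Algebra K A] (X : ℕ → A)

theorem ev_cons (x : Word × Scalar) (p : QPoly) :
    ev X (x :: p) = Scalar.val q x.2 • (x.1.map X).prod + ev X p := lin_cons x p

theorem ev_add (p r : QPoly) : ev X (p + r) = ev X p + ev X r := lin_add p r

theorem ev_sub (p r : QPoly) : ev X (p - r) = ev X p - ev X r := lin_sub q_ne_zero p r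

theorem ev_smul (s : Scalar) (p : QPoly) : ev X (s • p) = Scalar.val q s • ev X p :=
  lin_smul q_ne_zero s p

theorem ev_mul (p r : QPoly) : ev X (p * r) = ev X p * ev X r := by
  change lin q _ (mul p r) = _
  induction p with
  | nil => simp [mul, ev]
  | cons x p ih =>
    have : mul (x :: p) r = inContext x.1 (x.2 • r) [] ++ mul p r := by
      change _ = inContext x.1 (smul x.2 r) [] ++ mul p r
      simp [mul, inContext, smul]
    rw [this, lin_append, ih, lin_inContext]
    have h : lin q (fun w => ((x.1 ++ w ++ []).map X).prod) (x.2 • r) =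
        Scalar.val q x.2 • ((x.1.map X).prod * ev X r) := by
      have := map_lin (t := q) (L := fun w : Word => (w.map X).prod)
        (LinearMap.mulLeft K (x.1.map X).prod) (x.2 • r)
      rw [lin_smul q_ne_zero, map_smul] at this
      simpa [ev] using this.symm
    rw [h, ev_cons, add_mul, smul_mul_assoc]

end QPoly

/-! ### Rewriting -/

/-- A rewriting system: the product `x * y` of two letters may be replaced by `R x y`. -/
abbrev Rules : Type := ℕ → ℕ → Option QPoly

/-- The leftmost place where a rule applies: if the word is `a * x * y * b`, then the result is
`(a, R x y, b)`. -/
def redex (R : Rules) : Word → Option (Word × QPoly × Word)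
  | [] => none
  | x :: s =>
    match s with
    | [] => none
    | y :: t =>
      match R x y with
      | some f => some ([], f, t)
      | none =>
        match redex R s with
        | some (a, f, b) => some (x :: a, f, b)
        | none => none

theorem redex_eq_some {R : Rules} {w a b : Word} {f : QPoly} (h : redex R w = some (a, f, b)) :
    ∃ x y, R x y = some f ∧ w = a ++ x :: y :: b := by
  induction w generalizing a with
  | nil => simp [redex] at h
  | cons x s ih =>
    cases s with
    | nil => simp [redex] at h
    | cons y t =>
      rw [redex] at h
      split at h
      · next g hg =>
        simp only [Option.some.injEq, Prod.mk.injEq] at h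
        obtain ⟨rfl, rfl, rfl⟩ := h
        exact ⟨x, y, hg, rfl⟩
      · split at h
        · next a' f' b' h' =>
          simp only [Option.some.injEq, Prod.mk.injEq] at h
          obtain ⟨rfl, rfl, rfl⟩ := h
          obtain ⟨x', y', hR, hw⟩ := ih h'
          exact ⟨x', y', hR, by rw [hw]; rfl⟩
        · simp at h

/-- The leftmost redex lies to the left of any other redex. -/
theorem redex_append {R : Rules} {x y : ℕ} {f : QPoly} (hR : R x y = some f) (a b : Word) :
    redex R (a ++ x :: y :: b) = some (a, f, b) ∨
      (∃ a' z g, a = a' ++ [z] ∧ R z x = some g ∧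
        redex R (a ++ x :: y :: b) = some (a', g, y :: b)) ∨
      ∃ a' z z' c g, a = a' ++ z :: z' :: c ∧ R z z' = some g ∧
        redex R (a ++ x :: y :: b) = some (a', g, c ++ x :: y :: b) := by
  induction a with
  | nil => left; simp [redex, hR]
  | cons z a ih =>
    cases a with
    | nil =>
      cases hz : R z x with
      | some g => right; left; exact ⟨[], z, g, rfl, hz, by simp [redex, hz]⟩
      | none => left; simp [redex, hz, hR]
    | cons z' a =>
      cases hz : R z z' with
      | some g =>
        right; right
        exact ⟨[], z, z', a, g, rfl, hz, by simp [redex, hz]⟩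
      | none =>
        have key : ∀ {o}, redex R (z' :: a ++ x :: y :: b) = some o →
            redex R (z :: z' :: a ++ x :: y :: b) = some (z :: o.1, o.2) := by
          intro o ho
          rw [List.cons_append] at ho
          rw [List.cons_append, List.cons_append, redex]
          simp only [hz, ho]
        rcases ih with h | ⟨a', u, g, ha, hg, h⟩ | ⟨a', u, u', c, g, ha, hg, h⟩
        · left; exact key h
        · right; left; exact ⟨z :: a', u, g, by rw [ha]; rfl, hg, key h⟩
        · right; right; exact ⟨z :: a', u, u', c, g, by rw [ha]; rfl, hg, key h⟩

/-- Reduces the first polynomial to normal form and adds it to the second one. The first argument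
bounds the number of steps; if it is too small, then the result is not a normal form. -/
def reduce (R : Rules) : ℕ → QPoly → QPoly → QPoly
  | 0, p, out => p ++ out
  | _ + 1, [], out => out
  | n + 1, x :: p, out =>
    match redex R x.1 with
    | none => reduce R n p (QPoly.ins x.1 x.2 out)
    | some (a, f, b) => reduce R n (x.2 • QPoly.inContext a f b + p) out

open QPoly in
/-- Reduction does not change the value of a polynomial, provided that the rules preserve the
values of the words in a set that is closed under rewriting and contains the words of the
polynomial. -/
theorem lin_reduce {S M : Type*} [Field S] [AddCommGroup M] [Module S M] {t : S} (ht : t ≠ 0)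
    {L : Word → M} {R : Rules} {P : Word → Prop}
    (hR : ∀ a x y b f, R x y = some f → P (a ++ x :: y :: b) →
      L (a ++ x :: y :: b) = lin t (fun w => L (a ++ w ++ b)) f ∧ ∀ v ∈ f, P (a ++ v.1 ++ b))
    (n : ℕ) (p out : QPoly) (hp : ∀ v ∈ p, P v.1) :
    lin t L (reduce R n p out) = lin t L p + lin t L out := by
  induction n generalizing p out with
  | zero => simp [reduce]
  | succ n ih =>
    cases p with
    | nil => simp [reduce]
    | cons x p =>
      simp only [List.forall_mem_cons] at hp
      unfold reduce
      split
      · rw [ih _ _ hp.2, lin_ins, lin_cons]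
        abel
      · next a f b h =>
        obtain ⟨y, z, hyz, hx⟩ := redex_eq_some h
        obtain ⟨h1, h2⟩ := hR a y z b f hyz (hx ▸ hp.1)
        rw [ih _ _ (forall_mem_add (forall_mem_smul ?_) hp.2), lin_add, lin_smul ht,
          lin_inContext, ← h1, ← hx, lin_cons]
        exact List.forall_mem_map.2 h2

open QPoly in
/-- Reduction by rules that hold in an algebra does not change the value of a polynomial. -/
theorem ev_reduce {A : Type*} [Ring A] [Algebra K A] {X : ℕ → A} {R : Rules}
    (hR : ∀ x y f, R x y = some f → X x * X y = ev X f) (n : ℕ) (p : QPoly) :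
    ev X (reduce R n p []) = ev X p := by
  refine (lin_reduce q_ne_zero (P := fun _ => True) (fun a x y b f h _ => ⟨?_, by simp⟩) n p []
    (by simp)).trans (by simp [ev])
  have := map_lin (t := q) (L := fun w : Word => (w.map X).prod)
    ((LinearMap.mulLeft K (a.map X).prod).comp (LinearMap.mulRight K (b.map X).prod)) f
  simp only [LinearMap.comp_apply, LinearMap.mulLeft_apply, LinearMap.mulRight_apply] at this
  simp only [List.map_append, List.map_cons, List.prod_append, List.prod_cons, mul_assoc]
  rw [← this, ← mul_assoc (X x), hR x y f h, ev]

open QPoly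

/-! ### The PBW rewriting system -/

/-- The expansions of the products `j * i` of letters, `i < j`, into ordered words, as prescribed by
the PBW relations. The entry `i` of row `j` belongs to `j * i`; it begins with the multiple of
`i * j`. -/
def table : List (List QPoly) :=
  [[],
  [[([0, 1], [(1, 2)])]],
  [[([0, 2], [(1, 2)])],
   [([1, 2], [(1, 0)])]],
  [[([0, 3], [(1, 0)])],
   [([1, 3], [(1, 0)])],
   [([2, 3], [(1, -2)]), ([8], [(1, 0), (-1, -2)])]],
  [[([0, 4], [(1, 0)])],
   [([1, 4], [(1, -2)]), ([8], [(1, 0), (-1, -2)])],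
   [([2, 4], [(1, 0)])],
   [([3, 4], [(1, 0)]), ([0, 6], [(1, 1), (-1, -1)]), ([0, 7], [(-1, 1), (1, -1)]),
    ([1, 4], [(1, -1), (-1, -3)]), ([2, 3], [(-1, -1), (1, -3)])]],
  [[([0, 5], [(1, 0)]), ([1, 2], [(1, 2), (-1, -2)]), ([8], [(1, 1), (-1, -1)])],
   [([1, 5], [(1, 2)])],
   [([2, 5], [(1, 2)])],
   [([3, 5], [(1, 0)]), ([1, 6], [(1, 2), (-1, 0)])],
   [([4, 5], [(1, 0)]), ([2, 7], [(1, 2), (-1, 0)])]],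
  [[([0, 6], [(1, 0)]), ([2, 3], [(1, 0), (-1, -2)]), ([8], [(-1, 0), (1, -2)])],
   [([1, 6], [(1, 2)])],
   [([2, 6], [(1, 0)])],
   [([3, 6], [(1, 2)]), ([3, 5], [(1, 1), (-1, -1)]), ([1, 6], [(-1, 1), (1, -1)]),
    ([8, 11], [(-1, 1), (1, -1)])],
   [([4, 6], [(1, -2)]), ([4, 5], [(-1, -1), (1, -3)]), ([2, 7], [(1, -1), (-1, -3)]),
    ([2, 9], [(1, 0), (-1, -2)])],
   [([5, 6], [(1, 0)])]],
  [[([0, 7], [(1, 0)]), ([1, 4], [(1, 0), (-1, -2)]), ([8], [(-1, 0), (1, -2)])],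
   [([1, 7], [(1, 0)])],
   [([2, 7], [(1, 2)])],
   [([3, 7], [(1, -2)]), ([3, 5], [(-1, -1), (1, -3)]), ([1, 6], [(1, -1), (-1, -3)]),
    ([1, 9], [(1, 0), (-1, -2)])],
   [([4, 7], [(1, 2)]), ([4, 5], [(1, 1), (-1, -1)]), ([2, 7], [(-1, 1), (1, -1)]),
    ([8, 10], [(-1, 1), (1, -1)])],
   [([5, 7], [(1, 0)])],
   [([6, 7], [(1, 0)])]],
  [[([0, 8], [(1, 2)])],
   [([1, 8], [(1, 0)])],
   [([2, 8], [(1, 0)])],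
   [([3, 8], [(1, 0)]), ([0, 1, 6], [(1, 3), (-1, 1)]), ([1, 8], [(1, -1), (-1, -3)]),
    ([1, 2, 3], [(-1, -1), (1, -3)])],
   [([4, 8], [(1, 0)]), ([0, 2, 7], [(1, 3), (-1, 1)]), ([2, 8], [(1, -1), (-1, -3)]),
    ([1, 2, 4], [(-1, -1), (1, -3)])],
   [([5, 8], [(1, -2)])],
   [([6, 8], [(1, 0)]), ([1, 2, 6], [(1, 1), (-1, -1)]), ([2, 3, 5], [(-1, 1), (1, -1)]),
    ([5, 8], [(1, -1), (-1, -3)])],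
   [([7, 8], [(1, 0)]), ([1, 2, 7], [(1, 1), (-1, -1)]), ([1, 4, 5], [(-1, 1), (1, -1)]),
    ([5, 8], [(1, -1), (-1, -3)])]],
  [[([0, 9], [(1, -2)]), ([0, 6], [(-1, -1), (1, -3)]), ([0, 7], [(-1, 1), (1, -1)]),
    ([2, 3], [(1, -3), (-1, -5)]), ([3, 4], [(1, 0), (-1, -2)]), ([1, 4], [(1, -1), (-1, -3)]),
    ([8], [(1, 1), (-1, -1), (-1, -3), (1, -5)])],
   [([1, 9], [(1, 0)]), ([1, 6], [(-1, 1), (1, -1)]), ([3, 5], [(1, 1), (-1, -1)])],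
   [([2, 9], [(1, 0)]), ([2, 7], [(-1, 1), (1, -1)]), ([4, 5], [(1, 1), (-1, -1)])],
   [([3, 9], [(1, 0)]), ([0, 7, 11], [(-1, 0), (1, -2)]), ([1, 4, 11], [(1, -2), (-1, -4)]),
    ([1, 9], [(-1, -1), (1, -3)]), ([3, 7], [(1, -1), (-1, -3)]),
    ([8, 11], [(1, 0), (-2, -2), (1, -4)]), ([1, 6], [(1, 0), (-2, -2), (1, -4)]),
    ([3, 5], [(-1, 0), (2, -2), (-1, -4)])],
   [([4, 9], [(1, 0)]), ([0, 6, 10], [(-1, 0), (1, -2)]), ([2, 3, 10], [(1, -2), (-1, -4)]),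
    ([2, 9], [(-1, -1), (1, -3)]), ([4, 6], [(1, -1), (-1, -3)]),
    ([8, 10], [(1, 0), (-2, -2), (1, -4)]), ([2, 7], [(1, 0), (-2, -2), (1, -4)]),
    ([4, 5], [(-1, 0), (2, -2), (-1, -4)])],
   [([5, 9], [(1, 2)]), ([6, 7], [(-1, 2), (1, 0)])],
   [([6, 9], [(1, 0)]), ([5, 9], [(-1, 1), (1, -1)]), ([6, 7], [(1, 1), (-1, -1)]),
    ([2, 7, 11], [(-1, 0), (1, -2)]), ([4, 5, 11], [(1, 0), (-1, -2)])],
   [([7, 9], [(1, 0)]), ([5, 9], [(-1, 1), (1, -1)]), ([6, 7], [(1, 1), (-1, -1)]),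
    ([1, 6, 10], [(-1, 0), (1, -2)]), ([3, 5, 10], [(1, 0), (-1, -2)])],
   [([8, 9], [(1, 0)]), ([0, 5, 6], [(-1, 0), (1, -2)]), ([0, 5, 7], [(-1, 2), (1, 0)]),
    ([0, 6, 7], [(-1, 1), (1, -1)]), ([1, 2, 6], [(1, 0), (-1, -2)]),
    ([1, 2, 7], [(1, 0), (-1, -2)]), ([3, 4, 5], [(1, 1), (-1, -1)]),
    ([2, 3, 5], [(-1, 0), (2, -2), (-1, -4)]), ([5, 8], [(1, -2), (-2, -4), (1, -6)])]],
  [[([0, 10], [(1, -2)]), ([2], [(1, 2), (-1, -2)]), ([4], [(1, 1), (-1, -1)])],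
   [([1, 10], [(1, -2)]), ([5], [(1, 2), (-1, -2)]), ([7], [(1, 1), (-1, -1)])],
   [([2, 10], [(1, 2)])],
   [([3, 10], [(1, -2)]), ([9], [(1, 1), (-1, -1)]), ([6], [(1, 2), (-1, -2)])],
   [([4, 10], [(1, 0)])],
   [([5, 10], [(1, 2)])],
   [([6, 10], [(1, 2)])],
   [([7, 10], [(1, 0)])],
   [([8, 10], [(1, 0)]), ([2, 7], [(-1, 2), (1, 0)]), ([4, 5], [(1, 2), (-1, 0)])],
   [([9, 10], [(1, 0)])]],
  [[([0, 11], [(1, -2)]), ([1], [(1, 2), (-1, -2)]), ([3], [(1, 1), (-1, -1)])],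
   [([1, 11], [(1, 2)])],
   [([2, 11], [(1, -2)]), ([5], [(1, 2), (-1, -2)]), ([6], [(1, 1), (-1, -1)])],
   [([3, 11], [(1, 0)])],
   [([4, 11], [(1, -2)]), ([9], [(1, 1), (-1, -1)]), ([7], [(1, 2), (-1, -2)])],
   [([5, 11], [(1, 2)])],
   [([6, 11], [(1, 0)])],
   [([7, 11], [(1, 2)])],
   [([8, 11], [(1, 0)]), ([1, 6], [(-1, 2), (1, 0)]), ([3, 5], [(1, 2), (-1, 0)])],
   [([9, 11], [(1, 0)])],
   [([10, 11], [(1, 0)])]]]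

/-- The ordered expression of the product `j * i` of letters, for `i < j`. -/
def ordered (j i : ℕ) : QPoly := (table.getD j []).getD i []

/-- The rewriting system of the PBW relations. -/
def pbwRules : Rules := fun j i => match Nat.blt i j with
  | true => match Nat.blt j 12 with
    | true => some (ordered j i)
    | false => none
  | false => none

theorem pbwRules_eq_some {j i : ℕ} {f : QPoly} :
    pbwRules j i = some f ↔ i < j ∧ j < 12 ∧ f = ordered j i := by
  unfold pbwRules
  split
  · next h =>
    have h : i < j := by simpa [Nat.blt_eq] using h
    split
    · next h' =>
      have h' : j < 12 := by simpa [Nat.blt_eq] using h'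
      simp [h, h', eq_comm]
    · next h' =>
      have h' : ¬ j < 12 := by simpa [Nat.blt_eq, ← Bool.not_eq_true] using h'
      simp [h']
  · next h =>
    have h : ¬ i < j := by simpa [Nat.blt_eq, ← Bool.not_eq_true] using h
    simp [h]

/-- The difference of the two ways to rewrite the word `k * j * i`. -/
def overlap (R : Rules) (k j i : ℕ) : QPoly :=
  match R k j, R j i with
  | some f, some g => QPoly.inContext [] f [i] - QPoly.inContext [k] g []
  | _, _ => []

/-- Both ways to rewrite each of the words `k * j * i`, `i < j < k`, lead to the same result. -/
def overlapsResolve : Bool :=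
  (List.range 12).all fun k => (List.range k).all fun j => (List.range j).all fun i =>
    match reduce pbwRules 1000 (overlap pbwRules k j i) [] with
    | [] => true
    | _ => false

set_option maxRecDepth 100000 in
theorem overlapsResolve_eq_true : overlapsResolve = true := by decide +kernel

theorem reduce_overlap {k j i : ℕ} (hij : i < j) (hjk : j < k) (hk : k < 12) :
    reduce pbwRules 1000 (overlap pbwRules k j i) [] = [] := by
  have h := overlapsResolve_eq_true
  simp only [overlapsResolve, List.all_eq_true, List.mem_range] at h
  have := h k hk j hjk i hij
  split at this
  · assumption
  · simp at this

/-- Weights of the letters for which the PBW relations are homogeneous up to terms of smaller weight: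
all words of `ordered j i` except for `i * j` have a smaller weight than `j * i`. -/
def letterWeight (k : ℕ) : ℕ := [7, 0, 0, 10, 9, 0, 7, 5, 6, 14, 6, 8].getD k 0

/-- The sum of the weights of the letters. -/
def weight (w : Word) : ℕ := (w.map letterWeight).sum

/-- The number of pairs of letters that are in the wrong order. -/
def inversions : Word → ℕ
  | [] => 0
  | x :: w => w.countP (· < x) + inversions w

theorem inversions_swap {i j : ℕ} (hij : i < j) (a b : Word) :
    inversions (a ++ i :: j :: b) < inversions (a ++ j :: i :: b) := by
  induction a with
  | nil =>
    simp only [List.nil_append, inversions, List.countP_cons, hij, decide_true, if_true]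
    simp only [not_lt_of_gt hij, decide_false]
    simp
    omega
  | cons x a ih =>
    have h : (a ++ i :: j :: b).countP (· < x) = (a ++ j :: i :: b).countP (· < x) := by
      simp only [List.countP_append, List.countP_cons]
      omega
    simp only [List.cons_append, inversions, h]
    omega

/-- The rank of a word, which decreases under rewriting. -/
def rank (w : Word) : ℕ ×ₗ ℕ := toLex (weight w, inversions w)

theorem ordered_weight : ∀ j < 12, ∀ i < j, ∀ v ∈ ordered j i,
    v.1 = [i, j] ∨ weight v.1 < weight [j, i] := by
  decide +kernel

theorem rank_lt {j i : ℕ} {f : QPoly} (hf : pbwRules j i = some f) (a b : Word)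
    {v : Word × Scalar} (hv : v ∈ f) : rank (a ++ v.1 ++ b) < rank (a ++ j :: i :: b) := by
  obtain ⟨hij, hj, rfl⟩ := pbwRules_eq_some.1 hf
  rw [rank, rank, Prod.Lex.toLex_lt_toLex]
  rcases ordered_weight j hj i hij v hv with h | h
  · right
    rw [h]
    constructor
    · simp [weight]
      omega
    · simpa using inversions_swap hij a b
  · left
    simp only [weight, List.map_append, List.map_cons, List.sum_append, List.sum_cons] at h ⊢
    simp at h
    omega

/-- The normal form of a word with respect to the PBW relations. The bound on the rank, which
always holds, serves to make the recursion well-founded. -/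
def normalForm (w : Word) : Word →₀ K :=
  match redex pbwRules w with
  | none => Finsupp.single w 1
  | some (a, f, b) =>
    lin q (fun v => if rank (a ++ v ++ b) < rank w then normalForm (a ++ v ++ b) else 0) f
termination_by rank w
decreasing_by assumption

theorem normalForm_of_redex_eq_none {w : Word} (h : redex pbwRules w = none) :
    normalForm w = Finsupp.single w 1 := by
  rw [normalForm, h]

theorem normalForm_of_redex_eq_some {w a b : Word} {f : QPoly}
    (h : redex pbwRules w = some (a, f, b)) :
    normalForm w = lin q (fun v => normalForm (a ++ v ++ b)) f := by
  obtain ⟨x, y, hf, hw⟩ := redex_eq_some h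
  rw [normalForm, h]
  exact lin_congr fun v hv => if_pos (hw ▸ rank_lt hf a b hv)

/-- Bergman's diamond lemma: the normal form of a word may be computed by applying a rule at any
place of the word. -/
theorem normalForm_append {x y : ℕ} {f : QPoly} (hf : pbwRules x y = some f) (a b : Word) :
    normalForm (a ++ x :: y :: b) = lin q (fun v => normalForm (a ++ v ++ b)) f := by
  suffices ∀ w : Word, ∀ x y f a b, pbwRules x y = some f → w = a ++ x :: y :: b →
      normalForm w = lin q (fun v => normalForm (a ++ v ++ b)) f from this _ _ _ _ _ _ hf rfl
  intro w
  induction hr : rank w using WellFoundedLT.induction generalizing w with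
  | ind r ih =>
  subst hr
  replace ih : ∀ a x y b f, pbwRules x y = some f → rank (a ++ x :: y :: b) < rank w →
      normalForm (a ++ x :: y :: b) = lin q (fun v => normalForm (a ++ v ++ b)) f :=
    fun a x y b f hf h => ih _ h _ rfl x y f a b hf rfl
  rintro x y f a b hf rfl
  rcases redex_append hf a b with h | ⟨a', z, g, rfl, hg, h⟩ | ⟨a', z, z', c, g, rfl, hg, h⟩
  · exact normalForm_of_redex_eq_some h
  · -- the overlapping case, which is settled by the resolution of the overlap `z * x * y`
    rw [normalForm_of_redex_eq_some h]
    obtain ⟨hyx, -, rfl⟩ := pbwRules_eq_some.1 hf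
    obtain ⟨hxz, hz, rfl⟩ := pbwRules_eq_some.1 hg
    have hov : overlap pbwRules z x y =
        inContext [] (ordered z x) [y] - inContext [z] (ordered x y) [] := by
      simp [overlap, hf, hg]
    have key := lin_reduce q_ne_zero (L := fun w => normalForm (a' ++ w ++ b)) (R := pbwRules)
      (P := fun w => rank (a' ++ w ++ b) < rank (a' ++ [z] ++ x :: y :: b)) ?_ 1000
      (overlap pbwRules z x y) [] ?_
    · rw [reduce_overlap hyx hxz hz, hov, lin_sub q_ne_zero, lin_inContext, lin_inContext] at key
      simp only [lin_nil, add_zero] at key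
      simpa using (sub_eq_zero.1 key.symm)
    · intro a₁ x₁ y₁ b₁ f₁ h₁ hP
      constructor
      · have := ih (a' ++ a₁) x₁ y₁ (b₁ ++ b) f₁ h₁ (by simpa using hP)
        simpa using this
      · intro v hv
        refine lt_trans ?_ hP
        simpa using rank_lt h₁ (a' ++ a₁) (b₁ ++ b) hv
    · rw [hov]
      refine forall_mem_sub (P := fun w => rank (a' ++ w ++ b) < rank (a' ++ [z] ++ x :: y :: b))
        (List.forall_mem_map.2 fun v hv => ?_)
        (List.forall_mem_map.2 fun v hv => ?_)
      · simpa using rank_lt hg a' (y :: b) hv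
      · simpa using rank_lt hf (a' ++ [z]) b hv
  · -- the disjoint case, in which the two rules commute
    rw [normalForm_of_redex_eq_some h]
    calc
      _ = lin q (fun v => lin q (fun u => normalForm (a' ++ v ++ c ++ u ++ b)) f) g := by
        refine lin_congr fun v hv => ?_
        have := ih (a' ++ v.1 ++ c) x y b f hf (by simpa using rank_lt hg a' (c ++ x :: y :: b) hv)
        simpa using this
      _ = lin q (fun u => lin q (fun v => normalForm (a' ++ v ++ c ++ u ++ b)) g) f := lin_comm _
      _ = _ := by
        refine lin_congr fun u hu => ?_
        have := ih a' z z' (c ++ u.1 ++ b) g hg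
          (by simpa using rank_lt hf (a' ++ z :: z' :: c) b hu)
        simpa using this.symm

/-! ### Operators that satisfy the PBW relations -/

/-- The operators on the space of words that send a word `w` to the normal form of `k * w`. -/
def letterOperator (k : ℕ) : Module.End K (Word →₀ K) :=
  Finsupp.linearCombination K fun w => normalForm (k :: w)

theorem linearCombination_normalForm (u w : Word) :
    Finsupp.linearCombination K (fun v => normalForm (u ++ v)) (normalForm w) =
      normalForm (u ++ w) := by
  induction hr : rank w using WellFoundedLT.induction generalizing w with
  | ind r ih =>
  subst hr
  cases h : redex pbwRules w with
  | none => simp [normalForm_of_redex_eq_none h]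
  | some o =>
    obtain ⟨a, f, b⟩ := o
    obtain ⟨x, y, hf, hw⟩ := redex_eq_some h
    have := normalForm_append hf (u ++ a) b
    rw [normalForm_of_redex_eq_some h, map_lin, hw, ← List.append_assoc, this]
    refine lin_congr fun v hv => ?_
    rw [ih _ (hw ▸ rank_lt hf a b hv) _ rfl]
    simp

theorem letterOperator_normalForm (k : ℕ) (w : Word) :
    letterOperator k (normalForm w) = normalForm (k :: w) :=
  linearCombination_normalForm [k] w

theorem letterOperator_word {w : Word} (hw : w ≠ []) (v : Word) :
    (w.map letterOperator).prod (Finsupp.single v 1) = normalForm (w ++ v) := by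
  induction w with
  | nil => simp at hw
  | cons x w ih =>
    cases w with
    | nil => simp [letterOperator]
    | cons y w =>
      rw [List.map_cons, List.prod_cons, Module.End.mul_apply, ih (by simp),
        letterOperator_normalForm]
      rfl

theorem ordered_ne_nil : ∀ j < 12, ∀ i < j, ∀ v ∈ ordered j i, v.1 ≠ [] := by
  decide +kernel

theorem letterOperator_mul {i j : ℕ} (hij : i < j) (hj : j < 12) :
    letterOperator j * letterOperator i = ev letterOperator (ordered j i) := by
  refine Finsupp.lhom_ext' fun v => LinearMap.ext_ring ?_
  have h := normalForm_append (pbwRules_eq_some.2 ⟨hij, hj, rfl⟩) [] v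
  have h' := letterOperator_word (w := [j, i]) (by simp) v
  simp only [List.map_cons, List.map_nil, List.prod_cons, List.prod_nil, mul_one] at h'
  have e := map_lin (t := q) (L := fun w : Word => (w.map letterOperator).prod)
    (LinearMap.applyₗ (R := K) (Finsupp.single v (1 : K))) (ordered j i)
  simp only [LinearMap.applyₗ_apply_apply] at e
  rw [LinearMap.comp_apply, LinearMap.comp_apply, Finsupp.lsingle_apply, h', ev, e]
  simp only [List.nil_append, List.cons_append] at h ⊢
  rw [h]
  exact lin_congr fun u hu => (letterOperator_word (ordered_ne_nil j hj i hij u hu) v).symm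

/-! ### Relations as polynomials -/

namespace Scalar

instance : Mul Scalar := ⟨mul⟩

/-- `q ^ n`. -/
def qPow (n : ℕ) : Scalar := [(1, n)]

/-- `q ^ (-n)`. -/
def qInv (n : ℕ) : Scalar := [(1, -n)]

/-- `h n`. -/
def hPow (n : ℕ) : Scalar := [(1, n), (-1, -n)]

/-- The square of `h 1`. -/
def hSq : Scalar := [(1, 2), (-2, 0), (1, -2)]

/-- `1 - q ^ n`. -/
def oneSub (n : ℕ) : Scalar := [(-1, n), (1, 0)]

/-- `q + q⁻¹`. -/
def qTwo : Scalar := [(1, 1), (1, -1)]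

theorem val_mul_q (s t : Scalar) : val q (s * t) = val q s * val q t := val_mul q_ne_zero s t

theorem val_qPow (n : ℕ) : val q (qPow n) = q ^ n := by simp [qPow]

theorem val_qInv (n : ℕ) : val q (qInv n) = q⁻¹ ^ n := by simp [qInv]

theorem val_hPow (n : ℕ) : val q (hPow n) = h n := by simp [hPow, h, sub_eq_add_neg]

theorem val_hSq : val q hSq = h 1 ^ 2 := by
  have := q_ne_zero
  simp only [hSq, h, val_cons, val_nil]
  simp only [zpow_neg, zpow_ofNat]
  field_simp
  push_cast
  ring

theorem val_oneSub (n : ℕ) : val q (oneSub n) = 1 - q ^ n := by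
  simp [oneSub]
  ring

theorem val_qTwo : val q qTwo = q + q⁻¹ := by simp [qTwo]

/-- A criterion for a Laurent polynomial with exponents at least `-40` to be nonzero: its value at
`2` is nonzero. -/
def isNonzero (s : Scalar) : Bool :=
  (s.all fun x => decide (-40 ≤ x.2)) &&
    decide ((s.map fun x => x.1 * 2 ^ (x.2 + 40).toNat).sum ≠ 0)

theorem val_ne_zero {s : Scalar} (hs : s.isNonzero = true) : val q s ≠ 0 := by
  simp only [isNonzero, Bool.and_eq_true, List.all_eq_true, decide_eq_true_eq] at hs
  obtain ⟨h1, h2⟩ := hs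
  let p : Polynomial ℂ :=
    (s.map fun x => Polynomial.C (x.1 : ℂ) * Polynomial.X ^ (x.2 + 40).toNat).sum
  have hp : algebraMap (Polynomial ℂ) K p = q ^ (40 : ℤ) * val q s := by
    clear h2
    induction s with
    | nil => simp [p]
    | cons x s ih =>
      simp only [List.forall_mem_cons] at h1
      have h3 : algebraMap (Polynomial ℂ) K (Polynomial.C (x.1 : ℂ) *
          Polynomial.X ^ (x.2 + 40).toNat) = q ^ (40 : ℤ) * ((x.1 : K) * q ^ x.2) := by
        have h4 : (q : K) ^ (x.2 + 40).toNat = q ^ (40 : ℤ) * q ^ x.2 := by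
          rw [← zpow_add₀ q_ne_zero, ← zpow_natCast, Int.toNat_of_nonneg (by omega), add_comm]
        rw [map_mul, map_pow, RatFunc.algebraMap_X, ← q, h4, map_intCast, map_intCast]
        ring
      simp only [p, List.map_cons, List.sum_cons, map_add, val_cons, mul_add, h3]
      exact congrArg _ (ih h1.2)
  intro h0
  rw [h0, mul_zero, map_eq_zero_iff _ (RatFunc.algebraMap_injective ℂ)] at hp
  apply h2
  have h5 : (((s.map fun x => x.1 * 2 ^ (x.2 + 40).toNat).sum : ℤ) : ℂ) = p.eval 2 := by
    simp only [p]
    clear * -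
    induction s with
    | nil => simp
    | cons x s ih => simp [ih]
  rw [hp, Polynomial.eval_zero] at h5
  exact_mod_cast h5

end Scalar

theorem h_ne_zero {n : ℕ} (hn : (Scalar.hPow n).isNonzero = true) : h n ≠ 0 :=
  Scalar.val_hPow n ▸ Scalar.val_ne_zero hn

instance : Neg QPoly := ⟨fun p => ([(-1, 0)] : Scalar) • p⟩

/-- A letter as a polynomial. -/
def letter (k : ℕ) : QPoly := [([k], [(1, 0)])]

/-- The letters as polynomials. -/
def letters : Family QPoly where
  Y₂ := letter 0
  Y | .one => letter 11
    | .three => letter 10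
  Y₂ᵢ | .one => letter 1
      | .three => letter 2
  Y₁₃ := letter 5
  Z₂ᵢ | .one => letter 3
      | .three => letter 4
  Zᵢ₂ⱼ | .one => letter 6
       | .three => letter 7
  Z₁₂₃₂ := letter 8
  Z₁₃ := letter 9

/-- The member of a family that corresponds to a letter. -/
def Family.get {A : Type*} [Zero A] (F : Family A) : ℕ → A
  | 0 => F.Y₂
  | 1 => F.Y₂ᵢ .one
  | 2 => F.Y₂ᵢ .three
  | 3 => F.Z₂ᵢ .one
  | 4 => F.Z₂ᵢ .three
  | 5 => F.Y₁₃
  | 6 => F.Zᵢ₂ⱼ .one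
  | 7 => F.Zᵢ₂ⱼ .three
  | 8 => F.Z₁₂₃₂
  | 9 => F.Z₁₃
  | 10 => F.Y .three
  | 11 => F.Y .one
  | _ => 0

theorem Family.seq_eq_get {A : Type*} [Zero A] (F : Family A) (k : Fin 12) :
    F.seq k = F.get k := by
  fin_cases k <;> rfl

section Values

variable {A : Type*} [Ring A] [Algebra K A] (F : Family A)

theorem ev_letter (k : ℕ) : ev F.get (letter k) = F.get k := by simp [ev, letter]

theorem ev_Y₂ : ev F.get letters.Y₂ = F.Y₂ := ev_letter F 0

theorem ev_Y (i : Leg) : ev F.get (letters.Y i) = F.Y i := by cases i <;> exact ev_letter F _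

theorem ev_Y₂ᵢ (i : Leg) : ev F.get (letters.Y₂ᵢ i) = F.Y₂ᵢ i := by cases i <;> exact ev_letter F _

theorem ev_Y₁₃ : ev F.get letters.Y₁₃ = F.Y₁₃ := ev_letter F _

theorem ev_Z₂ᵢ (i : Leg) : ev F.get (letters.Z₂ᵢ i) = F.Z₂ᵢ i := by cases i <;> exact ev_letter F _

theorem ev_Zᵢ₂ⱼ (i : Leg) : ev F.get (letters.Zᵢ₂ⱼ i) = F.Zᵢ₂ⱼ i := by
  cases i <;> exact ev_letter F _

theorem ev_Z₁₂₃₂ : ev F.get letters.Z₁₂₃₂ = F.Z₁₂₃₂ := ev_letter F _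

theorem ev_Z₁₃ : ev F.get letters.Z₁₃ = F.Z₁₃ := ev_letter F _

theorem ev_neg (X : ℕ → A) (p : QPoly) : ev X (-p) = -ev X p :=
  (ev_smul X _ p).trans (by simp)

end Values

open Scalar in
/-- The PBW relations, as pairs of equal polynomials in the letters `p`. -/
def relations (p : Family QPoly) (i : Leg) : List (QPoly × QPoly) :=
  [(p.Y₂ᵢ i * p.Y₂, qPow 2 • (p.Y₂ * p.Y₂ᵢ i)),
   (p.Z₂ᵢ i * p.Y₂, p.Y₂ * p.Z₂ᵢ i),
   (p.Z₁₂₃₂ * p.Y₂, qPow 2 • (p.Y₂ * p.Z₁₂₃₂)),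
   (p.Y₁₃ * p.Y₂, p.Y₂ * p.Y₁₃ + hPow 2 • (p.Y₂ᵢ .one * p.Y₂ᵢ .three) + hPow 1 • p.Z₁₂₃₂),
   (p.Y₂ * p.Z₁₃, qPow 2 • (p.Z₁₃ * p.Y₂) + hPow 1 • (p.Y₂ * p.Zᵢ₂ⱼ .one + qPow 2 • (p.Y₂ *
     p.Zᵢ₂ⱼ .three) - qInv 2 • (p.Y₂ᵢ .three * p.Z₂ᵢ .one) - qPow 1 • (p.Z₂ᵢ .one * p.Z₂ᵢ .three)
     - p.Y₂ᵢ .one * p.Z₂ᵢ .three) - (hPow 1 * hPow 2) • p.Z₁₂₃₂),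
   (p.Zᵢ₂ⱼ i * p.Y₂, p.Y₂ * p.Zᵢ₂ⱼ i + (qInv 1 * hPow 1) • (p.Y₂ᵢ i.other * p.Z₂ᵢ i - p.Z₁₂₃₂)),
   (p.Y i * p.Y₂, qInv 2 • (p.Y₂ * p.Y i) + hPow 2 • p.Y₂ᵢ i + hPow 1 • p.Z₂ᵢ i),
   (p.Y₂ᵢ i * p.Z₁₃, p.Z₁₃ * p.Y₂ᵢ i + hPow 1 • (p.Y₂ᵢ i * p.Zᵢ₂ⱼ i - p.Z₂ᵢ i * p.Y₁₃)),
   (p.Y₂ᵢ .three * p.Y₂ᵢ .one, p.Y₂ᵢ .one * p.Y₂ᵢ .three),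
   (p.Z₂ᵢ i * p.Y₂ᵢ i, p.Y₂ᵢ i * p.Z₂ᵢ i),
   (p.Y₁₃ * p.Y₂ᵢ i, qPow 2 • (p.Y₂ᵢ i * p.Y₁₃)),
   (p.Zᵢ₂ⱼ i.other * p.Y₂ᵢ i, p.Y₂ᵢ i * p.Zᵢ₂ⱼ i.other),
   (p.Zᵢ₂ⱼ i * p.Y₂ᵢ i, qPow 2 • (p.Y₂ᵢ i * p.Zᵢ₂ⱼ i)),
   (p.Z₁₂₃₂ * p.Y₂ᵢ i, p.Y₂ᵢ i * p.Z₁₂₃₂),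
   (p.Y i * p.Y₂ᵢ i, qPow 2 • (p.Y₂ᵢ i * p.Y i)),
   (p.Y i.other * p.Y₂ᵢ i, qInv 2 • (p.Y₂ᵢ i * p.Y i.other) + hPow 2 • p.Y₁₃ + hPow 1 •
     p.Zᵢ₂ⱼ i.other),
   (p.Z₂ᵢ i.other * p.Y₂ᵢ i, qInv 2 • (p.Y₂ᵢ i * p.Z₂ᵢ i.other) + (qInv 1 * hPow 1) • p.Z₁₂₃₂),
   (p.Z₂ᵢ .three * p.Z₂ᵢ .one, p.Z₂ᵢ .one * p.Z₂ᵢ .three + hPow 1 • (p.Y₂ * p.Zᵢ₂ⱼ .one - p.Y₂ *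
     p.Zᵢ₂ⱼ .three + qInv 2 • (p.Y₂ᵢ .one * p.Z₂ᵢ .three) - qInv 2 • (p.Y₂ᵢ .three * p.Z₂ᵢ .one))),
   (p.Y₁₃ * p.Z₂ᵢ i, p.Z₂ᵢ i * p.Y₁₃ + (qPow 1 * hPow 1) • (p.Y₂ᵢ i * p.Zᵢ₂ⱼ i)),
   (p.Z₂ᵢ i * p.Zᵢ₂ⱼ i.other, qPow 2 • (p.Zᵢ₂ⱼ i.other * p.Z₂ᵢ i) + hPow 1 • (p.Z₂ᵢ i * p.Y₁₃ -
     p.Y₂ᵢ i * p.Zᵢ₂ⱼ i - qPow 1 • (p.Y₂ᵢ i * p.Z₁₃))),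
   (p.Zᵢ₂ⱼ i * p.Z₂ᵢ i, qPow 2 • (p.Z₂ᵢ i * p.Zᵢ₂ⱼ i) + hPow 1 • (p.Z₂ᵢ i * p.Y₁₃ - p.Y₂ᵢ i *
     p.Zᵢ₂ⱼ i - p.Z₁₂₃₂ * p.Y i)),
   (p.Z₁₂₃₂ * p.Z₂ᵢ i, p.Z₂ᵢ i * p.Z₁₂₃₂ + hPow 1 • (qPow 2 • (p.Y₂ * p.Y₂ᵢ i * p.Zᵢ₂ⱼ i) +
     qInv 2 • (p.Y₂ᵢ i * p.Z₁₂₃₂) - qInv 2 • (p.Y₂ᵢ .one * p.Y₂ᵢ .three * p.Z₂ᵢ i))),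
   (p.Z₁₃ * p.Z₂ᵢ i, p.Z₂ᵢ i * p.Z₁₃ + (hPow 1 * qInv 2) • (-(qPow 1 • (p.Y₂ * p.Zᵢ₂ⱼ i.other *
     p.Y i)) + qInv 1 • (p.Y₂ᵢ i * p.Z₂ᵢ i.other * p.Y i) - p.Y₂ᵢ i * p.Z₁₃ + p.Z₂ᵢ i *
     p.Zᵢ₂ⱼ i.other) + (hSq * qInv 2) • (p.Z₁₂₃₂ * p.Y i + p.Y₂ᵢ i * p.Zᵢ₂ⱼ i - p.Z₂ᵢ i * p.Y₁₃)),
   (p.Y i * p.Z₂ᵢ i.other, qInv 2 • (p.Z₂ᵢ i.other * p.Y i) + hPow 1 • p.Z₁₃ + hPow 2 •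
     p.Zᵢ₂ⱼ i.other),
   (p.Z₁₃ * p.Y₁₃, qPow 2 • (p.Y₁₃ * p.Z₁₃) - (qPow 1 * hPow 1) • (p.Zᵢ₂ⱼ .one * p.Zᵢ₂ⱼ .three)),
   (p.Y i * p.Z₂ᵢ i, p.Z₂ᵢ i * p.Y i),
   (p.Zᵢ₂ⱼ i * p.Y₁₃, p.Y₁₃ * p.Zᵢ₂ⱼ i),
   (p.Z₁₂₃₂ * p.Y₁₃, qInv 2 • (p.Y₁₃ * p.Z₁₂₃₂)),
   (p.Y i * p.Y₁₃, qPow 2 • (p.Y₁₃ * p.Y i)),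
   (p.Zᵢ₂ⱼ .three * p.Zᵢ₂ⱼ .one, p.Zᵢ₂ⱼ .one * p.Zᵢ₂ⱼ .three),
   (p.Z₁₂₃₂ * p.Zᵢ₂ⱼ i, p.Zᵢ₂ⱼ i * p.Z₁₂₃₂ + hPow 1 • (p.Y₂ᵢ .one * p.Y₂ᵢ .three * p.Zᵢ₂ⱼ i -
     p.Y₂ᵢ i.other * p.Z₂ᵢ i * p.Y₁₃ + qInv 2 • (p.Y₁₃ * p.Z₁₂₃₂))),
   (p.Zᵢ₂ⱼ i * p.Z₁₃, p.Z₁₃ * p.Zᵢ₂ⱼ i + hPow 1 • (p.Y₁₃ * p.Z₁₃ - p.Zᵢ₂ⱼ .one * p.Zᵢ₂ⱼ .three +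
     qInv 1 • (p.Y₂ᵢ i.other * p.Zᵢ₂ⱼ i.other * p.Y i) - qInv 1 • (p.Z₂ᵢ i.other * p.Y₁₃ *
     p.Y i))),
   (p.Z₁₂₃₂ * p.Z₁₃, p.Z₁₃ * p.Z₁₂₃₂ + hPow 1 • (qInv 1 • (p.Y₂ * p.Y₁₃ * p.Zᵢ₂ⱼ .one) + qPow 1 •
     (p.Y₂ * p.Y₁₃ * p.Zᵢ₂ⱼ .three) + p.Y₂ * p.Zᵢ₂ⱼ .one * p.Zᵢ₂ⱼ .three - qInv 1 • (p.Y₂ᵢ .one *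
     p.Y₂ᵢ .three * p.Zᵢ₂ⱼ .one) - qInv 1 • (p.Y₂ᵢ .one * p.Y₂ᵢ .three * p.Zᵢ₂ⱼ .three) -
     p.Z₂ᵢ .one * p.Z₂ᵢ .three * p.Y₁₃) + hSq • (qInv 2 • (p.Y₂ᵢ .three * p.Z₂ᵢ .one * p.Y₁₃) -
     qInv 4 • (p.Y₁₃ * p.Z₁₂₃₂))),
   (p.Y i * p.Z₁₂₃₂, p.Z₁₂₃₂ * p.Y i - (hPow 1 * qPow 1) • (p.Y₂ᵢ i * p.Zᵢ₂ⱼ i - p.Z₂ᵢ i *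
     p.Y₁₃)),
   (p.Y i * p.Zᵢ₂ⱼ i, p.Zᵢ₂ⱼ i * p.Y i),
   (p.Y i * p.Zᵢ₂ⱼ i.other, qPow 2 • (p.Zᵢ₂ⱼ i.other * p.Y i)),
   (p.Z₁₃ * p.Y i, p.Y i * p.Z₁₃),
   (p.Y .three * p.Y .one, p.Y .one * p.Y .three)]

theorem pbwRelations_iff {A : Type*} [Ring A] [Algebra K A] (F : Family A) :
    PBWRelations F ↔ ∀ i, ∀ r ∈ relations letters i, ev F.get r.1 = ev F.get r.2 := by
  simp only [relations, List.forall_mem_cons, List.not_mem_nil, false_imp_iff, implies_true, and_true,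
    ev_mul, ev_smul, ev_add, ev_sub, ev_neg, Scalar.val_mul_q, Scalar.val_qPow, Scalar.val_qInv,
    Scalar.val_hPow, Scalar.val_hSq, ev_Y₂, ev_Y, ev_Y₂ᵢ, ev_Y₁₃, ev_Z₂ᵢ, ev_Zᵢ₂ⱼ, ev_Z₁₂₃₂, ev_Z₁₃,
    pow_one]
  constructor
  · intro H i
    exact ⟨H.Y₂ᵢ_Y₂ i, H.Z₂ᵢ_Y₂ i, H.Z₁₂₃₂_Y₂, H.Y₁₃_Y₂, H.Y₂_Z₁₃, H.Zᵢ₂ⱼ_Y₂ i, H.Yᵢ_Y₂ i, H.Y₂ᵢ_Z₁₃ i,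
      H.Y₂₃_Y₂₁, H.Z₂ᵢ_Y₂ᵢ i, H.Y₁₃_Y₂ᵢ i, H.Zⱼ₂ᵢ_Y₂ᵢ i, H.Zᵢ₂ⱼ_Y₂ᵢ i, H.Z₁₂₃₂_Y₂ᵢ i, H.Yᵢ_Y₂ᵢ i,
      H.Yⱼ_Y₂ᵢ i, H.Z₂ⱼ_Y₂ᵢ i, H.Z₂₃_Z₂₁, H.Y₁₃_Z₂ᵢ i, H.Z₂ᵢ_Zⱼ₂ᵢ i, H.Zᵢ₂ⱼ_Z₂ᵢ i, H.Z₁₂₃₂_Z₂ᵢ i,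
      H.Z₁₃_Z₂ᵢ i, H.Yᵢ_Z₂ⱼ i, H.Z₁₃_Y₁₃, H.Yᵢ_Z₂ᵢ i, H.Zᵢ₂ⱼ_Y₁₃ i, H.Z₁₂₃₂_Y₁₃, H.Yᵢ_Y₁₃ i,
      H.Z₃₂₁_Z₁₂₃, H.Z₁₂₃₂_Zᵢ₂ⱼ i, H.Zᵢ₂ⱼ_Z₁₃ i, H.Z₁₂₃₂_Z₁₃, H.Yᵢ_Z₁₂₃₂ i, H.Yᵢ_Zᵢ₂ⱼ i,
      H.Yᵢ_Zⱼ₂ᵢ i, H.Z₁₃_Yᵢ i, H.Y₃_Y₁⟩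
  · intro H
    choose r0 r1 r2 r3 r4 r5 r6 r7 r8 r9 r10 r11 r12 r13 r14 r15 r16 r17 r18 r19
      r20 r21 r22 r23 r24 r25 r26 r27 r28 r29 r30 r31 r32 r33 r34 r35 r36 r37 using H
    exact ⟨r0, r1, r2 .one, r3 .one, r4 .one, r5, r6, r7, r8 .one, r9, r10, r11, r12, r13, r14, r15,
      r16, r17 .one, r18, r19, r20, r21, r22, r23, r24 .one, r25, r26, r27 .one, r28, r29 .one,
      r30, r31, r32 .one, r33, r34, r35, r36, r37 .one⟩

section Relations

open Scalar

namespace QPoly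

/-- The polynomial for `[a, b]_v`. -/
def br (v : Scalar) (a b : QPoly) : QPoly := a * b - v • (b * a)

/-- The polynomial for `[a, b]`. -/
def cm (a b : QPoly) : QPoly := a * b - b * a

/-- The polynomial for `z_{2i} = (1 - q²) Z_{2i}`. -/
def polyZ₂ (p : Family QPoly) (i : Leg) : QPoly := oneSub 2 • p.Z₂ᵢ i

/-- The polynomial for `z₁₃ = (1 - q²)² Z₁₃`. -/
def polyZ₁₃ (p : Family QPoly) : QPoly := (oneSub 2 * oneSub 2) • p.Z₁₃

end QPoly

/-- The defining relations of `𝒜_{q,4}`, as pairs of equal polynomials in the letters `p`. -/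
def serreRelations (p : Family QPoly) (i : Leg) : List (QPoly × QPoly) :=
  [(p.Y i * polyZ₂ p i, polyZ₂ p i * p.Y i),
   (p.Y₂ * polyZ₂ p i, polyZ₂ p i * p.Y₂),
   (p.Y i * polyZ₁₃ p, polyZ₁₃ p * p.Y i),
   (p.Y .one * p.Y .three, p.Y .three * p.Y .one),
   (br (qInv 2) (p.Y i) (br (qPow 2) (p.Y i) p.Y₂), hPow 1 • (p.Y i * polyZ₂ p i)),
   (br (qInv 2) p.Y₂ (br (qPow 2) p.Y₂ (p.Y i)), hPow 1 • (p.Y₂ * polyZ₂ p i)),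
   (br (qInv 2) (p.Y i) (br (qPow 2) (p.Y i) (polyZ₂ p i.other)), hPow 1 • (p.Y i * polyZ₁₃ p)),
   (qTwo • cm (polyZ₂ p .one) (polyZ₂ p .three),
     br (qPow 2) p.Y₂ (br (qInv 2) (polyZ₂ p .one) (p.Y .three)) -
       br (qPow 2) p.Y₂ (br (qInv 2) (polyZ₂ p .three) (p.Y .one))),
   (cm p.Y₂ (polyZ₁₃ p) + cm (polyZ₂ p i) (polyZ₂ p i.other),
     hPow 1 • (polyZ₂ p i.other * p.Y i * p.Y₂ - p.Y₂ * p.Y i * polyZ₂ p i.other)),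
   (([(2, 0)] : Scalar) • br (qPow 2) (polyZ₂ p i) (br (qInv 2) (polyZ₂ p i) (p.Y i.other)) +
       br (qPow 2) (polyZ₂ p i) (br (qInv 2) (p.Y i) (polyZ₂ p i.other)) +
       br (qPow 2) (p.Y i) (br (qInv 2) (polyZ₂ p i) (polyZ₂ p i.other)),
     hPow 1 • (polyZ₂ p i * (polyZ₁₃ p - p.Y i * p.Y i.other * p.Y₂ - p.Y₂ * p.Y i * p.Y i.other) +
         (polyZ₁₃ p - p.Y i * p.Y i.other * p.Y₂ - p.Y₂ * p.Y i * p.Y i.other) * polyZ₂ p i +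
       ([(1, 2), (1, 0), (1, -2)] : Scalar) •
         (p.Y i * p.Y₂ * p.Y i.other * polyZ₂ p i + polyZ₂ p i * p.Y i.other * p.Y₂ * p.Y i) -
       p.Y i.other * p.Y₂ * p.Y i * polyZ₂ p i - polyZ₂ p i * p.Y i * p.Y₂ * p.Y i.other)),
   (cm (polyZ₂ p i) (polyZ₁₃ p) -
       cm (p.Y i) (cm p.Y₂ (cm (p.Y i.other) (polyZ₂ p i))),
     hPow 1 • (p.Y i * polyZ₂ p i.other * polyZ₂ p i - polyZ₂ p i * polyZ₂ p i.other * p.Y i) +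
       hSq • (p.Y i * p.Y₂ * p.Y i.other * polyZ₂ p i - polyZ₂ p i * p.Y i.other * p.Y₂ * p.Y i))]

/-- The definitions of `Y_{2i}` and `Z_{i2j}`, freed of denominators, as pairs of equal polynomials in
the letters `p`. -/
def primaryDefinitions (p : Family QPoly) (i : Leg) : List (QPoly × QPoly) :=
  [(hPow 2 • p.Y₂ᵢ i, p.Y i * p.Y₂ - qInv 2 • (p.Y₂ * p.Y i) + qInv 1 • polyZ₂ p i),
   ((oneSub 4 * ([(1, 0), (-1, -2)] : Scalar)) • p.Zᵢ₂ⱼ i,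
     br (qInv 2) (p.Y i.other) (polyZ₂ p i) + qInv 1 • polyZ₁₃ p)]

/-- The definitions of `Y₁₃` and `Z₁₂₃₂` in terms of `i`, freed of denominators, as pairs of equal
polynomials in the letters `p`. -/
def secondaryDefinitions (p : Family QPoly) (i : Leg) : List (QPoly × QPoly) :=
  [((hPow 2 * qTwo) • p.Y₁₃,
     qTwo • br (qInv 2) (p.Y i.other) (p.Y₂ᵢ i) - hPow 2 • p.Zᵢ₂ⱼ i.other),
   (hPow 1 • p.Z₁₂₃₂,
     qPow 1 • (p.Z₂ᵢ i.other * p.Y₂ᵢ i) - qInv 1 • (p.Y₂ᵢ i * p.Z₂ᵢ i.other))]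

section Evaluation

variable {A : Type*} [Ring A] [Algebra K A] (F : Family A)

theorem ev_polyZ₂ (i : Leg) : ev F.get (polyZ₂ letters i) = (1 - q ^ 2) • F.Z₂ᵢ i := by
  rw [polyZ₂, ev_smul, val_oneSub, ev_Z₂ᵢ]

theorem ev_polyZ₁₃ : ev F.get (polyZ₁₃ letters) = ((1 - q ^ 2) ^ 2) • F.Z₁₃ := by
  rw [polyZ₁₃, ev_smul, val_mul_q, val_oneSub, ev_Z₁₃, ← pow_two (1 - q ^ 2)]

theorem ev_br (X : ℕ → A) (v : Scalar) (a b : QPoly) :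
    ev X (br v a b) = qbr (val q v) (ev X a) (ev X b) := by
  rw [br, ev_sub, ev_smul, ev_mul, ev_mul, qbr]

theorem ev_cm (X : ℕ → A) (a b : QPoly) : ev X (cm a b) = comm (ev X a) (ev X b) := by
  rw [cm, ev_sub, ev_mul, ev_mul, comm]

theorem val_cyclotomic : val q [(1, 2), (1, 0), (1, -2)] = q ^ 2 + 1 + q⁻¹ ^ 2 := by
  simp [add_assoc]

theorem val_two : val q [(2, 0)] = 2 := by simp

/-- The defining relations of `𝒜_{q,4}` under a homomorphism from the free algebra that sends its
generators to multiples of members of a family. -/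
theorem forall_serreRel_iff (f : FreeAlgebra K Gen →ₐ[K] A) (hu : ∀ i, f (fu i) = F.Y i)
    (hu₂ : f fu₂ = F.Y₂) (hz₂ : ∀ i, f (fz₂ i) = (1 - q ^ 2) • F.Z₂ᵢ i)
    (hz₁₃ : f fz₁₃ = ((1 - q ^ 2) ^ 2) • F.Z₁₃) :
    (∀ x y, SerreRel x y → f x = f y) ↔
      ∀ i, ∀ r ∈ serreRelations letters i, ev F.get r.1 = ev F.get r.2 := by
  have hq (v : K) (x y) : f (qbr v x y) = qbr v (f x) (f y) := by simp [qbr]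
  have hc (x y) : f (comm x y) = comm (f x) (f y) := by simp [comm]
  simp only [← ev_polyZ₂, ← ev_polyZ₁₃, ← ev_Y₂, ← ev_Y] at hu hu₂ hz₂ hz₁₃
  simp only [serreRelations, List.forall_mem_cons, List.not_mem_nil, false_imp_iff, implies_true,
    and_true, ev_mul, ev_smul, ev_add, ev_sub, ev_cm, ev_br, val_qPow, val_qInv, val_hPow,
    val_hSq, val_qTwo, val_two, val_cyclotomic, ← hu, ← hu₂, ← hz₂, ← hz₁₃, ← hq, ← hc, ← map_mul,
    ← map_sub, ← map_add, ← map_smul]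
  constructor
  · intro H i
    exact ⟨H _ _ (.u_z i), H _ _ (.u₂_z i), H _ _ (.u_z₁₃ i), H _ _ .u_u, H _ _ (.serre_u i),
      H _ _ (.serre_u₂ i), H _ _ (.serre_z i), H _ _ .z_z, H _ _ (.u₂_z₁₃ i), H _ _ (.z_z_u i),
      H _ _ (.z_z₁₃ i)⟩
  · intro H x y hxy
    choose r0 r1 r2 r3 r4 r5 r6 r7 r8 r9 r10 using H
    cases hxy with
    | u_z i => exact r0 i
    | u₂_z i => exact r1 i
    | u_z₁₃ i => exact r2 i
    | u_u => exact r3 .one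
    | serre_u i => exact r4 i
    | serre_u₂ i => exact r5 i
    | serre_z i => exact r6 i
    | z_z => exact r7 .one
    | u₂_z₁₃ i => exact r8 i
    | z_z_u i => exact r9 i
    | z_z₁₃ i => exact r10 i

theorem primaryDefinitions_iff (i : Leg) :
    (∀ r ∈ primaryDefinitions letters i, ev F.get r.1 = ev F.get r.2) ↔
      F.Y₂ᵢ i = (q ^ 2 - q⁻¹ ^ 2)⁻¹ • (F.Y i * F.Y₂ - q⁻¹ ^ 2 • (F.Y₂ * F.Y i) +
        q⁻¹ • (1 - q ^ 2) • F.Z₂ᵢ i) ∧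
      F.Zᵢ₂ⱼ i = ((1 - q ^ 4) * (1 - q⁻¹ ^ 2))⁻¹ •
        (qbr (q⁻¹ ^ 2) (F.Y i.other) ((1 - q ^ 2) • F.Z₂ᵢ i) + q⁻¹ • (1 - q ^ 2) ^ 2 • F.Z₁₃) := by
  have e2 : h 2 = q ^ 2 - q⁻¹ ^ 2 := rfl
  have e4 : val q [(1, 0), (-1, -2)] = 1 - q⁻¹ ^ 2 := by simp [sub_eq_add_neg]
  have h2 : q ^ 2 - q⁻¹ ^ 2 ≠ 0 := h_ne_zero (n := 2) (by decide)
  have h4 : (1 - q ^ 4) * (1 - q⁻¹ ^ 2) ≠ 0 :=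
    mul_ne_zero (val_oneSub 4 ▸ val_ne_zero (by decide)) (e4 ▸ val_ne_zero (by decide))
  simp only [primaryDefinitions, List.forall_mem_cons, List.not_mem_nil, false_imp_iff,
    implies_true, and_true, ev_mul, ev_smul, ev_add, ev_sub, ev_br, val_mul_q, val_qInv, val_hPow,
    val_oneSub, ev_polyZ₂, ev_polyZ₁₃, ev_Y₂, ev_Y, ev_Y₂ᵢ, ev_Zᵢ₂ⱼ, pow_one, e4, e2]
  rw [eq_inv_smul_iff₀ h2, eq_inv_smul_iff₀ h4]

theorem secondaryDefinitions_iff (i : Leg) :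
    (∀ r ∈ secondaryDefinitions letters i, ev F.get r.1 = ev F.get r.2) ↔
      F.Y₁₃ = (q ^ 2 - q⁻¹ ^ 2)⁻¹ • qbr (q⁻¹ ^ 2) (F.Y i.other) (F.Y₂ᵢ i) -
        (q + q⁻¹)⁻¹ • F.Zᵢ₂ⱼ i.other ∧
      F.Z₁₂₃₂ = (q - q⁻¹)⁻¹ •
        (q • (F.Z₂ᵢ i.other * F.Y₂ᵢ i) - q⁻¹ • (F.Y₂ᵢ i * F.Z₂ᵢ i.other)) := by
  have e1 : h 1 = q - q⁻¹ := by simp [h]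
  have e2 : h 2 = q ^ 2 - q⁻¹ ^ 2 := rfl
  have h1 : q - q⁻¹ ≠ 0 := e1 ▸ h_ne_zero (n := 1) (by decide)
  have h2 : q ^ 2 - q⁻¹ ^ 2 ≠ 0 := h_ne_zero (n := 2) (by decide)
  have h3 : q + q⁻¹ ≠ 0 := val_qTwo ▸ val_ne_zero (by decide)
  simp only [secondaryDefinitions, List.forall_mem_cons, List.not_mem_nil, false_imp_iff,
    implies_true, and_true, ev_mul, ev_smul, ev_sub, ev_br, val_mul_q, val_qPow, val_qInv,
    val_hPow, val_qTwo, ev_Y, ev_Y₂ᵢ, ev_Y₁₃, ev_Z₂ᵢ, ev_Zᵢ₂ⱼ, ev_Z₁₂₃₂, pow_one, e2, e1]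
  rw [eq_inv_smul_iff₀ h1]
  refine and_congr_left' ?_
  rw [← smul_right_inj (mul_ne_zero h2 h3) (m₁ := F.Y₁₃), smul_sub, smul_smul, smul_smul,
    mul_right_comm, mul_inv_cancel₀ h2, one_mul, mul_inv_cancel_right₀ h3]

end Evaluation

/-! ### Derivation of the PBW relations by linear algebra -/

/-- The coefficient of a word, provided that the word does not repeat. -/
def coeff (w : Word) : QPoly → Scalar
  | [] => []
  | x :: p => match beqWord w x.1 with
    | true => x.2
    | false => coeff w p

/-- The polynomial `d` is the multiple by the nonzero scalar `c` of the PBW relation for the product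
`j * i`. -/
def isMultiple (d : QPoly) (j i : ℕ) (c : Scalar) : Bool :=
  Nat.blt i j && Nat.blt j 12 && c.isNonzero &&
    (d - c • (letter j * letter i - ordered j i)).isEmpty

theorem isMultiple_iff {d : QPoly} {j i : ℕ} {c : Scalar} :
    isMultiple d j i c = true ↔ i < j ∧ j < 12 ∧ c.isNonzero = true ∧
      d - c • (letter j * letter i - ordered j i) = [] := by
  rw [isMultiple, Bool.and_eq_true, Bool.and_eq_true, Bool.and_eq_true, Nat.blt_eq, Nat.blt_eq,
    List.isEmpty_iff, and_assoc, and_assoc]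

theorem ev_eq_zero_iff_of_isMultiple {A : Type*} [Ring A] [Algebra K A] {X : ℕ → A} {d : QPoly}
    {j i : ℕ} {c : Scalar} (hd : isMultiple d j i c = true) :
    ev X d = 0 ↔ X j * X i = ev X (ordered j i) := by
  obtain ⟨-, -, hc, h⟩ := isMultiple_iff.1 hd
  have h' : ev X d - val q c • (X j * X i - ev X (ordered j i)) = 0 := by
    have := congrArg (ev X) h
    rw [ev_sub, ev_smul, ev_sub, ev_mul] at this
    simpa [letter, ev] using this
  rw [sub_eq_zero.1 h', smul_eq_zero, or_iff_right (val_ne_zero hc), sub_eq_zero]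

/-- The rewriting system of those PBW relations `j * i` for which the bit `12 * j + i` of `S` is
set. -/
def known (S : ℕ) : Rules := fun j i =>
  match Nat.blt i j && Nat.blt j 12 && S.testBit (12 * j + i) with
  | true => some (ordered j i)
  | false => none

/-- The sources of identities: a given polynomial that vanishes, or an overlap of known rules. -/
inductive Source : Type
  | given (n : ℕ)
  | overlap (k j i : ℕ)

/-- The polynomial of a source, reduced by the rules that are available. It vanishes wherever the
source and the rules hold. -/
def Source.poly (G : List QPoly) (S : ℕ) : Source → QPoly
  | given n => reduce (known S) 1000 (G.getD n []) []
  | overlap k j i => reduce (known S) 1000 (SlFourFolding.overlap (known S) k j i) []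

/-- A linear combination of sources. -/
def combination (G : List QPoly) (S : ℕ) : List (Scalar × Source) → QPoly
  | [] => []
  | x :: l => x.1 • x.2.poly G S + combination G S l

/-- `(j, i, c, l)` claims that the linear combination `l` is `c` times the PBW relation for `j * i`. -/
abbrev RelationStep : Type := ℕ × ℕ × Scalar × List (Scalar × Source)

/-- Derives one PBW relation after the other; finally all of them must be available. -/
def stepsDeriveAll (G : List QPoly) : ℕ → List RelationStep → Bool
  | S, [] => (List.range 12).all fun j => (List.range j).all fun i => S.testBit (12 * j + i)
  | S, (j, i, c, l) :: ds =>
    isMultiple (combination G S l) j i c && stepsDeriveAll G (S ||| 2 ^ (12 * j + i)) ds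

section Soundness

variable {A : Type*} [Ring A] [Algebra K A] {X : ℕ → A}

theorem ev_inContext (a b : Word) (p : QPoly) :
    ev X (inContext a p b) = (a.map X).prod * ev X p * (b.map X).prod := by
  have := map_lin (t := q) (L := fun w : Word => (w.map X).prod)
    ((LinearMap.mulRight K (b.map X).prod).comp (LinearMap.mulLeft K (a.map X).prod)) p
  simp only [LinearMap.comp_apply, LinearMap.mulLeft_apply, LinearMap.mulRight_apply] at this
  rw [ev, lin_inContext, ev, this]
  simp [mul_assoc]

theorem ev_overlap {R : Rules} (hR : ∀ x y f, R x y = some f → X x * X y = ev X f) (k j i : ℕ) :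
    ev X (overlap R k j i) = 0 := by
  unfold overlap
  split
  · next f g hf hg =>
    rw [ev_sub, ev_inContext, ev_inContext, ← hR _ _ _ hf, ← hR _ _ _ hg]
    simp [mul_assoc]
  · rfl

theorem ev_combination {G : List QPoly} (hG : ∀ p ∈ G, ev X p = 0) {S : ℕ}
    (hS : ∀ x y f, known S x y = some f → X x * X y = ev X f) (l : List (Scalar × Source)) :
    ev X (combination G S l) = 0 := by
  induction l with
  | nil => rfl
  | cons x l ih =>
    rw [combination, ev_add, ev_smul, ih, add_zero]
    suffices ev X (x.2.poly G S) = 0 by rw [this, smul_zero]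
    cases x.2 with
    | given n =>
      rw [Source.poly, ev_reduce hS, List.getD_eq_getElem?_getD]
      cases h : G[n]? with
      | none => rfl
      | some p => exact hG p (List.mem_of_getElem? h)
    | overlap k j i => rw [Source.poly, ev_reduce hS, ev_overlap hS]

theorem known_eq_some {S j i : ℕ} {f : QPoly} : known S j i = some f ↔
    i < j ∧ j < 12 ∧ S.testBit (12 * j + i) = true ∧ f = ordered j i := by
  unfold known
  split
  · next h =>
    rw [Bool.and_eq_true, Bool.and_eq_true, Nat.blt_eq, Nat.blt_eq] at h
    simp [h, eq_comm]
  · next h =>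
    rw [← Bool.not_eq_true, Bool.and_eq_true, Bool.and_eq_true, Nat.blt_eq, Nat.blt_eq] at h
    simp only [reduceCtorEq, false_iff]
    tauto

theorem ordered_of_stepsDeriveAll {G : List QPoly} (hG : ∀ p ∈ G, ev X p = 0) {S : ℕ}
    {ds : List RelationStep} (hS : ∀ x y f, known S x y = some f → X x * X y = ev X f)
    (h : stepsDeriveAll G S ds = true) {i j : ℕ} (hij : i < j) (hj : j < 12) :
    X j * X i = ev X (ordered j i) := by
  induction ds generalizing S with
  | nil =>
    simp only [stepsDeriveAll, List.all_eq_true, List.mem_range] at h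
    exact hS _ _ _ (known_eq_some.2 ⟨hij, hj, h j hj i hij, rfl⟩)
  | cons d ds ih =>
    obtain ⟨j', i', c, l⟩ := d
    rw [stepsDeriveAll, Bool.and_eq_true] at h
    refine ih (fun x y f hf => ?_) h.2
    obtain ⟨hyx, hx, hbit, rfl⟩ := known_eq_some.1 hf
    rw [Nat.testBit_or, Bool.or_eq_true, Nat.testBit_two_pow, decide_eq_true_eq] at hbit
    rcases hbit with hbit | hbit
    · exact hS _ _ _ (known_eq_some.2 ⟨hyx, hx, hbit, rfl⟩)
    · obtain ⟨h1, h2, -⟩ := isMultiple_iff.1 h.1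
      obtain ⟨rfl, rfl⟩ : j' = x ∧ i' = y := by omega
      exact (ev_eq_zero_iff_of_isMultiple h.1).1 (ev_combination hG hS l)

end Soundness

/-- The polynomial whose vanishing expresses a relation. -/
def difference (r : QPoly × QPoly) : QPoly := r.1 - r.2

/-- The relations of `𝒜_{q,4}` and the definitions of the PBW generators. -/
def defining : List QPoly :=
  (serreRelations letters .one ++ serreRelations letters .three ++
    primaryDefinitions letters .one ++ primaryDefinitions letters .three ++
    secondaryDefinitions letters .one).map difference

/-- The derivation of the PBW relations from the relations of `𝒜_{q,4}` and the definitions of the PBW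
generators, which are numbered as in `defining`. -/
def relationSteps : List RelationStep :=
  [(11, 0, [(-1, 0)], [([(1, 0)], .given 22)]),
   (10, 0, [(-1, 0)], [([(1, 0)], .given 24)]),
   (10, 3, [(1, 2), (-1, 0)], [([(1, 0)], .given 23)]),
   (11, 4, [(1, 2), (-1, 0)], [([(1, 0)], .given 25)]),
   (10, 1, [(-1, 1), (-1, -1)], [([(1, 0)], .given 26)]),
   (4, 1, [(-1, 1)], [([(1, 0)], .given 27)]),
   (11, 10, [(1, 0)], [([(1, 0)], .given 3)]),
   (10, 4, [(-1, 2), (1, 0)], [([(1, 0)], .given 11)]),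
   (10, 2, [(1, 2), (-1, -2)], [([(1, 0)], .given 15)]),
   (4, 0, [(1, 2), (-1, 0)], [([(1, 0)], .given 12)]),
   (2, 0, [(1, 2), (-1, -2)], [([(1, 0)], .given 16)]),
   (11, 2, [(-1, 2), (1, -2)], [([(1, 0)], .overlap 11 10 0)]),
   (3, 0, [(1, 2), (-1, 0)], [([(1, 0)], .given 1)]),
   (1, 0, [(1, 2), (-1, -2)], [([(1, 0)], .given 5)]),
   (11, 3, [(-1, 2), (1, 0)], [([(1, 0)], .given 0)]),
   (11, 1, [(1, 2), (-1, -2)], [([(1, 0)], .given 4)]),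
   (4, 2, [(-1, 3), (1, 1)], [([(1, 0)], .overlap 10 2 0)]),
   (10, 9, [(1, 4), (-2, 2), (1, 0)], [([(1, 0)], .given 13)]),
   (10, 6, [(-1, 4), (1, 2), (1, 0), (-1, -2)], [([(1, 0)], .given 17)]),
   (10, 5, [(1, 2), (-1, -2)], [([(1, 0)], .overlap 11 10 2)]),
   (10, 7, [(1, 2), (-1, -2)], [([(1, 0)], .overlap 11 10 4)]),
   (7, 0, [(1, 5), (-1, 3), (-1, 1), (1, -1)],
    [([(1, 0)], .given 8),
     ([(1, 3), (-1, 1)], .overlap 11 4 0)]),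
   (3, 2, [(1, 7), (-1, 5), (-1, 3), (1, 1)],
    [([(-1, 1)], .given 7),
     ([(1, 0)], .given 8),
     ([(1, 3), (-1, 1)], .overlap 10 3 0)]),
   (9, 0, [(1, 6), (-1, 4), (-1, 2), (1, 0)], [([(-1, 2)], .given 8), ([(-1, 0)], .given 19)]),
   (4, 3, [(-1, 2), (2, 0), (-1, -2)], [([(1, 0)], .given 8)]),
   (6, 0, [(1, 4), (-1, 2), (-1, 0), (1, -2)], [([(1, 0)], .given 7)]),
   (5, 0, [(1, 6), (-1, -2)], [([(1, 0)], .overlap 10 1 0), ([(1, 4)], .overlap 11 2 0)]),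
   (2, 1, [(-1, 4), (1, 0)], [([(1, 0)], .overlap 10 1 0)]),
   (11, 9, [(1, 4), (-2, 2), (1, 0)], [([(1, 0)], .given 2)]),
   (11, 7, [(-1, 4), (1, 2), (1, 0), (-1, -2)], [([(1, 0)], .given 6)]),
   (11, 5, [(-1, 2), (1, -2)], [([(1, 0)], .overlap 11 10 1)]),
   (11, 6, [(-1, 2), (1, -2)], [([(1, 0)], .overlap 11 10 3)]),
   (3, 1, [(-1, 3), (1, 1)], [([(1, 0)], .overlap 11 1 0)]),
   (10, 8, [(1, 5), (-1, 1)],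
    [([(-1, 4), (-1, 2)], .overlap 10 5 0),
     ([(-1, 5)], .overlap 10 7 0),
     ([(-1, 2), (-1, 0)], .overlap 10 2 1),
     ([(-1, 5)], .overlap 10 4 1)]),
   (9, 2, [(1, 9), (-2, 7), (2, 3), (-1, 1)],
    [([(-1, 2)], .given 21),
     ([(-1, 8), (1, 6), (1, 4), (-1, 2)], .overlap 10 7 0),
     ([(1, 8), (-2, 6), (2, 2), (-1, 0)], .overlap 11 4 2)]),
   (6, 2, [(1, 2), (-1, -2)], [([(1, 0)], .overlap 10 3 2)]),
   (6, 4, [(1, 3), (-1, 1)], [([(1, 0)], .overlap 10 6 0)]),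
   (9, 4, [(1, 1), (-1, -3)], [([(1, 0)], .overlap 10 9 0), ([(-1, 0)], .overlap 10 4 3)]),
   (5, 4, [(2, 8), (-2, 6), (-4, 4), (4, 2), (2, 0), (-2, -2)],
    [([(-1, 1)], .given 20),
     ([(-1, 8), (2, 4), (-1, 0)], .overlap 10 4 1)]),
   (7, 4, [(1, 6), (-1, 4), (-2, 2), (2, 0), (1, -2), (-1, -4)], [([(1, 0)], .given 20)]),
   (7, 2, [(-1, 6), (1, 4), (2, 2), (-2, 0), (-1, -2), (1, -4)], [([(1, 0)], .given 21)]),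
   (5, 2, [(1, 0), (-1, -4)], [([(1, 0)], .overlap 10 5 0)]),
   (8, 0, [(1, 0), (-1, -2)], [([(1, 0)], .overlap 4 1 0)]),
   (11, 8, [(1, 3), (-1, -1)],
    [([(-1, 2), (-1, 0)], .overlap 11 5 0),
     ([(-1, 3)], .overlap 11 6 0),
     ([(1, 4), (1, 2)], .overlap 11 2 1),
     ([(-1, 3)], .overlap 11 3 2)]),
   (9, 1, [(1, 9), (-2, 7), (2, 3), (-1, 1)],
    [([(-1, 2)], .given 10),
     ([(-1, 8), (1, 6), (1, 4), (-1, 2)], .overlap 11 6 0),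
     ([(1, 8), (-2, 6), (2, 2), (-1, 0)], .overlap 10 3 1)]),
   (7, 1, [(1, 2), (-1, -2)], [([(1, 0)], .overlap 11 4 1)]),
   (7, 3, [(1, 3), (-1, 1)], [([(1, 0)], .overlap 11 7 0)]),
   (9, 3, [(1, 3), (-1, -1)], [([(1, 2)], .overlap 11 9 0), ([(1, 0)], .overlap 11 4 3)]),
   (5, 3, [(2, 8), (-2, 6), (-4, 4), (4, 2), (2, 0), (-2, -2)],
    [([(-1, 1)], .given 9),
     ([(-1, 8), (2, 4), (-1, 0)], .overlap 11 3 2)]),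
   (6, 3, [(1, 6), (-1, 4), (-2, 2), (2, 0), (1, -2), (-1, -4)], [([(1, 0)], .given 9)]),
   (6, 1, [(-1, 6), (1, 4), (2, 2), (-2, 0), (-1, -2), (1, -4)], [([(1, 0)], .given 10)]),
   (5, 1, [(1, 4), (-1, 0)], [([(1, 0)], .overlap 11 5 0)]),
   (8, 2, [(-1, 3), (1, 1)], [([(1, 0)], .overlap 5 2 0)]),
   (8, 4, [(-1, 2), (2, 0), (-1, -2)], [([(1, 0)], .overlap 9 2 0)]),
   (7, 5, [(-1, 3), (1, 1)], [([(1, 0)], .overlap 10 5 1)]),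
   (6, 5, [(-1, 3), (1, 1)], [([(1, 0)], .overlap 11 5 2)]),
   (7, 6, [(-1, 3), (1, 1)], [([(1, 0)], .overlap 10 6 1)]),
   (9, 5, [(-1, 1), (1, -1)], [([(1, 0)], .overlap 10 5 3)]),
   (9, 7, [(1, 1), (-1, -1)], [([(1, 0)], .overlap 10 9 1)]),
   (9, 6, [(1, 1), (-1, -1)], [([(1, 0)], .overlap 11 9 2)]),
   (8, 1, [(-1, 3), (1, 1)], [([(1, 0)], .overlap 5 1 0)]),
   (8, 3, [(-1, 1), (1, -1)], [([(1, 0)], .overlap 5 3 0)]),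
   (8, 5, [(1, 2), (-1, 0)], [([(1, 0)], .overlap 5 4 1)]),
   (8, 6, [(1, 1), (-1, -1)], [([(1, 0)], .overlap 6 5 0)]),
   (8, 7, [(1, 1), (-1, -1)], [([(1, 0)], .overlap 7 5 0)]),
   (9, 8, [(-1, 1), (1, -1)], [([(1, 0)], .overlap 9 5 0)])]

set_option maxRecDepth 100000 in
theorem stepsDeriveAll_relationSteps : stepsDeriveAll defining 0 relationSteps = true := by
  decide +kernel

/-- Substitution of the ordered expressions reduces all polynomials to zero. -/
def vanish (l : List (QPoly × QPoly)) : Bool :=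
  l.all fun r => (reduce pbwRules 1000 (difference r) []).isEmpty

set_option maxRecDepth 100000 in
theorem vanish_serreRelations (i : Leg) : vanish (serreRelations letters i) = true := by
  cases i <;> decide +kernel

set_option maxRecDepth 100000 in
theorem vanish_primaryDefinitions (i : Leg) : vanish (primaryDefinitions letters i) = true := by
  cases i <;> decide +kernel

set_option maxRecDepth 100000 in
theorem vanish_secondaryDefinitions (i : Leg) : vanish (secondaryDefinitions letters i) = true := by
  cases i <;> decide +kernel

set_option maxRecDepth 100000 in
theorem vanish_relations (i : Leg) : vanish (relations letters i) = true := by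
  cases i <;> decide +kernel

/-- The product `j * i` with `i < j` of the two letters on the left hand side of a PBW relation. -/
def leading (r : QPoly × QPoly) : ℕ × ℕ :=
  match r.1 with
  | [([x, y], _)] => match Nat.blt x y with
    | true => (y, x)
    | false => (x, y)
  | _ => (0, 0)

/-- Every PBW relation is contained in the list. -/
def covers (l : List (QPoly × QPoly)) : Bool :=
  (List.range 12).all fun j => (List.range j).all fun i => l.any fun r =>
    Nat.beq (leading r).1 j && Nat.beq (leading r).2 i &&
      isMultiple (difference r) j i (coeff [j, i] (difference r))

set_option maxRecDepth 100000 in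
theorem covers_relations :
    covers (relations letters .one ++ relations letters .three) = true := by decide +kernel

section Consequences

variable {A : Type*} [Ring A] [Algebra K A]

theorem of_vanish {X : ℕ → A} (hX : ∀ i j, i < j → j < 12 → X j * X i = ev X (ordered j i))
    {l : List (QPoly × QPoly)} (hl : vanish l = true) : ∀ r ∈ l, ev X r.1 = ev X r.2 := by
  intro r hr
  simp only [vanish, List.all_eq_true, List.isEmpty_iff] at hl
  have h := congrArg (ev X) (hl r hr)
  rw [ev_reduce, difference, ev_sub] at h
  · exact sub_eq_zero.1 h
  · intro x y f hf
    obtain ⟨h1, h2, rfl⟩ := pbwRules_eq_some.1 hf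
    exact hX y x h1 h2

theorem pbwRelations_iff_ordered (F : Family A) :
    PBWRelations F ↔ ∀ i j, i < j → j < 12 → F.get j * F.get i = ev F.get (ordered j i) := by
  rw [pbwRelations_iff]
  refine ⟨fun H i j hij hj => ?_, fun H i => of_vanish H (vanish_relations i)⟩
  have h := covers_relations
  simp only [covers, List.all_eq_true, List.any_eq_true, List.mem_range] at h
  obtain ⟨r, hr, h⟩ := h j hj i hij
  rw [Bool.and_eq_true] at h
  refine (ev_eq_zero_iff_of_isMultiple h.2).1 ?_
  rw [difference, ev_sub, sub_eq_zero]
  rw [List.mem_append] at hr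
  exact hr.elim (H _ r) (H _ r)

/-- The PBW relations follow from the relations of `𝒜_{q,4}` and the definitions of the PBW
generators. -/
theorem pbwRelations_of_serreRelations (F : Family A)
    (hs : ∀ i, ∀ r ∈ serreRelations letters i, ev F.get r.1 = ev F.get r.2)
    (hd : ∀ i, ∀ r ∈ primaryDefinitions letters i, ev F.get r.1 = ev F.get r.2)
    (hd' : ∀ r ∈ secondaryDefinitions letters .one, ev F.get r.1 = ev F.get r.2) :
    PBWRelations F := by
  rw [pbwRelations_iff_ordered]
  refine fun i j hij hj => ordered_of_stepsDeriveAll (List.forall_mem_map.2 fun r hr => ?_)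
    (fun x y f hf => ?_) stepsDeriveAll_relationSteps hij hj
  · rw [difference, ev_sub, sub_eq_zero]
    simp only [List.mem_append] at hr
    rcases hr with (((hr | hr) | hr) | hr) | hr
    exacts [hs _ r hr, hs _ r hr, hd _ r hr, hd _ r hr, hd' r hr]
  · simp [known_eq_some] at hf

end Consequences

end Relations

/-! ### Ordered words and ordered monomials -/

/-- The ordered word with given multiplicities of the letters. -/
def wordOf (m : Fin 12 →₀ ℕ) : Word := (List.finRange 12).flatMap fun i => List.replicate (m i) i

/-- The multiplicities of the letters in a word. Only letters below `12` are counted correctly. -/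
def expo (w : Word) : Fin 12 →₀ ℕ := (w.map fun k => Finsupp.single (Fin.ofNat 12 k) 1).sum

theorem expo_apply {w : Word} (hw : ∀ k ∈ w, k < 12) (i : Fin 12) : expo w i = w.count (i : ℕ) := by
  induction w with
  | nil => simp [expo]
  | cons k w ih =>
    simp only [List.forall_mem_cons] at hw
    have hk : Fin.ofNat 12 k = i ↔ k = (i : ℕ) := by
      rw [Fin.ext_iff, Fin.val_ofNat, Nat.mod_eq_of_lt hw.1]
    have : expo (k :: w) = Finsupp.single (Fin.ofNat 12 k) 1 + expo w := by simp [expo]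
    rw [this, Finsupp.add_apply, ih hw.2, List.count_cons, Finsupp.single_apply, add_comm]
    simp only [hk, beq_iff_eq]

theorem count_wordOf (m : Fin 12 →₀ ℕ) (i : Fin 12) : (wordOf m).count (i : ℕ) = m i := by
  rw [wordOf, List.count_flatMap, ← Fin.sum_univ_def]
  simp [List.count_replicate, ← Fin.ext_iff]

theorem lt_of_mem_wordOf {m : Fin 12 →₀ ℕ} {k : ℕ} (hk : k ∈ wordOf m) : k < 12 := by
  simp only [wordOf, List.mem_flatMap, List.mem_replicate] at hk
  obtain ⟨i, -, -, rfl⟩ := hk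
  exact i.2

theorem expo_wordOf (m : Fin 12 →₀ ℕ) : expo (wordOf m) = m := by
  ext i
  rw [expo_apply fun k => lt_of_mem_wordOf, count_wordOf]

theorem pairwise_wordOf (m : Fin 12 →₀ ℕ) : (wordOf m).Pairwise (· ≤ ·) := by
  rw [wordOf, List.pairwise_flatMap]
  refine ⟨fun i _ => List.pairwise_replicate.2 (Or.inr le_rfl), ?_⟩
  refine (List.pairwise_lt_finRange 12).imp fun {i j} hij x hx y hy => ?_
  rw [List.eq_of_mem_replicate hx, List.eq_of_mem_replicate hy]
  exact hij.le

theorem wordOf_expo {w : Word} (hw : ∀ k ∈ w, k < 12) (hs : w.Pairwise (· ≤ ·)) :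
    wordOf (expo w) = w := by
  refine List.Perm.eq_of_pairwise' (pairwise_wordOf _) hs (List.perm_iff_count.2 fun k => ?_)
  by_cases hk : k < 12
  · exact (count_wordOf (expo w) ⟨k, hk⟩).trans (expo_apply hw ⟨k, hk⟩)
  · rw [List.count_eq_zero_of_not_mem fun h => hk (lt_of_mem_wordOf h),
      List.count_eq_zero_of_not_mem fun h => hk (hw k h)]

theorem redex_eq_none_of_pairwise {w : Word} (hw : w.Pairwise (· ≤ ·)) :
    redex pbwRules w = none := by
  by_contra h
  obtain ⟨⟨a, f, b⟩, h⟩ := Option.ne_none_iff_exists'.1 h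
  obtain ⟨x, y, hxy, rfl⟩ := redex_eq_some h
  have := (List.pairwise_append.1 hw).2.1
  exact absurd (List.rel_of_pairwise_cons this List.mem_cons_self)
    (not_le_of_gt (pbwRules_eq_some.1 hxy).1)

theorem pairwise_of_redex_eq_none {w : Word} (hw : ∀ k ∈ w, k < 12)
    (h : redex pbwRules w = none) : w.Pairwise (· ≤ ·) := by
  rw [← List.isChain_iff_pairwise]
  induction w with
  | nil => exact List.IsChain.nil
  | cons x w ih =>
    cases w with
    | nil => exact List.isChain_singleton x
    | cons y w =>
      rw [redex] at h
      split at h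
      · simp at h
      · next hxy =>
        split at h
        · simp at h
        · next h' =>
          refine List.isChain_cons_cons.2
            ⟨not_lt.1 fun hlt => ?_, ih (fun k hk => hw k (List.mem_cons_of_mem _ hk)) h'⟩
          rw [pbwRules_eq_some.2 ⟨hlt, hw x List.mem_cons_self, rfl⟩] at hxy
          simp at hxy

section Monomials

variable {A : Type*} [Ring A] (X : Fin 12 → A) (X' : ℕ → A)

theorem prod_map_wordOf (hX : ∀ i : Fin 12, X' i = X i) (m : Fin 12 →₀ ℕ) :
    ((wordOf m).map X').prod = orderedMonomial X m := by
  rw [orderedMonomial, wordOf, List.map_flatMap, List.ofFn_eq_map, List.flatMap, List.prod_flatten,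
    List.map_map]
  congr 1
  exact List.map_congr_left fun i _ => by simp [hX]

theorem prod_map_eq_orderedMonomial (hX : ∀ i : Fin 12, X' i = X i) {w : Word}
    (hw : ∀ k ∈ w, k < 12) (hs : w.Pairwise (· ≤ ·)) :
    (w.map X').prod = orderedMonomial X (expo w) := by
  rw [← prod_map_wordOf X X' hX, wordOf_expo hw hs]

end Monomials

/-- The PBW relations express products of letters by ordered words. -/
theorem ordered_sorted : ∀ j < 12, ∀ i < j, ∀ v ∈ ordered j i,
    (∀ k ∈ v.1, k < 12) ∧ v.1.Pairwise (· ≤ ·) := by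
  decide +kernel

/-! ### The PBW basis -/

section Basis

variable {A : Type*} [Ring A] [Algebra K A] {X : Fin 12 → A} {X' : ℕ → A}

theorem prod_map_mem_span (hX : ∀ i : Fin 12, X' i = X i)
    (hrel : ∀ i j, i < j → j < 12 → X' j * X' i = ev X' (ordered j i)) (w : Word)
    (hw : ∀ k ∈ w, k < 12) :
    (w.map X').prod ∈ Submodule.span K (Set.range (orderedMonomial X)) := by
  induction hr : rank w using WellFoundedLT.induction generalizing w with
  | ind r ih =>
  subst hr
  cases h : redex pbwRules w with
  | none =>
    rw [prod_map_eq_orderedMonomial X X' hX hw (pairwise_of_redex_eq_none hw h)]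
    exact Submodule.subset_span ⟨_, rfl⟩
  | some o =>
    obtain ⟨a, f, b⟩ := o
    obtain ⟨x, y, hf, rfl⟩ := redex_eq_some h
    obtain ⟨hyx, hx, rfl⟩ := pbwRules_eq_some.1 hf
    have hev := ev_inContext (X := X') a b (ordered x y)
    rw [← hrel y x hyx hx] at hev
    have : ((a ++ x :: y :: b).map X').prod = ev X' (inContext a (ordered x y) b) := by
      rw [hev]
      simp [mul_assoc]
    rw [this, ev, lin]
    refine list_sum_mem (List.forall_mem_map.2 fun v hv => Submodule.smul_mem _ _ ?_)
    obtain ⟨u, hu, rfl⟩ := List.mem_map.1 hv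
    refine ih _ (rank_lt hf a b hu) _ (fun k hk => ?_) rfl
    simp only [List.mem_append, List.mem_cons, or_imp, forall_and] at hk hw
    rcases hk with (hk | hk) | hk
    · exact hw.1 k hk
    · exact (ordered_sorted x hx y hyx u hu).1 k hk
    · exact hw.2.2.2 k hk

theorem isPBW (hX : ∀ i : Fin 12, X' i = X i)
    (hrel : ∀ i j, i < j → j < 12 → X' j * X' i = ev X' (ordered j i))
    (hgen : Algebra.adjoin K (Set.range X) = ⊤) (ρ : A →ₐ[K] Module.End K (Word →₀ K))
    (hρ : ∀ i : Fin 12, ρ (X i) = letterOperator i) : IsPBW X where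
  generates := hgen
  linearIndependent := by
    -- the ordered monomials send the empty word to the corresponding ordered words
    let T : A →ₗ[K] Word →₀ K := (LinearMap.applyₗ (Finsupp.single [] 1)).comp ρ.toLinearMap
    have hT (m) : T (orderedMonomial X m) = Finsupp.single (wordOf m) 1 := by
      have h1 : ρ (orderedMonomial X m) = ((wordOf m).map letterOperator).prod := by
        rw [prod_map_wordOf (fun i : Fin 12 => letterOperator i) _ (fun _ => rfl), orderedMonomial,
          orderedMonomial, map_list_prod, List.map_ofFn]
        simp [Function.comp_def, hρ]
      change ρ (orderedMonomial X m) (Finsupp.single [] 1) = _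
      rw [h1]
      by_cases hm : wordOf m = []
      · simp [hm]
      · rw [letterOperator_word hm, List.append_nil,
          normalForm_of_redex_eq_none (redex_eq_none_of_pairwise (pairwise_wordOf m))]
    refine LinearIndependent.of_comp T ?_
    have : ⇑T ∘ orderedMonomial X = (fun w => Finsupp.single w 1) ∘ wordOf := funext hT
    rw [this]
    exact (Finsupp.linearIndependent_single_one K Word).comp _
      (Function.LeftInverse.injective expo_wordOf)
  spans := by
    rw [← Algebra.top_toSubmodule, ← hgen, Algebra.adjoin_eq_span, Submodule.span_le]
    intro x hx
    obtain ⟨w, hw, rfl⟩ : ∃ w : Word, (∀ k ∈ w, k < 12) ∧ (w.map X').prod = x := by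
      induction hx using Submonoid.closure_induction with
      | mem x hx =>
        obtain ⟨i, rfl⟩ := hx
        exact ⟨[(i : ℕ)], by simp, by simp [hX]⟩
      | one => exact ⟨[], by simp, rfl⟩
      | mul x y _ _ hx hy =>
        obtain ⟨u, hu, rfl⟩ := hx
        obtain ⟨v, hv, rfl⟩ := hy
        exact ⟨u ++ v, by simpa [or_imp, forall_and] using ⟨hu, hv⟩, by simp⟩
    exact prod_map_mem_span hX hrel w hw

theorem IsPBW.coeff_eq_lin (hpbw : IsPBW X) (hX : ∀ i : Fin 12, X' i = X i)
    (hrel : ∀ i j, i < j → j < 12 → X' j * X' i = ev X' (ordered j i)) {i j : Fin 12}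
    (hij : i < j) :
    hpbw.coeff i j = lin q (fun w => Finsupp.single (expo w) 1) (ordered j i) := by
  rw [IsPBW.coeff, ← hX, ← hX, hrel i j hij j.2, ev]
  refine (map_lin hpbw.basis.repr.toLinearMap _).trans (lin_congr fun v hv => ?_)
  obtain ⟨h1, h2⟩ := ordered_sorted j j.2 i hij v hv
  have : hpbw.basis (expo v.1) = orderedMonomial X (expo v.1) := by
    rw [IsPBW.basis, Module.Basis.mk_apply]
  rw [prod_map_eq_orderedMonomial X X' hX h1 h2, ← this]
  exact hpbw.basis.repr_self _

end Basis

/-! ### Values and derivatives at `q = 1` -/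

/-- The rational function `f` is defined at `q = 1`, with value `a` and derivative `b`. -/
def HasJetAtOne (f : K) (a b : ℂ) : Prop :=
  RegularAtOne f ∧ valueAtOne f = a ∧ derivAtOne f = b

open Polynomial in
/-- Value and derivative may be computed from a fraction that is not reduced. -/
theorem hasJetAtOne_of_eq_div {f : K} {P Q : ℂ[X]} (hQ : Q.eval 1 ≠ 0)
    (hf : f = algebraMap ℂ[X] K P / algebraMap ℂ[X] K Q) :
    HasJetAtOne f (P.eval 1 / Q.eval 1)
      ((P.derivative.eval 1 * Q.eval 1 - P.eval 1 * Q.derivative.eval 1) / Q.eval 1 ^ 2) := by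
  have hQ0 : Q ≠ 0 := by
    rintro rfl
    simp at hQ
  have hden : f.denom.eval 1 ≠ 0 := by
    intro h0
    have := eval_dvd (x := (1 : ℂ)) (hf ▸ RatFunc.denom_div_dvd P Q)
    rw [h0, zero_dvd_iff] at this
    exact hQ this
  have h : f.num * Q = P * f.denom := (RatFunc.num_mul_eq_mul_denom_iff hQ0).2 hf
  have h0 := congrArg (eval 1) h
  have h1 := congrArg (fun p => eval 1 (derivative p)) h
  simp only [eval_mul, derivative_mul, eval_add] at h0 h1
  refine ⟨hden, ?_, ?_⟩
  · rw [valueAtOne, div_eq_div_iff hden hQ, h0]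
  · rw [derivAtOne, div_eq_div_iff (pow_ne_zero 2 hden) (pow_ne_zero 2 hQ)]
    linear_combination (Q.eval 1 * f.denom.eval 1) * h1 -
      (Q.eval 1 * f.denom.derivative.eval 1 + Q.derivative.eval 1 * f.denom.eval 1) * h0

namespace HasJetAtOne

variable {f g : K} {a b c d : ℂ}

theorem add (hf : HasJetAtOne f a b) (hg : HasJetAtOne g c d) :
    HasJetAtOne (f + g) (a + c) (b + d) := by
  obtain ⟨h1, rfl, rfl⟩ := hf
  obtain ⟨h2, rfl, rfl⟩ := hg
  have hf0 : algebraMap (Polynomial ℂ) K f.denom ≠ 0 :=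
    RatFunc.algebraMap_ne_zero f.denom_ne_zero
  have hg0 : algebraMap (Polynomial ℂ) K g.denom ≠ 0 :=
    RatFunc.algebraMap_ne_zero g.denom_ne_zero
  rw [RegularAtOne] at h1 h2
  have key := hasJetAtOne_of_eq_div (f := f + g) (P := f.num * g.denom + f.denom * g.num)
    (Q := f.denom * g.denom) (by simpa using ⟨h1, h2⟩) (by
      rw [map_mul, map_add, map_mul, map_mul, ← div_add_div _ _ hf0 hg0, RatFunc.num_div_denom,
        RatFunc.num_div_denom])
  convert key using 1
  · simp only [valueAtOne, Polynomial.eval_add, Polynomial.eval_mul]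
    field_simp
  · simp only [derivAtOne, Polynomial.eval_add, Polynomial.eval_mul, Polynomial.derivative_add,
      Polynomial.derivative_mul]
    field_simp
    ring

theorem zero : HasJetAtOne 0 0 0 := by
  simpa using hasJetAtOne_of_eq_div (f := 0) (P := 0) (Q := 1) (by simp) (by simp)

theorem monomial (c e : ℤ) : HasJetAtOne ((c : K) * q ^ e) c ((c * e : ℤ) : ℂ) := by
  have hX : q = algebraMap (Polynomial ℂ) K Polynomial.X := RatFunc.algebraMap_X.symm
  have hc : (c : K) = algebraMap (Polynomial ℂ) K (Polynomial.C (c : ℂ)) := by simp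
  obtain ⟨n, rfl | rfl⟩ := e.eq_nat_or_neg
  · have := hasJetAtOne_of_eq_div (f := (c : K) * q ^ (n : ℤ))
      (P := Polynomial.C (c : ℂ) * Polynomial.X ^ n) (Q := 1) (by simp)
      (by rw [hc, hX, map_mul, map_pow, map_one, div_one, zpow_natCast])
    simpa [Polynomial.derivative_X_pow] using this
  · have := hasJetAtOne_of_eq_div (f := (c : K) * q ^ (-n : ℤ))
      (P := Polynomial.C (c : ℂ)) (Q := Polynomial.X ^ n) (by simp)
      (by rw [hc, hX, map_pow, div_eq_mul_inv, zpow_neg, zpow_natCast])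
    simpa [Polynomial.derivative_X_pow] using this

end HasJetAtOne

namespace Scalar

/-- The value of a Laurent polynomial at `q = 1`. -/
def atOne (s : Scalar) : ℤ := (s.map fun x => x.1).sum

/-- The derivative of a Laurent polynomial at `q = 1`. -/
def slope (s : Scalar) : ℤ := (s.map fun x => x.1 * x.2).sum

theorem val_one {S : Type*} [Field S] (s : Scalar) : val (1 : S) s = s.atOne := by
  induction s with
  | nil => simp [atOne]
  | cons x s ih => simp [ih, atOne]

theorem hasJetAtOne (s : Scalar) : HasJetAtOne (val q s) s.atOne s.slope := by
  induction s with
  | nil => simpa [atOne, slope] using HasJetAtOne.zero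
  | cons x s ih => simpa [atOne, slope] using (HasJetAtOne.monomial x.1 x.2).add ih

end Scalar

namespace QPoly

/-- The derivative of the coefficients at `q = 1`. -/
def slope (p : QPoly) : QPoly := p.map fun x => (x.1, [(x.2.slope, 0)])

theorem hasJetAtOne_lin (L : Word → Prop) [DecidablePred L] (p : QPoly) :
    HasJetAtOne (lin q (fun w => if L w then (1 : K) else 0) p)
      (lin (1 : ℂ) (fun w => if L w then (1 : ℂ) else 0) p)
      (lin (1 : ℂ) (fun w => if L w then (1 : ℂ) else 0) (slope p)) := by
  induction p with
  | nil => simpa [slope] using HasJetAtOne.zero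
  | cons x p ih =>
    have : slope (x :: p) = (x.1, [(x.2.slope, 0)]) :: slope p := rfl
    rw [this, lin_cons, lin_cons, lin_cons]
    refine HasJetAtOne.add ?_ ih
    rw [Scalar.val_one]
    split
    · simpa using x.2.hasJetAtOne
    · simpa using HasJetAtOne.zero

theorem lin_eq_zero {S M : Type*} [Field S] [AddCommGroup M] [Module S M] {L : Word → M}
    {p : QPoly} (hp : p.all fun x => x.2.atOne == 0) : lin (1 : S) L p = 0 := by
  induction p with
  | nil => rfl
  | cons x p ih =>
    rw [List.all_cons, Bool.and_eq_true, beq_iff_eq] at hp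
    rw [lin_cons, ih hp.2, Scalar.val_one, hp.1]
    simp

end QPoly

/-! ### The specialization -/

/-- At `q = 1`, the expansion of `j * i` becomes `i * j`. -/
def isOptimal (j i : ℕ) : Bool := match ordered j i with
  | x :: p => beqWord x.1 [i, j] && x.2.atOne == 1 && p.all fun y => y.2.atOne == 0
  | [] => false

theorem isOptimal_eq_true : ∀ j < 12, ∀ i < j, isOptimal j i = true := by decide +kernel

theorem lin_one_ordered {S M : Type*} [Field S] [AddCommGroup M] [Module S M] (L : Word → M)
    {i j : ℕ} (hij : i < j) (hj : j < 12) : lin (1 : S) L (ordered j i) = L [i, j] := by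
  have h := isOptimal_eq_true j hj i hij
  unfold isOptimal at h
  split at h
  · next x p hp =>
    rw [Bool.and_eq_true, Bool.and_eq_true, beq_iff_eq] at h
    rw [hp, lin_cons, lin_eq_zero h.2, Scalar.val_one, h.1.2, eq_of_beqWord h.1.1]
    simp
  · simp at h

theorem expo_pair (i j : Fin 12) :
    expo [(i : ℕ), (j : ℕ)] = Finsupp.single i 1 + Finsupp.single j 1 := by
  simp [expo]

section

variable {A : Type*} [Ring A] [Algebra K A] {X : Fin 12 → A} {X' : ℕ → A}

theorem IsPBW.hasJetAtOne_coeff (hpbw : IsPBW X) (hX : ∀ i : Fin 12, X' i = X i)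
    (hrel : ∀ i j, i < j → j < 12 → X' j * X' i = ev X' (ordered j i)) {i j : Fin 12}
    (hij : i < j) (m : Fin 12 →₀ ℕ) :
    HasJetAtOne (hpbw.coeff i j m)
      (lin (1 : ℂ) (fun w => if expo w = m then (1 : ℂ) else 0) (ordered j i))
      (lin (1 : ℂ) (fun w => if expo w = m then (1 : ℂ) else 0) (slope (ordered j i))) := by
  have h := map_lin (t := q) (L := fun w => Finsupp.single (expo w) (1 : K))
    (Finsupp.lapply m) (ordered j i)
  simp only [Finsupp.lapply_apply, Finsupp.single_apply] at h
  rw [hpbw.coeff_eq_lin hX hrel hij, h]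
  exact hasJetAtOne_lin _ _

theorem IsPBW.optimalSpecializable (hpbw : IsPBW X) (hX : ∀ i : Fin 12, X' i = X i)
    (hrel : ∀ i j, i < j → j < 12 → X' j * X' i = ev X' (ordered j i)) :
    hpbw.OptimalSpecializable where
  specializable i j hij m := (hpbw.hasJetAtOne_coeff hX hrel hij m).1
  optimal i j hij m := by
    rw [(hpbw.hasJetAtOne_coeff hX hrel hij m).2.1, lin_one_ordered _ hij j.2, expo_pair]
    simp only [eq_comm]

theorem orderedMonomial_pair {B : Type*} [Ring B] (X : Fin 12 → B) {i j : Fin 12} (hij : i < j) :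
    orderedMonomial X (Finsupp.single i 1 + Finsupp.single j 1) = X i * X j := by
  have h := prod_map_eq_orderedMonomial X (fun k => X (Fin.ofNat 12 k)) (fun i => by simp)
    (w := [(i : ℕ), (j : ℕ)]) (by simp) (by simpa using hij.le)
  rw [← expo_pair, ← h]
  simp

theorem valueAtOne_zero : valueAtOne 0 = 0 := HasJetAtOne.zero.2.1

theorem derivAtOne_zero : derivAtOne 0 = 0 := HasJetAtOne.zero.2.2

theorem IsPBW.OptimalSpecializable.sum_coeff {hpbw : IsPBW X} (h : hpbw.OptimalSpecializable)
    {B : Type*} [Ring B] [Algebra K B] (G : Fin 12 → B) {i j : Fin 12} (hij : i < j) :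
    ((hpbw.coeff i j).sum fun m c => algebraMap ℂ K (valueAtOne c) • orderedMonomial G m) =
      G i * G j := by
  rw [Finsupp.sum, Finset.sum_eq_single (Finsupp.single i 1 + Finsupp.single j 1),
    h.optimal i j hij, if_pos rfl, map_one, one_smul, orderedMonomial_pair G hij]
  · intro m _ hm
    rw [h.optimal i j hij, if_neg hm, map_zero, zero_smul]
  · intro hm
    rw [Finsupp.notMem_support_iff.1 hm, valueAtOne_zero, map_zero, zero_smul]

/-- The specialization of an optimal specializable algebra is a polynomial algebra. -/
theorem IsPBW.OptimalSpecializable.exists_algEquiv {hpbw : IsPBW X}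
    (h : hpbw.OptimalSpecializable) :
    ∃ e : hpbw.Specialization ≃ₐ[K] MvPolynomial (Fin 12) K,
      ∀ k, e (hpbw.specGen k) = MvPolynomial.X k := by
  have hswap {i j : Fin 12} (hij : i < j) :
      hpbw.specGen j * hpbw.specGen i = hpbw.specGen i * hpbw.specGen j := by
    have := RingQuot.mkAlgHom_rel K (IsPBW.SpecRel.mk (hX := hpbw) i j hij)
    rw [h.sum_coeff _ hij, map_mul, map_mul] at this
    exact this
  have hgen (i j : Fin 12) : Commute (hpbw.specGen i) (hpbw.specGen j) := by
    rcases lt_trichotomy i j with hij | rfl | hij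
    · exact (hswap hij).symm
    · exact Commute.refl _
    · exact hswap hij
  have hadj : Algebra.adjoin K (Set.range hpbw.specGen) = ⊤ := by
    have := congrArg (Subalgebra.map (RingQuot.mkAlgHom K hpbw.SpecRel))
      (FreeAlgebra.adjoin_range_ι K (Fin 12))
    rw [AlgHom.map_adjoin, ← Set.range_comp, Algebra.map_top,
      (AlgHom.range_eq_top _).2 (RingQuot.mkAlgHom_surjective K _)] at this
    exact this
  have hcomm (x y : hpbw.Specialization) : x * y = y * x := by
    have hx : x ∈ Algebra.adjoin K (Set.range hpbw.specGen) := hadj ▸ Algebra.mem_top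
    have hy : y ∈ Algebra.adjoin K (Set.range hpbw.specGen) := hadj ▸ Algebra.mem_top
    refine Algebra.commute_of_mem_adjoin_of_forall_mem_commute hy fun a ha => ?_
    refine (Algebra.commute_of_mem_adjoin_of_forall_mem_commute hx fun b hb => ?_).symm
    obtain ⟨i, rfl⟩ := ha
    obtain ⟨j, rfl⟩ := hb
    exact hgen i j
  let : CommRing hpbw.Specialization := { (inferInstance : Ring hpbw.Specialization) with
    mul_comm := hcomm }
  let f : hpbw.Specialization →ₐ[K] MvPolynomial (Fin 12) K :=
    RingQuot.liftAlgHom K ⟨FreeAlgebra.lift K MvPolynomial.X, by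
      rintro _ _ ⟨i, j, hij⟩
      rw [h.sum_coeff _ hij, map_mul, map_mul, mul_comm]⟩
  have hf (k) : f (hpbw.specGen k) = MvPolynomial.X k := by
    simp [f, IsPBW.specGen]
  let g : MvPolynomial (Fin 12) K →ₐ[K] hpbw.Specialization := MvPolynomial.aeval hpbw.specGen
  refine ⟨AlgEquiv.ofAlgHom f g ?_ ?_, hf⟩
  · refine MvPolynomial.algHom_ext fun k => ?_
    simp [g, hf]
  · refine AlgHom.ext_of_adjoin_eq_top hadj ?_
    rintro _ ⟨k, rfl⟩
    simp [g, hf]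

end

/-! ### Biderivations of polynomial algebras -/

namespace IsSkewBiderivation

variable {P : Type*} [CommRing P] [Algebra K P] {b : P →ₗ[K] P →ₗ[K] P}

/-- The derivation `{x, ·}`. -/
def derivation (hb : IsSkewBiderivation b) (x : P) : Derivation K P P :=
  Derivation.mk' (b x) fun y z => by
    rw [hb.leibniz_right, smul_eq_mul, smul_eq_mul, mul_comm z]
    exact add_comm _ _

theorem self (hb : IsSkewBiderivation b) (x : P) : b x x = 0 := by
  have h2 : (2 : K) • b x x = 0 := by
    rw [two_smul K]
    nth_rewrite 1 [hb.skew x x]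
    exact neg_add_cancel _
  have h := smul_eq_zero.1 h2
  exact h.resolve_left two_ne_zero

theorem apply_one (hb : IsSkewBiderivation b) (x : P) : b x 1 = 0 :=
  (hb.derivation x).map_one_eq_zero

end IsSkewBiderivation

section Polynomials

open MvPolynomial

variable {σ : Type*} {b b' : MvPolynomial σ K →ₗ[K] MvPolynomial σ K →ₗ[K] MvPolynomial σ K}

/-- Derivations in both arguments are determined by their values on the variables. -/
theorem biderivation_ext
    (h1 : ∀ x y z, b (x * y) z = x * b y z + y * b x z)
    (h2 : ∀ x y z, b x (y * z) = b x y * z + y * b x z)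
    (h1' : ∀ x y z, b' (x * y) z = x * b' y z + y * b' x z)
    (h2' : ∀ x y z, b' x (y * z) = b' x y * z + y * b' x z)
    (h : ∀ i j, b (X i) (X j) = b' (X i) (X j)) : b = b' := by
  let right (b : MvPolynomial σ K →ₗ[K] MvPolynomial σ K →ₗ[K] MvPolynomial σ K)
      (h : ∀ x y z, b x (y * z) = b x y * z + y * b x z) (x) :
      Derivation K (MvPolynomial σ K) (MvPolynomial σ K) :=
    Derivation.mk' (b x) fun y z => by
      rw [h, smul_eq_mul, smul_eq_mul, mul_comm z]
      exact add_comm _ _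
  let left (b : MvPolynomial σ K →ₗ[K] MvPolynomial σ K →ₗ[K] MvPolynomial σ K)
      (h : ∀ x y z, b (x * y) z = x * b y z + y * b x z) (z) :
      Derivation K (MvPolynomial σ K) (MvPolynomial σ K) :=
    Derivation.mk' (b.flip z) fun x y => h x y z
  have hX (i) (z) : b (X i) z = b' (X i) z :=
    DFunLike.congr_fun (MvPolynomial.derivation_ext (D₁ := right b h2 (X i))
      (D₂ := right b' h2' (X i)) (h i)) z
  refine LinearMap.ext fun x => LinearMap.ext fun z => ?_
  exact DFunLike.congr_fun (MvPolynomial.derivation_ext (D₁ := left b h1 z) (D₂ := left b' h1' z)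
    fun i => hX i z) x

theorem IsSkewBiderivation.ext (hb : IsSkewBiderivation b) (hb' : IsSkewBiderivation b')
    (h : ∀ i j, b (X i) (X j) = b' (X i) (X j)) : b = b' :=
  biderivation_ext hb.leibniz_left hb.leibniz_right hb'.leibniz_left hb'.leibniz_right h

/-- The Jacobi identity holds if it holds for triples of distinct variables, in one order each. -/
theorem IsSkewBiderivation.isPoissonBracket [LinearOrder σ] (hb : IsSkewBiderivation b)
    (hlt : ∀ i j k, i < j → j < k →
      b (X i) (b (X j) (X k)) + b (X j) (b (X k) (X i)) + b (X k) (b (X i) (X j)) = 0) :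
    IsPoissonBracket b where
  toIsSkewBiderivation := hb
  jacobi := by
    -- for fixed `x` and `y`, the Jacobi identity says that the following derivation vanishes
    have key {x y} (hxy : ∀ k, b x (b y (X k)) + b y (b (X k) x) + b (X k) (b x y) = 0) (z) :
        b x (b y z) + b y (b z x) + b z (b x y) = 0 := by
      let D := ⁅hb.derivation x, hb.derivation y⁆ - hb.derivation (b x y)
      have hD (z) : D z = b x (b y z) + b y (b z x) + b z (b x y) := by
        have e1 : D z = b x (b y z) - b y (b x z) - b (b x y) z := rfl
        rw [e1, hb.skew z x, hb.skew z (b x y), map_neg, sub_eq_add_neg, sub_eq_add_neg]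
      have : D = 0 := MvPolynomial.derivation_ext fun k => by
        rw [hD, hxy, Derivation.zero_apply]
      rw [← hD, this, Derivation.zero_apply]
    have cyclic {x y z} (h : b x (b y z) + b y (b z x) + b z (b x y) = 0) :
        b z (b x y) + b x (b y z) + b y (b z x) = 0 := by
      rw [← h]
      abel
    have swap {x y z} (h : b x (b y z) + b y (b z x) + b z (b x y) = 0) :
        b y (b x z) + b x (b z y) + b z (b y x) = 0 := by
      rw [hb.skew x z, hb.skew z y, hb.skew y x, map_neg, map_neg, map_neg, ← neg_add, ← neg_add,
        add_comm (b y _), h, neg_zero]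
    have self (x z) : b x (b x z) + b x (b z x) + b z (b x x) = 0 := by
      rw [hb.skew z x, hb.self x, map_neg, map_zero, add_zero, add_neg_cancel]
    have h (i j k) :
        b (X i) (b (X j) (X k)) + b (X j) (b (X k) (X i)) + b (X k) (b (X i) (X j)) = 0 := by
      rcases lt_trichotomy i j with hij | rfl | hij
      · rcases lt_trichotomy j k with hjk | rfl | hjk
        · exact hlt i j k hij hjk
        · exact cyclic (self (X j) (X i))
        · rcases lt_trichotomy i k with hik | rfl | hik
          · exact cyclic (cyclic (swap (hlt i k j hik hjk)))
          · exact cyclic (cyclic (self (X i) (X j)))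
          · exact cyclic (cyclic (hlt k i j hik hij))
      · exact self _ _
      · rcases lt_trichotomy i k with hik | rfl | hik
        · exact swap (hlt j i k hij hik)
        · exact cyclic (cyclic (self (X i) (X j)))
        · rcases lt_trichotomy j k with hjk | rfl | hjk
          · exact cyclic (hlt j k i hjk hik)
          · exact cyclic (self (X j) (X i))
          · exact cyclic (swap (hlt k j i hjk hij))
    have h1 (i j z) : b (X i) (b (X j) z) + b (X j) (b z (X i)) + b z (b (X i) (X j)) = 0 :=
      key (h i j) z
    have h2 (i y z) : b y (b (X i) z) + b (X i) (b z y) + b z (b y (X i)) = 0 :=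
      key (fun j => cyclic (h1 i j y)) z
    exact fun x y z => key (fun i => cyclic (h2 i y x)) z

end Polynomials

/-! ### The classical limit -/

/-- The bracket of two letters. -/
def bracket (i j : ℕ) : QPoly :=
  match Nat.blt j i with
  | true => slope (ordered i j)
  | false => match Nat.blt i j with
    | true => ([(-1, 0)] : Scalar) • slope (ordered j i)
    | false => []

/-- The bracket of a letter and a word, by the Leibniz rule. -/
def bracketWord (i : ℕ) : Word → QPoly
  | [] => []
  | k :: w => inContext [] (bracket i k) w ++ inContext [k] (bracketWord i w) []

/-- The bracket of a letter and a polynomial. -/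
def bracketPoly (i : ℕ) (p : QPoly) : QPoly := p.flatMap fun x => x.2 • bracketWord i x.1

/-- The cyclic sum `{i, {j, k}} + {j, {k, i}} + {k, {i, j}}`, expanded by the Leibniz rule. -/
def jacobiator (i j k : ℕ) : QPoly :=
  bracketPoly i (bracket j k) ++ bracketPoly j (bracket k i) ++ bracketPoly k (bracket i j)

/-- Inserts a letter into an ordered word. -/
def insertLetter (k : ℕ) : Word → Word
  | [] => [k]
  | l :: w => match Nat.ble k l with
    | true => k :: l :: w
    | false => l :: insertLetter k w

/-- The letters of a word in increasing order. -/
def sortWord (w : Word) : Word := w.foldr insertLetter []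

/-- The polynomial vanishes at `q = 1` if the letters commute. -/
def vanishesAtOne (p : QPoly) : Bool :=
  (((p.map fun x => (sortWord x.1, x.2)) : QPoly) + ([] : QPoly)).all fun x => x.2.atOne == 0

set_option maxRecDepth 100000 in
theorem vanishesAtOne_jacobiator :
    ∀ k < 12, ∀ j < k, ∀ i < j, vanishesAtOne (jacobiator i j k) = true := by
  decide +kernel

section

variable {P : Type*} [CommRing P] [Algebra K P] (X : ℕ → P)

/-- The value of a polynomial at `q = 1` in a commutative algebra. -/
def evOne (p : QPoly) : P := lin (1 : K) (fun w => (w.map X).prod) p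

omit [Algebra K P] in
theorem prod_insertLetter (k : ℕ) (w : Word) :
    ((insertLetter k w).map X).prod = X k * (w.map X).prod := by
  induction w with
  | nil => simp [insertLetter]
  | cons l w ih =>
    unfold insertLetter
    split
    · simp
    · simp [ih, mul_left_comm]

omit [Algebra K P] in
theorem prod_sortWord (w : Word) : ((sortWord w).map X).prod = (w.map X).prod := by
  induction w with
  | nil => rfl
  | cons k w ih =>
    have : sortWord (k :: w) = insertLetter k (sortWord w) := rfl
    rw [this, prod_insertLetter, ih, List.map_cons, List.prod_cons]

theorem evOne_eq_zero {p : QPoly} (hp : vanishesAtOne p = true) : evOne X p = 0 := by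
  have h := lin_eq_zero (S := K) (L := fun w => (w.map X).prod) hp
  rw [lin_add, lin_nil, add_zero] at h
  rw [← h, evOne, lin, lin, List.map_map]
  simp [Function.comp_def, prod_sortWord]

theorem evOne_append (p r : QPoly) : evOne X (p ++ r) = evOne X p + evOne X r := lin_append p r

theorem evOne_smul (s : Scalar) (p : QPoly) : evOne X (s • p) = (s.atOne : K) • evOne X p := by
  rw [evOne, lin_smul one_ne_zero, Scalar.val_one, evOne]

theorem evOne_inContext (a b : Word) (p : QPoly) :
    evOne X (inContext a p b) = (a.map X).prod * evOne X p * (b.map X).prod := by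
  have := map_lin (t := (1 : K)) (L := fun w : Word => (w.map X).prod)
    ((LinearMap.mulRight K (b.map X).prod).comp (LinearMap.mulLeft K (a.map X).prod)) p
  simp only [LinearMap.comp_apply, LinearMap.mulLeft_apply, LinearMap.mulRight_apply] at this
  rw [evOne, lin_inContext, evOne, this]
  simp [mul_assoc]

variable {X} {b : P →ₗ[K] P →ₗ[K] P}

theorem IsSkewBiderivation.apply_word (hb : IsSkewBiderivation b)
    (hX : ∀ i j, b (X i) (X j) = evOne X (bracket i j)) (i : ℕ) (w : Word) :
    b (X i) (w.map X).prod = evOne X (bracketWord i w) := by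
  induction w with
  | nil => simpa [evOne, bracketWord] using hb.apply_one (X i)
  | cons k w ih =>
    rw [bracketWord, evOne_append, evOne_inContext, evOne_inContext, List.map_cons, List.prod_cons,
      hb.leibniz_right, ih, hX]
    simp

theorem IsSkewBiderivation.apply_evOne (hb : IsSkewBiderivation b)
    (hX : ∀ i j, b (X i) (X j) = evOne X (bracket i j)) (i : ℕ) (p : QPoly) :
    b (X i) (evOne X p) = evOne X (bracketPoly i p) := by
  induction p with
  | nil => simp [evOne, bracketPoly]
  | cons x p ih =>
    have h1 : evOne X (x :: p) = (x.2.atOne : K) • (x.1.map X).prod + evOne X p := by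
      rw [evOne, lin_cons, Scalar.val_one, evOne]
    have h2 : bracketPoly i (x :: p) = x.2 • bracketWord i x.1 ++ bracketPoly i p := rfl
    rw [h1, h2, map_add, map_smul, ih, evOne_append, evOne_smul, hb.apply_word hX]

theorem evOne_bracket_swap (i j : ℕ) : evOne X (bracket i j) = -evOne X (bracket j i) := by
  rcases lt_trichotomy i j with h | rfl | h
  · have h1 : Nat.blt i j = true := by simpa using h
    have h2 : Nat.blt j i = false := by simpa [← Bool.not_eq_true] using h.le
    simp [bracket, h1, h2, evOne_smul, Scalar.atOne]
  · have h2 : Nat.blt i i = false := by simp [← Bool.not_eq_true]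
    simp [bracket, h2, evOne]
  · have h1 : Nat.blt j i = true := by simpa using h
    have h2 : Nat.blt i j = false := by simpa [← Bool.not_eq_true] using h.le
    simp [bracket, h1, h2, evOne_smul, Scalar.atOne]

end

open MvPolynomial in
/-- The Poisson bracket on the polynomial algebra. -/
def poissonBracket :
    MvPolynomial (Fin 12) K →ₗ[K] MvPolynomial (Fin 12) K →ₗ[K] MvPolynomial (Fin 12) K :=
  LinearMap.mk₂ K
    (fun f g => mkDerivation K (fun i : Fin 12 => mkDerivation K fun j : Fin 12 =>
      evOne polyFamily.get (bracket i j)) f g)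
    (fun f f' g => by simp) (fun c f g => by simp) (fun f g g' => by simp) (fun c f g => by simp)

theorem polyFamily_get (k : Fin 12) : polyFamily.get k = MvPolynomial.X k := by
  fin_cases k <;> rfl

theorem poissonBracket_X (i j : Fin 12) :
    poissonBracket (MvPolynomial.X i) (MvPolynomial.X j) = evOne polyFamily.get (bracket i j) := by
  simp [poissonBracket, LinearMap.mk₂_apply, MvPolynomial.mkDerivation_X]

theorem isSkewBiderivation_poissonBracket : IsSkewBiderivation poissonBracket := by
  have h1 (x y z) : poissonBracket (x * y) z = x * poissonBracket y z + y * poissonBracket x z := by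
    simp [poissonBracket, LinearMap.mk₂_apply, Derivation.leibniz]
  have h2 (x y z) : poissonBracket x (y * z) = poissonBracket x y * z + y * poissonBracket x z := by
    simp only [poissonBracket, LinearMap.mk₂_apply, Derivation.leibniz, smul_eq_mul]
    ring
  refine ⟨fun x y => ?_, h1, h2⟩
  have : poissonBracket = -poissonBracket.flip := by
    refine biderivation_ext h1 h2 (fun x y z => ?_) (fun x y z => ?_) fun i j => ?_
    · simp only [LinearMap.neg_apply, LinearMap.flip_apply, h2]
      ring
    · simp only [LinearMap.neg_apply, LinearMap.flip_apply, h1]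
      ring
    · rw [LinearMap.neg_apply, LinearMap.neg_apply, LinearMap.flip_apply, poissonBracket_X,
        poissonBracket_X, evOne_bracket_swap]
  exact DFunLike.congr_fun (DFunLike.congr_fun this x) y

theorem bracket_eq_nil {i j : ℕ} (h : ¬(i < 12 ∧ j < 12)) : bracket i j = [] := by
  have key {i j : ℕ} (hij : i < j) (h : ¬ j < 12) : ordered j i = [] := by
    have : table.getD j [] = [] := List.getD_eq_default _ _ (by
      have : table.length = 12 := rfl
      omega)
    rw [ordered, this]
    rfl
  unfold bracket
  split
  · next h' =>
    rw [Nat.blt_eq] at h'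
    rw [key h' (by omega)]
    rfl
  · split
    · next h' =>
      rw [Nat.blt_eq] at h'
      rw [key h' (by omega)]
      rfl
    · rfl

theorem poissonBracket_get (i j : ℕ) :
    poissonBracket (polyFamily.get i) (polyFamily.get j) = evOne polyFamily.get (bracket i j) := by
  by_cases h : i < 12 ∧ j < 12
  · have := poissonBracket_X ⟨i, h.1⟩ ⟨j, h.2⟩
    rwa [← polyFamily_get, ← polyFamily_get] at this
  · rw [bracket_eq_nil h, evOne, lin_nil]
    have get_eq_zero {k : ℕ} (hk : 12 ≤ k) : polyFamily.get k = 0 := by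
      obtain ⟨n, rfl⟩ := Nat.exists_eq_add_of_le hk
      rw [add_comm]
      rfl
    rw [not_and_or, not_lt, not_lt] at h
    rcases h with h | h
    · simp [get_eq_zero h]
    · simp [get_eq_zero h]

theorem isPoissonBracket_poissonBracket : IsPoissonBracket poissonBracket := by
  have hb := isSkewBiderivation_poissonBracket
  refine hb.isPoissonBracket fun i j k hij hjk => ?_
  have h := evOne_eq_zero polyFamily.get (vanishesAtOne_jacobiator k k.2 j hjk i hij)
  rw [jacobiator, evOne_append, evOne_append, ← hb.apply_evOne poissonBracket_get,
    ← hb.apply_evOne poissonBracket_get, ← hb.apply_evOne poissonBracket_get,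
    ← poissonBracket_get, ← poissonBracket_get, ← poissonBracket_get] at h
  simpa only [polyFamily_get] using h

section

variable {A : Type*} [Ring A] [Algebra K A] {X : Fin 12 → A} {X' : ℕ → A}

open MvPolynomial in
theorem orderedMonomial_X (m : Fin 12 →₀ ℕ) :
    orderedMonomial MvPolynomial.X m = (monomial m 1 : MvPolynomial (Fin 12) K) := by
  rw [orderedMonomial, List.prod_ofFn, monomial_eq, C_1, one_mul, Finsupp.prod_fintype _ _ (by simp)]

theorem algebraMap_lin_one (L : Word → Prop) [DecidablePred L] (p : QPoly) :
    algebraMap ℂ K (lin (1 : ℂ) (fun w => if L w then (1 : ℂ) else 0) p) =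
      lin (1 : K) (fun w => if L w then (1 : K) else 0) p := by
  induction p with
  | nil => simp
  | cons x p ih =>
    rw [lin_cons, lin_cons, map_add, ih, Scalar.val_one, Scalar.val_one]
    split <;> simp

theorem IsPBW.sum_derivAtOne (hpbw : IsPBW X) (hX : ∀ i : Fin 12, X' i = X i)
    (hrel : ∀ i j, i < j → j < 12 → X' j * X' i = ev X' (ordered j i)) {i j : Fin 12}
    (hij : i < j) :
    ((hpbw.coeff i j).sum fun m c => MvPolynomial.monomial m (algebraMap ℂ K (derivAtOne c))) =
      evOne polyFamily.get (bracket j i) := by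
  have h1 : Nat.blt i j = true := by simpa using hij
  have h2 : evOne polyFamily.get (bracket j i) =
      lin (1 : K) (fun w => MvPolynomial.monomial (expo w) (1 : K)) (slope (ordered j i)) := by
    rw [bracket, h1, evOne]
    refine lin_congr fun x hx => ?_
    obtain ⟨v, hv, rfl⟩ := List.mem_map.1 hx
    obtain ⟨h3, h4⟩ := ordered_sorted j j.2 i hij v hv
    rw [prod_map_eq_orderedMonomial _ _ polyFamily_get h3 h4, orderedMonomial_X]
  ext n
  have h3 := map_lin (t := (1 : K)) (L := fun w => MvPolynomial.monomial (expo w) (1 : K))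
    (MvPolynomial.lcoeff K n) (slope (ordered j i))
  simp only [MvPolynomial.lcoeff_apply, MvPolynomial.coeff_monomial] at h3
  rw [h2, h3, ← algebraMap_lin_one, ← (hpbw.hasJetAtOne_coeff hX hrel hij n).2.2, Finsupp.sum,
    MvPolynomial.coeff_sum, Finset.sum_eq_single n]
  · rw [MvPolynomial.coeff_monomial, if_pos rfl]
  · intro m _ hm
    rw [MvPolynomial.coeff_monomial, if_neg hm]
  · intro hn
    rw [Finsupp.notMem_support_iff.1 hn, derivAtOne_zero, map_zero, map_zero,
      MvPolynomial.coeff_zero]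

theorem IsPBW.isClassicalLimit_poissonBracket (hpbw : IsPBW X) (hX : ∀ i : Fin 12, X' i = X i)
    (hrel : ∀ i j, i < j → j < 12 → X' j * X' i = ev X' (ordered j i)) :
    hpbw.IsClassicalLimit poissonBracket := by
  intro i j hij
  rw [poissonBracket_X, hpbw.sum_derivAtOne hX hrel hij]

theorem IsPBW.IsClassicalLimit.ext {hpbw : IsPBW X}
    {b b' : MvPolynomial (Fin 12) K →ₗ[K] MvPolynomial (Fin 12) K →ₗ[K] MvPolynomial (Fin 12) K}
    (h : hpbw.IsClassicalLimit b) (h' : hpbw.IsClassicalLimit b') (hb : IsSkewBiderivation b)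
    (hb' : IsSkewBiderivation b') : b = b' := by
  refine hb.ext hb' fun i j => ?_
  rcases lt_trichotomy i j with hij | rfl | hij
  · rw [hb.skew, hb'.skew, h i j hij, h' i j hij]
  · rw [hb.self, hb'.self]
  · rw [h j i hij, h' j i hij]

end

theorem evOne_neg {P : Type*} [CommRing P] [Algebra K P] (X : ℕ → P) (p : QPoly) :
    evOne X (([(-1, 0)] : Scalar) • p) = -evOne X p := by
  simp [evOne_smul, Scalar.atOne]

theorem evOne_cons {P : Type*} [CommRing P] [Algebra K P] (X : ℕ → P) (x : Word × Scalar)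
    (p : QPoly) : evOne X (x :: p) = (x.2.atOne : P) * (x.1.map X).prod + evOne X p := by
  rw [evOne, lin_cons, Scalar.val_one, Algebra.smul_def, map_intCast, evOne]

theorem evOne_nil {P : Type*} [CommRing P] [Algebra K P] (X : ℕ → P) : evOne X [] = 0 := rfl

theorem poissonTable : PoissonTable poissonBracket polyFamily := by
  have h0 : polyFamily.Y₂ = polyFamily.get 0 := rfl
  have h1 : polyFamily.Y₂ᵢ .one = polyFamily.get 1 := rfl
  have h2 : polyFamily.Y₂ᵢ .three = polyFamily.get 2 := rfl
  have h3 : polyFamily.Z₂ᵢ .one = polyFamily.get 3 := rfl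
  have h4 : polyFamily.Z₂ᵢ .three = polyFamily.get 4 := rfl
  have h5 : polyFamily.Y₁₃ = polyFamily.get 5 := rfl
  have h6 : polyFamily.Zᵢ₂ⱼ .one = polyFamily.get 6 := rfl
  have h7 : polyFamily.Zᵢ₂ⱼ .three = polyFamily.get 7 := rfl
  have h8 : polyFamily.Z₁₂₃₂ = polyFamily.get 8 := rfl
  have h9 : polyFamily.Z₁₃ = polyFamily.get 9 := rfl
  have h10 : polyFamily.Y .three = polyFamily.get 10 := rfl
  have h11 : polyFamily.Y .one = polyFamily.get 11 := rfl
  constructor <;> try rintro (_ | _)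
  all_goals
    simp only [Leg.other, h0, h1, h2, h3, h4, h5, h6, h7, h8, h9, h10, h11, poissonBracket_get]
    simp [evOne_neg, evOne_cons, evOne_nil, bracket, ordered, table, QPoly.slope, Scalar.slope,
      Scalar.atOne, Nat.blt]
    try ring

/-! ### The PBW generators of `𝒜_{q,4}` -/

theorem one_sub_ne_zero : 1 - q ^ 2 ≠ 0 :=
  Scalar.val_oneSub 2 ▸ Scalar.val_ne_zero (by decide)

theorem z₂_eq (i : Leg) : z₂ i = (1 - q ^ 2) • pbwFamily.Z₂ᵢ i :=
  (smul_inv_smul₀ one_sub_ne_zero _).symm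

theorem z₁₃_eq : z₁₃ = (1 - q ^ 2) ^ 2 • pbwFamily.Z₁₃ :=
  (smul_inv_smul₀ (pow_ne_zero 2 one_sub_ne_zero) _).symm

theorem pbwFamily_serreRelations :
    ∀ i, ∀ r ∈ serreRelations letters i, ev pbwFamily.get r.1 = ev pbwFamily.get r.2 :=
  (forall_serreRel_iff pbwFamily (RingQuot.mkAlgHom K SerreRel) (fun _ => rfl) rfl z₂_eq z₁₃_eq).1
    fun _ _ h => RingQuot.mkAlgHom_rel K h

theorem pbwFamily_primaryDefinitions (i : Leg) :
    ∀ r ∈ primaryDefinitions letters i, ev pbwFamily.get r.1 = ev pbwFamily.get r.2 := by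
  rw [primaryDefinitions_iff, ← z₂_eq, ← z₁₃_eq]
  exact ⟨rfl, rfl⟩

theorem pbwRelations_pbwFamily : PBWRelations pbwFamily :=
  pbwRelations_of_serreRelations pbwFamily pbwFamily_serreRelations pbwFamily_primaryDefinitions
    ((secondaryDefinitions_iff pbwFamily .one).2 ⟨rfl, rfl⟩)

theorem pbwFamily_get {i j : ℕ} (hij : i < j) (hj : j < 12) :
    pbwFamily.get j * pbwFamily.get i = ev pbwFamily.get (ordered j i) :=
  (pbwRelations_iff_ordered pbwFamily).1 pbwRelations_pbwFamily i j hij hj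

/-- The formulae for `Y₁₃` and `Z₁₂₃₂` hold for both choices of `i`, since they follow from the PBW
relations. -/
theorem pbwFamily_eq (i : Leg) : pbwFamily.Y₁₃ = elY₂₁₃ i ∧ pbwFamily.Z₁₂₃₂ = elZ₂₁₃₂ i :=
  (secondaryDefinitions_iff pbwFamily i).1
    (of_vanish (fun _ _ => pbwFamily_get) (vanish_secondaryDefinitions i))

theorem adjoin_pbwFamily : Algebra.adjoin K (Set.range pbwFamily.seq) = ⊤ := by
  have hgen := congrArg (Subalgebra.map (RingQuot.mkAlgHom K SerreRel))
    (FreeAlgebra.adjoin_range_ι K Gen)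
  rw [AlgHom.map_adjoin, ← Set.range_comp, Algebra.map_top,
    (AlgHom.range_eq_top _).2 (RingQuot.mkAlgHom_surjective K _)] at hgen
  rw [eq_top_iff, ← hgen, Algebra.adjoin_le_iff]
  have hX (k : Fin 12) : pbwFamily.get k ∈ Algebra.adjoin K (Set.range pbwFamily.seq) :=
    pbwFamily.seq_eq_get k ▸ Algebra.subset_adjoin ⟨k, rfl⟩
  rintro _ ⟨i | _ | i | _, rfl⟩
  · cases i with
    | one => exact hX 11
    | three => exact hX 10
  · exact hX 0
  · change z₂ i ∈ Algebra.adjoin K (Set.range pbwFamily.seq)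
    rw [z₂_eq]
    refine Subalgebra.smul_mem _ ?_ _
    cases i with
    | one => exact hX 3
    | three => exact hX 4
  · change z₁₃ ∈ Algebra.adjoin K (Set.range pbwFamily.seq)
    rw [z₁₃_eq]
    exact Subalgebra.smul_mem _ (hX 9) _

/-- The PBW relations imply the relations of `𝒜_{q,4}` and the formulae for the PBW generators. -/
theorem exists_algHom {B : Type*} [Ring B] [Algebra K B] {F : Family B}
    (hF : ∀ i j, i < j → j < 12 → F.get j * F.get i = ev F.get (ordered j i)) :
    ∃ φ : Aq4 →ₐ[K] B, ∀ k, φ (pbwFamily.seq k) = F.seq k := by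
  let f : FreeAlgebra K Gen →ₐ[K] B := FreeAlgebra.lift K fun
    | .u i => F.Y i
    | .u₂ => F.Y₂
    | .z₂ i => (1 - q ^ 2) • F.Z₂ᵢ i
    | .z₁₃ => (1 - q ^ 2) ^ 2 • F.Z₁₃
  have hf := (forall_serreRel_iff F f (fun i => by simp [f, fu]) (by simp [f, fu₂])
    (fun i => by simp [f, fz₂]) (by simp [f, fz₁₃])).2
    fun i => of_vanish hF (vanish_serreRelations i)
  let φ : Aq4 →ₐ[K] B := RingQuot.liftAlgHom K ⟨f, fun x y h => hf x y h⟩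
  have hφ (x) : φ (RingQuot.mkAlgHom K SerreRel x) = f x := by simp [φ]
  have hu (i) : φ (u i) = F.Y i := (hφ _).trans (by simp [f, fu])
  have hu₂ : φ u₂ = F.Y₂ := (hφ _).trans (by simp [f, fu₂])
  have hz₂ (i) : φ (z₂ i) = (1 - q ^ 2) • F.Z₂ᵢ i := (hφ _).trans (by simp [f, fz₂])
  have hz₁₃ : φ z₁₃ = (1 - q ^ 2) ^ 2 • F.Z₁₃ := (hφ _).trans (by simp [f, fz₁₃])
  have hd (i) := (primaryDefinitions_iff F i).1 (of_vanish hF (vanish_primaryDefinitions i))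
  have hd' := (secondaryDefinitions_iff F .one).1 (of_vanish hF (vanish_secondaryDefinitions .one))
  have hY₂ᵢ (i) : φ (elY₂ᵢ i) = F.Y₂ᵢ i := by
    rw [(hd i).1]
    simp [elY₂ᵢ, hu, hu₂, hz₂]
  have hZ₂ᵢ (i) : φ (elZ₂ᵢ i) = F.Z₂ᵢ i := by
    rw [elZ₂ᵢ, map_smul, hz₂, inv_smul_smul₀ one_sub_ne_zero]
  have hZᵢ₂ⱼ (i) : φ (elZᵢ₂ⱼ i) = F.Zᵢ₂ⱼ i := by
    rw [(hd i).2]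
    simp [elZᵢ₂ⱼ, qbr, hu, hz₁₃, hz₂]
  have hY₁₃ : φ (elY₂₁₃ .one) = F.Y₁₃ := by
    rw [hd'.1]
    simp [elY₂₁₃, qbr, hu, hY₂ᵢ, hZᵢ₂ⱼ]
  have hZ₁₂₃₂ : φ (elZ₂₁₃₂ .one) = F.Z₁₂₃₂ := by
    rw [hd'.2]
    simp [elZ₂₁₃₂, hY₂ᵢ, hZ₂ᵢ]
  have hZ₁₃ : φ (((1 - q ^ 2) ^ 2)⁻¹ • z₁₃) = F.Z₁₃ := by
    rw [map_smul, hz₁₃, inv_smul_smul₀ (pow_ne_zero 2 one_sub_ne_zero)]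
  refine ⟨φ, fun k => ?_⟩
  fin_cases k
  exacts [hu₂, hY₂ᵢ _, hY₂ᵢ _, hZ₂ᵢ _, hZ₂ᵢ _, hY₁₃, hZᵢ₂ⱼ _, hZᵢ₂ⱼ _, hZ₁₂₃₂, hZ₁₃, hu _, hu _]

/-- The letter operators, labelled like the PBW generators. -/
def operators : Family (Module.End K (Word →₀ K)) where
  Y₂ := letterOperator 0
  Y | .one => letterOperator 11
    | .three => letterOperator 10
  Y₂ᵢ | .one => letterOperator 1
      | .three => letterOperator 2
  Y₁₃ := letterOperator 5
  Z₂ᵢ | .one => letterOperator 3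
      | .three => letterOperator 4
  Zᵢ₂ⱼ | .one => letterOperator 6
       | .three => letterOperator 7
  Z₁₂₃₂ := letterOperator 8
  Z₁₃ := letterOperator 9

theorem operators_get {k : ℕ} (hk : k < 12) : operators.get k = letterOperator k := by
  interval_cases k <;> rfl

theorem ev_congr {A : Type*} [Ring A] [Algebra K A] {X X' : ℕ → A} {p : QPoly}
    (h : ∀ v ∈ p, ∀ k ∈ v.1, X k = X' k) : ev X p = ev X' p :=
  lin_congr fun v hv => by rw [List.map_congr_left (h v hv)]

theorem isPBW_pbwFamily : IsPBW pbwFamily.seq := by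
  obtain ⟨ρ, hρ⟩ := exists_algHom (F := operators) fun i j hij hj => by
    rw [operators_get hj, operators_get (hij.trans hj), letterOperator_mul hij hj]
    exact ev_congr fun v hv k hk => (operators_get ((ordered_sorted j hj i hij v hv).1 k hk)).symm
  refine isPBW (fun k => (pbwFamily.seq_eq_get k).symm) (fun _ _ => pbwFamily_get)
    adjoin_pbwFamily ρ fun k => ?_
  rw [hρ, operators.seq_eq_get, operators_get k.2]

end SlFourFolding

end

theorem theorem4p6 :
    -- the formulae for `Y₂₁₃` and `Z₂₁₃₂` do not depend on the choice of `{i, j} = {1, 3}`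
    (elY₂₁₃ .one = elY₂₁₃ .three ∧ elZ₂₁₃₂ .one = elZ₂₁₃₂ .three) ∧
    -- the PBW relations hold in `𝒜_{q,4}` and they are defining relations
    (PBWRelations pbwFamily ∧
      ∀ (B : Type*) [Ring B] [Algebra K B] (F : Family B), PBWRelations F →
        ∃! φ : Aq4 →ₐ[K] B, ∀ k, φ (pbwFamily.seq k) = F.seq k) ∧
    -- `𝒜_{q,4}` is PBW and optimal specializable
    ∃ hX : IsPBW pbwFamily.seq,
      hX.OptimalSpecializable ∧
      (∃ e : hX.Specialization ≃ₐ[K] MvPolynomial (Fin 12) K,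
        ∀ k, e (hX.specGen k) = MvPolynomial.X k) ∧
      -- its classical limit is a well-defined Poisson bracket, given by the explicit table
      ∃ b : MvPolynomial (Fin 12) K →ₗ[K] MvPolynomial (Fin 12) K →ₗ[K] MvPolynomial (Fin 12) K,
        IsPoissonBracket b ∧ hX.IsClassicalLimit b ∧ PoissonTable b polyFamily ∧
        ∀ b', IsSkewBiderivation b' → hX.IsClassicalLimit b' → b' = b := by
  have hX (k : Fin 12) : pbwFamily.get k = pbwFamily.seq k := (pbwFamily.seq_eq_get k).symm
  have hrel (i j : ℕ) (hij : i < j) (hj : j < 12) := pbwFamily_get hij hj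
  have hopt := isPBW_pbwFamily.optimalSpecializable hX hrel
  have hlim := isPBW_pbwFamily.isClassicalLimit_poissonBracket hX hrel
  refine ⟨⟨(pbwFamily_eq .three).1, (pbwFamily_eq .three).2⟩,
    ⟨pbwRelations_pbwFamily, fun B _ _ F hF => ?_⟩, isPBW_pbwFamily, hopt, hopt.exists_algEquiv,
    poissonBracket, isPoissonBracket_poissonBracket, hlim, poissonTable,
    fun b' hb' h' => h'.ext hlim hb' isSkewBiderivation_poissonBracket⟩
  obtain ⟨φ, hφ⟩ := exists_algHom ((pbwRelations_iff_ordered F).1 hF)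
  refine ⟨φ, hφ, fun ψ hψ => AlgHom.ext_of_adjoin_eq_top adjoin_pbwFamily ?_⟩
  rintro _ ⟨k, rfl⟩
  exact (hψ k).trans (hφ k).symm
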